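/- Throughout, representations are finite-dimensional and over $\mathbb{C}$. For a finite group $G$ let $G\wr S_n=G^n\rtimes S_n$ be the wreath product. Let $\mathrm{rep}(G\wr S_*)=\bigoplus_{n\ge 0}\mathrm{rep}(G\wr S_n)$ be the category of families $E=(E_n)_{n\ge 0}$ of representations $E_n$ of $G\wr S_n$, almost all of them zero, with the monoidal structure given by the induction product $$(E\cdot F)_n=\bigoplus_{p+q=n}\mathrm{Ind}_{(G\wr S_p)\times(G\wr S_q)}^{G\wr S_n}(E_p\boxtimes F_q),$$ whose unit is the trivial representation of $G\wr S_0$ in degree $0$. A functor $F\colon\mathrm{rep}(G)\to\mathrm{vect}_{\mathbb{C}}$ is called polynomial of bounded total degree if there is a $d$ such that for all $f_1,\dots,f_s\colon V\to W$ in $\mathrm{rep}(G)$ the map $\mathbb{C}^s\to\mathrm{Hom}(F(V),F(W))$, $(c_1,\dots,c_s)\mapsto F(c_1f_1+\dots+c_sf_s)$, is polynomial of total degree at most $d$. These functors and their natural transformations form a monoidal category under the pointwise tensor product. For $V\in\mathrm{rep}(G)$ the group $G\wr S_n$ acts on $T^n(V)=V^{\otimes n}$, and $E_n\otimes_{G\wr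 S_n}T^n(V)$ denotes the coinvariants of the diagonal action on $E_n\otimes V^{\otimes n}$. **Theorem.** (a) For every finite group $G$ the formula $\Xi(E)(V)=\bigoplus_n E_n\otimes_{G\wr S_n}T^n(V)$ defines an equivalence of monoidal categories $$\Xi\colon \mathrm{rep}(G\wr S_*)\xrightarrow{\ \simeq\ }\{\text{polynomial functors }\mathrm{rep}(G)\to\mathrm{vect}_{\mathbb{C}}\text{ of bounded total degree}\}.$$ (b) Let $G$ be a finite abelian group with character group $\hat G=\mathrm{Hom}(G,\mathbb{C}^\times)$; extend each $\chi\in\hat G$ linearly to $\mathbb{C}[G]$. For $R\in\{\mathbb{Z},\mathbb{C}\}$ let $\Lambda_R(G)$ be the ring of symmetric polynomial class functions with coefficients in $R$, that is, of families of functions $f_d\colon\mathbb{C}[G]^d\to\mathbb{C}$ $(d\ge 0)$ such that, for some $N$ independent of $d$, each $f_d(x_1,\dots,x_d)$ is a polynomial of degree at most $N$ with coefficients in $R$ in the coordinates $\chi(x_i)$, invariant under permuting, separately for each $\chi$, the coordinates $\chi(x_1),\dots,\chi(x_d)$, and such that $f_{d+1}(x_1,\dots,x_d,0)=f_d(x_1,\dots,x_d)$.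 For $r\ge1$ and $c\in G$ let $p_r(c)(x_1,\dots,x_d)=\sum_{i=1}^d\sum_{\chi\in\hat G}\chi(c)\chi(x_i)^r$, and for $w=(a,\pi)\in G\wr S_n$ let $\Psi(w)$ be the product over the cycles of $\pi$ of $p_r(c)$, where $r$ is the length of the cycle and $c$ is the product of the $a_i$ over it. Then there is an isomorphism of rings, the characteristic map $$\mathrm{ch}\colon K_0(\mathrm{rep}(G\wr S_*))\xrightarrow{\ \cong\ }\Lambda_{\mathbb{Z}}(G),\qquad \mathrm{ch}[E]=\sum_n\frac{1}{|G\wr S_n|}\sum_{w\in G\wr S_n}\mathrm{tr}(w\mid E_n)\,\Psi(w),$$ where $[E][F]=[E\cdot F]$; the same formula gives an isomorphism $\mathbb{C}\otimes K_0(\mathrm{rep}(G\wr S_*))\cong\Lambda_{\mathbb{C}}(G)$. Moreover $\Xi$ categorifies $\mathrm{ch}$: the Grothendieck group $K_0$ of the category of polynomial functors (with respect to pointwise exact sequences, with the product $[F][H]=[F\otimes H]$) is isomorphic as a ring to $\Lambda_{\mathbb{Z}}(G)$ through $\mathrm{ch}'$, which sends $[F]$ to its character $$(x_1,\dots,x_d)\longmapsto\mathrm{tr}\bigl(F(\mathrm{diag}(x_1,\dots,x_d))\mid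 F(\mathbb{C}[G]^d)\bigr),$$ and $\mathrm{ch}'[\Xi(E)]=\mathrm{ch}[E]$ for all $E$. -/

import Mathlib

open CategoryTheory MonoidalCategory
open scoped TensorProduct DirectSum MonoidAlgebra

noncomputable section

namespace WreathPoly

/-- The wreath product `G ≀ S_n = G^n ⋊ S_n`, where `S_n` permutes the coordinates. -/
abbrev Wr (G : Type) [Group G] (n : ℕ) : Type :=
  (Fin n → G) ⋊[mulAutArrow] Equiv.Perm (Fin n)

/-- Juxtaposition `{1, …, p} ⊔ {1, …, q} ≃ {1, …, n}` for `p + q = n`. -/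
def juxt {p q n : ℕ} (h : p + q = n) : Fin p ⊕ Fin q ≃ Fin n :=
  finSumFinEquiv.trans (finCongr h)

/-- The block inclusion `(G ≀ S_p) × (G ≀ S_q) → G ≀ S_n` for `p + q = n`. -/
def block (G : Type) [Group G] {p q n : ℕ} (h : p + q = n) : Wr G p × Wr G q →* Wr G n where
  toFun w :=
    ⟨fun i => Sum.elim w.1.left w.2.left ((juxt h).symm i),
      (juxt h).permCongr (Equiv.sumCongr w.1.right w.2.right)⟩
  map_one' := by
    ext i
    · obtain ⟨j, rfl⟩ := (juxt h).surjective i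
      cases j <;> simp
    · simp
  map_mul' v w := by
    ext i
    · obtain ⟨j, rfl⟩ := (juxt h).surjective i
      cases j with
      | inl j =>
        have hj : (juxt h).symm (((juxt h).permCongr
            (Equiv.sumCongr v.1.right v.2.right)).symm (juxt h (.inl j))) =
              .inl (v.1.right.symm j) :=
          (juxt h).symm_apply_eq.2 ((Equiv.symm_apply_eq _).2 (by simp [Equiv.permCongr_apply]))
        simp only [SemidirectProduct.mul_left, Pi.mul_apply, Prod.fst_mul, Prod.snd_mul,
          Equiv.symm_apply_apply, Sum.elim_inl]
        refine congrArg (v.1.left j * ·) ?_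
        exact (congrArg (Sum.elim w.1.left w.2.left) hj).symm
      | inr j =>
        have hj : (juxt h).symm (((juxt h).permCongr
            (Equiv.sumCongr v.1.right v.2.right)).symm (juxt h (.inr j))) =
              .inr (v.2.right.symm j) :=
          (juxt h).symm_apply_eq.2 ((Equiv.symm_apply_eq _).2 (by simp [Equiv.permCongr_apply]))
        simp only [SemidirectProduct.mul_left, Pi.mul_apply, Prod.fst_mul, Prod.snd_mul,
          Equiv.symm_apply_apply, Sum.elim_inr]
        refine congrArg (v.2.left j * ·) ?_
        exact (congrArg (Sum.elim w.1.left w.2.left) hj).symm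
    · obtain ⟨j, rfl⟩ := (juxt h).surjective i
      cases j <;> simp [Equiv.permCongr_apply]

/-- The skeleton of the groupoid of finitely generated free `G`-sets: the objects are the natural
numbers, and a morphism `m ⟶ n` is a bijection with labels in `G`; so there are only
automorphisms, and `n` has automorphism group `G ≀ S_n`. -/
structure Blk (G : Type) [Group G] where
  rank : ℕ

namespace Blk

variable {G : Type} [Group G]

@[ext]
structure Hom (X Y : Blk G) where
  perm : Fin X.rank ≃ Fin Y.rank
  lab : Fin Y.rank → G

instance : Category (Blk G) where
  Hom := Hom
  id X := ⟨Equiv.refl _, fun _ => 1⟩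
  comp f g := ⟨f.perm.trans g.perm, fun i => g.lab i * f.lab (g.perm.symm i)⟩
  id_comp f := by apply Hom.ext <;> simp
  comp_id f := by apply Hom.ext <;> simp
  assoc f g h := by apply Hom.ext <;> simp [Equiv.trans_assoc, mul_assoc]

@[simp] lemma id_perm (X : Blk G) : Hom.perm (𝟙 X) = Equiv.refl _ := rfl
@[simp] lemma comp_perm {X Y Z : Blk G} (f : X ⟶ Y) (g : Y ⟶ Z) :
    Hom.perm (f ≫ g) = (Hom.perm f).trans (Hom.perm g) := rfl

/-- The label of the image of `i`. -/
def val {X Y : Blk G} (f : X ⟶ Y) (i : Fin X.rank) : G := Hom.lab f (Hom.perm f i)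

@[simp] lemma val_id (X : Blk G) (i : Fin X.rank) : val (𝟙 X) i = 1 := rfl

@[simp] lemma val_comp {X Y Z : Blk G} (f : X ⟶ Y) (g : Y ⟶ Z) (i : Fin X.rank) :
    val (f ≫ g) i = val g (Hom.perm f i) * val f i :=
  congrArg (fun j => Hom.lab g (Hom.perm g (Hom.perm f i)) * Hom.lab f j)
    ((Hom.perm g).symm_apply_apply _)

lemma hom_ext {X Y : Blk G} {f g : X ⟶ Y} (h₁ : ∀ i, Hom.perm f i = Hom.perm g i)
    (h₂ : ∀ i, val f i = val g i) : f = g := by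
  have h : Hom.perm f = Hom.perm g := Equiv.ext h₁
  apply Hom.ext h
  funext i
  obtain ⟨j, rfl⟩ := (Hom.perm f).surjective i
  exact (h₂ j).trans (congrArg (Hom.lab g) (h₁ j).symm)

/-- Two objects of the same rank are isomorphic. -/
def castIso {X Y : Blk G} (h : X.rank = Y.rank) : X ≅ Y where
  hom := ⟨finCongr h, fun _ => 1⟩
  inv := ⟨finCongr h.symm, fun _ => 1⟩
  hom_inv_id := hom_ext (fun _ => rfl) fun _ => mul_one 1
  inv_hom_id := hom_ext (fun _ => rfl) fun _ => mul_one 1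

/-- Addition of ranks. -/
def add (X Y : Blk G) : Blk G := ⟨X.rank + Y.rank⟩

def inl {X Y : Blk G} (i : Fin X.rank) : Fin (add X Y).rank := Fin.castAdd Y.rank i

def inr {X Y : Blk G} (i : Fin Y.rank) : Fin (add X Y).rank := Fin.natAdd X.rank i

lemma add_cases {X Y : Blk G} {P : Fin (add X Y).rank → Prop} (h₁ : ∀ i, P (inl i))
    (h₂ : ∀ i, P (inr i)) (i : Fin (add X Y).rank) : P i :=
  Fin.addCases (m := X.rank) (n := Y.rank) (motive := P) h₁ h₂ i

/-- Juxtaposition of labelled bijections. -/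
def tens {X X' Y Y' : Blk G} (f : X ⟶ X') (g : Y ⟶ Y') : add X Y ⟶ add X' Y' where
  perm := (finSumFinEquiv.symm.trans (Equiv.sumCongr f.perm g.perm)).trans finSumFinEquiv
  lab i := Sum.elim f.lab g.lab (finSumFinEquiv.symm i)

section

variable {X X' Y Y' : Blk G} (f : X ⟶ X') (g : Y ⟶ Y')

@[simp] lemma tens_perm_inl (i : Fin X.rank) :
    Hom.perm (tens f g) (inl i) = inl (Hom.perm f i) :=
  congrArg (fun j => finSumFinEquiv (Equiv.sumCongr (Hom.perm f) (Hom.perm g) j))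
    (finSumFinEquiv_symm_apply_castAdd i)

@[simp] lemma tens_perm_inr (i : Fin Y.rank) :
    Hom.perm (tens f g) (inr i) = inr (Hom.perm g i) :=
  congrArg (fun j => finSumFinEquiv (Equiv.sumCongr (Hom.perm f) (Hom.perm g) j))
    (finSumFinEquiv_symm_apply_natAdd i)

@[simp] lemma tens_val_inl (i : Fin X.rank) : val (tens f g) (inl i) = val f i := by
  simp only [val, tens_perm_inl]
  exact congrArg (Sum.elim _ _) (finSumFinEquiv_symm_apply_castAdd _)

@[simp] lemma tens_val_inr (i : Fin Y.rank) : val (tens f g) (inr i) = val g i := by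
  simp only [val, tens_perm_inr]
  exact congrArg (Sum.elim _ _) (finSumFinEquiv_symm_apply_natAdd _)

end

variable (X Y Z : Blk G)

def assoc : add (add X Y) Z ≅ add X (add Y Z) := castIso (Nat.add_assoc _ _ _)

def leftU : add ⟨0⟩ X ≅ X := castIso (Nat.zero_add _)

def rightU : add X ⟨0⟩ ≅ X := castIso (Nat.add_zero _)

@[simp] lemma assoc_val (i : Fin (add (add X Y) Z).rank) : val (assoc X Y Z).hom i = 1 := rfl

@[simp] lemma assoc_perm₁ (i : Fin X.rank) :
    Hom.perm (assoc X Y Z).hom (inl (inl i)) = inl i := rfl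

@[simp] lemma assoc_perm₂ (i : Fin Y.rank) :
    Hom.perm (assoc X Y Z).hom (inl (inr i)) = inr (inl i) := rfl

@[simp] lemma assoc_perm₃ (i : Fin Z.rank) :
    Hom.perm (assoc X Y Z).hom (inr i) = inr (inr i) := Fin.ext (Nat.add_assoc _ _ _)

@[simp] lemma leftU_val (i : Fin (add ⟨0⟩ X).rank) : val (leftU X).hom i = 1 := rfl

@[simp] lemma leftU_perm (i : Fin X.rank) :
    Hom.perm (leftU X).hom (inr i) = i := Fin.ext (Nat.zero_add _)

@[simp] lemma rightU_val (i : Fin (add X ⟨0⟩).rank) : val (rightU X).hom i = 1 := rfl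

@[simp] lemma rightU_perm (i : Fin X.rank) :
    Hom.perm (rightU X).hom (inl i) = i := rfl

instance : MonoidalCategoryStruct (Blk G) where
  tensorObj := add
  tensorHom f g := tens f g
  whiskerLeft X _ _ g := tens (𝟙 X) g
  whiskerRight f Y := tens f (𝟙 Y)
  tensorUnit := ⟨0⟩
  associator := assoc
  leftUnitor := leftU
  rightUnitor := rightU

attribute [local simp] MonoidalCategoryStruct.tensorObj MonoidalCategoryStruct.tensorHom
  MonoidalCategoryStruct.associator MonoidalCategoryStruct.leftUnitor
  MonoidalCategoryStruct.rightUnitor MonoidalCategoryStruct.tensorUnit in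
instance : MonoidalCategory (Blk G) :=
  MonoidalCategory.ofTensorHom
    (id_tensorHom_id := fun X Y => by
      apply hom_ext <;> refine add_cases ?_ ?_ <;> intro i <;> simp)
    (id_tensorHom := fun _ _ _ _ => rfl)
    (tensorHom_id := fun _ _ => rfl)
    (tensorHom_comp_tensorHom := fun f₁ f₂ g₁ g₂ => by
      apply hom_ext <;> refine add_cases ?_ ?_ <;> intro i <;> simp)
    (associator_naturality := fun f₁ f₂ f₃ => by
      apply hom_ext <;> refine add_cases (add_cases ?_ ?_) ?_ <;> intro i <;> simp)
    (leftUnitor_naturality := fun f => by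
      apply hom_ext <;> refine add_cases (fun i => i.elim0) ?_ <;> intro i <;> simp)
    (rightUnitor_naturality := fun f => by
      apply hom_ext <;> refine add_cases ?_ (fun i => i.elim0) <;> intro i <;> simp)
    (pentagon := fun W X Y Z => by
      apply hom_ext <;> refine add_cases (add_cases (add_cases ?_ ?_) ?_) ?_ <;> intro i <;> simp)
    (triangle := fun X Y => by
      apply hom_ext <;> refine add_cases (add_cases ?_ (fun i => i.elim0)) ?_ <;>
        intro i <;> simp)

end Blk

section Source

variable (G : Type) [Group G]

instance wrFinite [Finite G] (n : ℕ) : Finite (Wr G n) :=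
  Finite.of_injective (fun w : Wr G n => (w.left, w.right)) fun _ _ h =>
    SemidirectProduct.ext (congrArg Prod.fst h) (congrArg Prod.snd h)

/-- Only finitely many of the representations are nonzero. -/
def IsBounded : ObjectProperty (∀ n : ℕ, FDRep ℂ (Wr G n)) :=
  fun E => ∃ N : ℕ, ∀ n, N ≤ n → Subsingleton (E n)

/-- The category `⨁_n rep(G ≀ S_n)`: families of finite-dimensional complex representations of the
groups `G ≀ S_n`, almost all of them zero. -/
abbrev WreathRep : Type 1 := (IsBounded G).FullSubcategory

variable {G}

namespace WreathRep

/-- The component in degree `n`. -/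
abbrev deg (E : WreathRep G) (n : ℕ) : FDRep ℂ (Wr G n) := E.obj n

/-- The linear map underlying the component of a morphism in degree `n`. -/
def lin {E F : WreathRep G} (f : E ⟶ F) (n : ℕ) : E.deg n →ₗ[ℂ] F.deg n :=
  (f.hom n).hom.hom.hom

lemma lin_rho {E F : WreathRep G} (f : E ⟶ F) (n : ℕ) (w : Wr G n) (x : E.deg n) :
    lin f n ((E.deg n).ρ w x) = (F.deg n).ρ w (lin f n x) :=
  LinearMap.congr_fun (congrArg (fun g => g.hom.hom) ((f.hom n).comm w)) x

lemma lin_ext {E F : WreathRep G} {f g : E ⟶ F} (h : ∀ n x, lin f n x = lin g n x) : f = g := by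
  apply ObjectProperty.hom_ext
  funext n
  apply Action.hom_ext
  exact FGModuleCat.hom_ext (LinearMap.ext (h n))

/-- Build a morphism from a family of equivariant maps. -/
def mkHom {E F : WreathRep G} (f : ∀ n, E.deg n →ₗ[ℂ] F.deg n)
    (h : ∀ n w x, f n ((E.deg n).ρ w x) = (F.deg n).ρ w (f n x)) : E ⟶ F :=
  ObjectProperty.homMk fun n =>
    { hom := ObjectProperty.homMk (ModuleCat.ofHom (f n))
      comm := fun w => FGModuleCat.hom_ext (LinearMap.ext (h n w)) }

@[simp] lemma lin_mkHom {E F : WreathRep G} (f : ∀ n, E.deg n →ₗ[ℂ] F.deg n)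
    (h : ∀ n w x, f n ((E.deg n).ρ w x) = (F.deg n).ρ w (f n x)) (n : ℕ) :
    lin (mkHom f h) n = f n := rfl

@[simp] lemma lin_id (E : WreathRep G) (n : ℕ) : lin (𝟙 E) n = LinearMap.id := rfl

@[simp] lemma lin_comp {E F H : WreathRep G} (f : E ⟶ F) (g : F ⟶ H) (n : ℕ) :
    lin (f ≫ g) n = lin g n ∘ₗ lin f n := rfl

/-- Transport along an equality of degrees. -/
def cast (E : WreathRep G) {m n : ℕ} (h : m = n) : E.deg m →ₗ[ℂ] E.deg n :=
  h ▸ LinearMap.id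

@[simp] lemma cast_rfl (E : WreathRep G) (n : ℕ) : E.cast (rfl : n = n) = LinearMap.id := rfl

end WreathRep

namespace Blk

lemma rank_eq {X Y : Blk G} (f : X ⟶ Y) : X.rank = Y.rank := by
  simpa using Fintype.card_congr (Hom.perm f)

/-- A labelled bijection between sets of the same size, as an element of the wreath product. -/
def toWr {X Y : Blk G} (f : X ⟶ Y) : Wr G Y.rank :=
  ⟨Hom.lab f, (finCongr (rank_eq f).symm).trans (Hom.perm f)⟩

/-- An element of the wreath product, as an automorphism. -/
def ofWr {n : ℕ} (w : Wr G n) : (⟨n⟩ : Blk G) ⟶ ⟨n⟩ := Hom.mk w.right w.left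

@[simp] lemma toWr_ofWr {n : ℕ} (w : Wr G n) : toWr (ofWr w) = w := rfl

@[simp] lemma ofWr_toWr {n : ℕ} (f : (⟨n⟩ : Blk G) ⟶ ⟨n⟩) : ofWr (toWr f) = f := rfl

lemma toWr_id (X : Blk G) : toWr (𝟙 X) = 1 := rfl

lemma toWr_comp {n : ℕ} (f g : (⟨n⟩ : Blk G) ⟶ ⟨n⟩) : toWr (f ≫ g) = toWr g * toWr f := rfl

end Blk

open Blk WreathRep

/-- The action of labelled bijections on a family of representations. -/
def act (E : WreathRep G) {X Y : Blk G} (f : X ⟶ Y) : E.deg X.rank →ₗ[ℂ] E.deg Y.rank :=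
  (E.deg Y.rank).ρ (toWr f) ∘ₗ E.cast (rank_eq f)

lemma act_comp (E : WreathRep G) {X Y Z : Blk G} (f : X ⟶ Y) (g : Y ⟶ Z) :
    act E (f ≫ g) = act E g ∘ₗ act E f := by
  obtain ⟨m⟩ := X
  obtain ⟨n⟩ := Y
  obtain ⟨k⟩ := Z
  obtain rfl : m = n := rank_eq f
  obtain rfl : m = k := rank_eq g
  exact (E.deg m).ρ.map_mul (toWr g) (toWr f)

lemma act_nat {E F : WreathRep G} (φ : E ⟶ F) {X Y : Blk G} (f : X ⟶ Y) (x : E.deg X.rank) :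
    lin φ Y.rank (act E f x) = act F f (lin φ X.rank x) := by
  obtain ⟨m⟩ := X
  obtain ⟨n⟩ := Y
  obtain rfl : m = n := rank_eq f
  exact lin_rho φ m (toWr f) x

/-- A family of representations of the `G ≀ S_n` as a functor on the groupoid of free `G`-sets. -/
def toFun (G : Type) [Group G] : WreathRep G ⥤ Blk G ⥤ ModuleCat.{0} ℂ where
  obj E :=
    { obj X := ModuleCat.of ℂ (E.deg X.rank)
      map f := ModuleCat.ofHom (act E f)
      map_id X := ModuleCat.hom_ext ((E.deg X.rank).ρ.map_one)
      map_comp f g := ModuleCat.hom_ext (act_comp E f g) }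
  map φ :=
    { app X := ModuleCat.ofHom (lin φ X.rank)
      naturality X Y f := ModuleCat.hom_ext (LinearMap.ext fun x => act_nat φ f x) }

def toFunFF (G : Type) [Group G] : (toFun G).FullyFaithful where
  preimage {E F} φ := mkHom (fun n => (φ.app ⟨n⟩).hom) fun n w x =>
    LinearMap.congr_fun (congrArg ModuleCat.Hom.hom (φ.naturality (ofWr w))) x

/-- The external tensor product of representations of two groups. -/
def extProd {H K : Type} [Group H] [Group K] {A B : Type} [AddCommGroup A] [Module ℂ A]
    [AddCommGroup B] [Module ℂ B] (ρ : Representation ℂ H A) (σ : Representation ℂ K B) :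
    Representation ℂ (H × K) (A ⊗[ℂ] B) :=
  Representation.tprod (ρ.comp (MonoidHom.fst H K)) (σ.comp (MonoidHom.snd H K))

/-- The summand of the induction product indexed by `p + q = n`. -/
abbrev indSummand (E F : WreathRep G) (n : ℕ) (pq : Finset.HasAntidiagonal.antidiagonal n) : Type :=
    Representation.IndV (block G (Finset.HasAntidiagonal.mem_antidiagonal.1 pq.2))
      (extProd (E.deg pq.1.1).ρ (F.deg pq.1.2).ρ)
 
/-- The underlying space of the degree `n` part of the induction product. -/
abbrev IndSum (E F : WreathRep G) (n : ℕ) : Type :=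
  ⨁ pq : Finset.HasAntidiagonal.antidiagonal n, indSummand E F n pq

/-- The action on the degree `n` part of the induction product. -/
def indProdRep (E F : WreathRep G) (n : ℕ) :
    Representation ℂ (Wr G n) (IndSum E F n) :=
  Representation.directSum fun pq : Finset.HasAntidiagonal.antidiagonal n =>
    Representation.ind (block G (Finset.HasAntidiagonal.mem_antidiagonal.1 pq.2))
      (extProd (E.deg pq.1.1).ρ (F.deg pq.1.2).ρ)

/-- The induction product: in degree `n` it is the direct sum over `p + q = n` of the
representations induced from `E_p ⊠ F_q` along `(G ≀ S_p) × (G ≀ S_q) → G ≀ S_n`. -/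
def indProd [Finite G] (E F : WreathRep G) : WreathRep G where
  obj n := FDRep.of (indProdRep E F n)
  property := by
    obtain ⟨N, hN⟩ := E.property
    obtain ⟨M, hM⟩ := F.property
    refine ⟨N + M, fun n hn => ?_⟩
    have h : ∀ pq, Subsingleton (indSummand E F n pq) := by
      rintro ⟨⟨p, q⟩, h⟩
      have h' := Finset.HasAntidiagonal.mem_antidiagonal.1 h
      dsimp only at h'
      have h0 : ∀ (x : E.deg p) (y : F.deg q), x ⊗ₜ[ℂ] y = 0 := by
        intro x y
        by_cases hp : N ≤ p
        · have := hN p hp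
          rw [Subsingleton.elim x 0, TensorProduct.zero_tmul]
        · have := hM q (by omega)
          rw [Subsingleton.elim y 0, TensorProduct.tmul_zero]
      have h1 : (LinearMap.id : indSummand E F n ⟨(p, q), h⟩ →ₗ[ℂ] _) = 0 := by
        apply Representation.IndV.hom_ext
        intro w
        apply TensorProduct.ext'
        intro x y
        rw [h0 x y, map_zero, map_zero]
      exact ⟨fun x y => (LinearMap.congr_fun h1 x).trans (LinearMap.congr_fun h1 y).symm⟩
    exact ⟨fun x y => DFinsupp.ext fun pq => Subsingleton.elim _ _⟩

lemma indV_mk_block {H K A : Type} [Group H] [Group K] [AddCommGroup A] [Module ℂ A]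
    (φ : H →* K) (ρ : Representation ℂ H A) (g : H) (k : K) (a : A) :
    Representation.IndV.mk φ ρ (φ g * k) (ρ g a) = Representation.IndV.mk φ ρ k a := by
  have := Representation.Coinvariants.mk_self_apply
    (Representation.tprod ((Representation.leftRegular ℂ K).comp φ) ρ) g
    (MonoidAlgebra.single k (1 : ℂ) ⊗ₜ[ℂ] a)
  simpa using this

/-- The canonical map `E_p ⊗ F_q → (E · F)_n` for `p + q = n`, translated by `w`. -/
def indIncl (E F : WreathRep G) {p q n : ℕ} (h : p + q = n) (w : Wr G n) :
    E.deg p ⊗[ℂ] F.deg q →ₗ[ℂ] IndSum E F n :=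
  (DirectSum.lof ℂ (Finset.HasAntidiagonal.antidiagonal n) (indSummand E F n)
    ⟨(p, q), Finset.HasAntidiagonal.mem_antidiagonal.2 h⟩) ∘ₗ
      Representation.IndV.mk (block G h) (extProd (E.deg p).ρ (F.deg q).ρ) w⁻¹

lemma indIncl_rho (E F : WreathRep G) {p q n : ℕ} (h : p + q = n) (v w : Wr G n)
    (x : E.deg p ⊗[ℂ] F.deg q) :
    indProdRep E F n v (indIncl E F h w x) = indIncl E F h (v * w) x := by
  rw [indIncl, indIncl, mul_inv_rev]
  refine (DirectSum.lmap_lof _ _ _).trans ?_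
  exact congrArg (DirectSum.lof ℂ (Finset.HasAntidiagonal.antidiagonal n) (indSummand E F n)
    ⟨(p, q), Finset.HasAntidiagonal.mem_antidiagonal.2 h⟩) (Representation.ind_mk _ _ v w⁻¹ x)

lemma indIncl_block (E F : WreathRep G) {p q n : ℕ} (h : p + q = n) (u : Wr G p) (v : Wr G q)
    (w : Wr G n) (x : E.deg p) (y : F.deg q) :
    indIncl E F h (w * block G h (u, v)) (x ⊗ₜ y) =
      indIncl E F h w ((E.deg p).ρ u x ⊗ₜ (F.deg q).ρ v y) := by
  rw [indIncl, indIncl, mul_inv_rev]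
  refine congrArg (DirectSum.lof ℂ (Finset.HasAntidiagonal.antidiagonal n) (indSummand E F n)
    ⟨(p, q), Finset.HasAntidiagonal.mem_antidiagonal.2 h⟩) ?_
  refine (indV_mk_block (block G h) (extProd (E.deg p).ρ (F.deg q).ρ) (u, v) _ _).symm.trans ?_
  rw [mul_inv_cancel_left]
  rfl

lemma indIncl_hom_ext (E F : WreathRep G) {n : ℕ} {T : Type} [AddCommGroup T] [Module ℂ T]
    {f g : IndSum E F n →ₗ[ℂ] T}
    (hfg : ∀ (p q : ℕ) (h : p + q = n) (w : Wr G n) (x : E.deg p) (y : F.deg q),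
      f (indIncl E F h w (x ⊗ₜ y)) = g (indIncl E F h w (x ⊗ₜ y))) : f = g := by
  apply DirectSum.linearMap_ext
  rintro ⟨⟨p, q⟩, h⟩
  apply Representation.IndV.hom_ext
  intro w
  apply TensorProduct.ext'
  intro x y
  have := hfg p q (Finset.HasAntidiagonal.mem_antidiagonal.1 h) w⁻¹ x y
  rw [indIncl, inv_inv] at this
  exact this

/-- The universal property of the induction product in degree `n`. -/
def indDesc (E F : WreathRep G) {n : ℕ} {T : Type} [AddCommGroup T] [Module ℂ T]
    (f : ∀ (p q : ℕ), p + q = n → Wr G n → E.deg p ⊗[ℂ] F.deg q →ₗ[ℂ] T)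
    (hf : ∀ (p q : ℕ) (h : p + q = n) (u : Wr G p) (v : Wr G q) (w : Wr G n) x y,
      f p q h (w * block G h (u, v)) (x ⊗ₜ y) = f p q h w ((E.deg p).ρ u x ⊗ₜ (F.deg q).ρ v y)) :
    IndSum E F n →ₗ[ℂ] T :=
  DirectSum.toModule ℂ (Finset.HasAntidiagonal.antidiagonal n) T fun pq =>
    Representation.Coinvariants.lift _
      (TensorProduct.lift <| (Finsupp.lift _ _ _ fun k =>
          f pq.1.1 pq.1.2 (Finset.HasAntidiagonal.mem_antidiagonal.1 pq.2) k⁻¹) ∘ₗ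
        (MonoidAlgebra.coeffLinearEquiv ℂ).toLinearMap) (by
      rintro ⟨u, v⟩
      apply TensorProduct.ext
      apply MonoidAlgebra.lhom_ext'
      intro k
      apply LinearMap.ext_ring
      apply TensorProduct.ext'
      intro x y
      have := hf pq.1.1 pq.1.2 (Finset.HasAntidiagonal.mem_antidiagonal.1 pq.2) u v
        (block G (Finset.HasAntidiagonal.mem_antidiagonal.1 pq.2) (u, v) * k)⁻¹ x y
      rw [mul_inv_rev, inv_mul_cancel_right] at this
      simp [extProd]
      simpa using this.symm)

lemma indDesc_incl (E F : WreathRep G) {n : ℕ} {T : Type} [AddCommGroup T] [Module ℂ T]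
    (f : ∀ (p q : ℕ), p + q = n → Wr G n → E.deg p ⊗[ℂ] F.deg q →ₗ[ℂ] T)
    (hf : ∀ (p q : ℕ) (h : p + q = n) (u : Wr G p) (v : Wr G q) (w : Wr G n) x y,
      f p q h (w * block G h (u, v)) (x ⊗ₜ y) = f p q h w ((E.deg p).ρ u x ⊗ₜ (F.deg q).ρ v y))
    {p q : ℕ} (h : p + q = n) (w : Wr G n) (x : E.deg p ⊗[ℂ] F.deg q) :
    indDesc E F f hf (indIncl E F h w x) = f p q h w x := by
  refine (DirectSum.toModule_lof ℂ _ _).trans ?_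
  simp

end Source

section Monoidal

set_option linter.unusedSectionVars false

open Blk WreathRep ExternalProduct
open scoped CategoryTheory.Prod

variable {G : Type} [Group G]

lemma block_toWr {p q : ℕ} (f : (⟨p⟩ : Blk G) ⟶ ⟨p⟩) (g : (⟨q⟩ : Blk G) ⟶ ⟨q⟩) :
    block G rfl (toWr f, toWr g) = toWr (tens f g) := by
  apply SemidirectProduct.ext
  · rfl
  · apply Equiv.ext
    intro i
    rfl

variable [Finite G]

lemma act_indIncl (E F : WreathRep G) {p q : ℕ} {Z : Blk G} (k : (⟨p + q⟩ : Blk G) ⟶ Z)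
    (x : E.deg p ⊗[ℂ] F.deg q) :
    act (indProd E F) k (indIncl E F (rfl : p + q = p + q) 1 x) =
      indIncl E F (rank_eq k) (toWr k) x := by
  obtain ⟨n⟩ := Z
  obtain rfl : p + q = n := rank_eq k
  exact (indIncl_rho E F rfl (toWr k) 1 x).trans (by rw [mul_one])

lemma indIncl_act (E F : WreathRep G) {X X' Y Y' : Blk G} (f : X ⟶ X') (g : Y ⟶ Y')
    {n : ℕ} (h : X'.rank + Y'.rank = n) (h' : X.rank + Y.rank = n) (w : Wr G n)
    (x : E.deg X.rank) (y : F.deg Y.rank) :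
    indIncl E F h w (act E f x ⊗ₜ act F g y) =
      indIncl E F h' (w * toWr (X := add X Y) (Y := ⟨n⟩) (tens f g ≫ (castIso (X := add X' Y') (Y := ⟨n⟩) h).hom))
        (x ⊗ₜ y) := by
  obtain ⟨a⟩ := X
  obtain ⟨b⟩ := X'
  obtain ⟨c⟩ := Y
  obtain ⟨d⟩ := Y'
  obtain rfl : a = b := rank_eq f
  obtain rfl : c = d := rank_eq g
  obtain rfl : a + c = n := h
  refine (indIncl_block E F rfl (toWr f) (toWr g) w x y).symm.trans ?_
  rw [block_toWr]
  exact congrArg (fun t => indIncl E F rfl (w * t) (x ⊗ₜ y))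
    (congrArg toWr (Category.comp_id (tens f g)).symm)

def convUnit (E F : WreathRep G) :
    (toFun G).obj E ⊠ (toFun G).obj F ⟶ tensor (Blk G) ⋙ (toFun G).obj (indProd E F) where
  app XY := ModuleCat.ofHom (indIncl E F (rfl : XY.1.rank + XY.2.rank = _) 1)
  naturality XY XY' fg := by
    apply ModuleCat.hom_ext
    apply TensorProduct.ext'
    intro x y
    refine (indIncl_act E F fg.1 fg.2 rfl (rank_eq (tens fg.1 fg.2)) 1 x y).trans ?_
    refine Eq.trans ?_ (act_indIncl E F (tens fg.1 fg.2) (x ⊗ₜ y)).symm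
    rw [one_mul]
    exact congrArg (fun t => indIncl E F _ t (x ⊗ₜ y))
      (congrArg toWr (Category.comp_id (tens fg.1 fg.2)))

/-- An element of the wreath product as a morphism out of a sum. -/
def split {p q n : ℕ} (h : p + q = n) (w : Wr G n) : (⟨p⟩ ⊗ ⟨q⟩ : Blk G) ⟶ ⟨n⟩ :=
  (castIso (X := add ⟨p⟩ ⟨q⟩) (Y := ⟨n⟩) h).hom ≫ ofWr w

/-- The object of the indexing category of the Kan extension given by `w`. -/
def splitArrow {p q n : ℕ} (h : p + q = n) (w : Wr G n) :
    CostructuredArrow (tensor (Blk G)) ⟨n⟩ :=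
  CostructuredArrow.mk (S := tensor (Blk G)) (Y := ((⟨p⟩, ⟨q⟩) : Blk G × Blk G)) (split h w)

/-- The component of a cocone. -/
def leg {E F : WreathRep G} {n : ℕ} (s : Limits.Cocone (CostructuredArrow.proj
      (tensor (Blk G)) ⟨n⟩ ⋙ (toFun G).obj E ⊠ (toFun G).obj F))
    (j : CostructuredArrow (tensor (Blk G)) ⟨n⟩) :
    E.deg j.left.1.rank ⊗[ℂ] F.deg j.left.2.rank →ₗ[ℂ] s.pt :=
  (s.ι.app j).hom

lemma leg_nat {E F : WreathRep G} {n : ℕ} (s : Limits.Cocone (CostructuredArrow.proj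
      (tensor (Blk G)) ⟨n⟩ ⋙ (toFun G).obj E ⊠ (toFun G).obj F))
    {j j' : CostructuredArrow (tensor (Blk G)) ⟨n⟩} (φ : j ⟶ j')
    (x : E.deg j.left.1.rank) (y : F.deg j.left.2.rank) :
    leg s j' (act E φ.left.1 x ⊗ₜ act F φ.left.2 y) = leg s j (x ⊗ₜ y) := by
  have := LinearMap.congr_fun (congrArg ModuleCat.Hom.hom (s.w φ)) (x ⊗ₜ[ℂ] y)
  refine Eq.trans ?_ this
  rfl

lemma split_block {p q n : ℕ} (h : p + q = n) (u : Wr G p) (v : Wr G q) (w : Wr G n) :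
    (ofWr u ⊗ₘ ofWr v) ≫ split h w = split h (w * block G h (u, v)) := by
  subst h
  have h₁ : split (rfl : p + q = p + q) w = ofWr w := Category.id_comp _
  have h₂ : split (rfl : p + q = p + q) (w * block G rfl (u, v)) =
    ofWr (w * block G rfl (u, v)) := Category.id_comp _
  refine (congrArg ((ofWr u ⊗ₘ ofWr v) ≫ ·) h₁).trans (Eq.trans ?_ h₂.symm)
  exact congrArg (fun t => ofWr (w * t)) (block_toWr (ofWr u) (ofWr v)).symm

lemma toWr_split {p q n : ℕ} (h : p + q = n) (w : Wr G n) : toWr (split h w) = w := by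
  subst h
  exact congrArg toWr (Category.id_comp (ofWr w))

lemma split_toWr {p q n : ℕ} (k : (⟨p⟩ ⊗ ⟨q⟩ : Blk G) ⟶ ⟨n⟩) :
    split (rank_eq k) (toWr k) = k := by
  obtain rfl : p + q = n := rank_eq k
  exact Category.id_comp (ofWr (toWr k))

lemma cocone_app (E F : WreathRep G) {n : ℕ} (j : CostructuredArrow (tensor (Blk G)) ⟨n⟩)
    (x : E.deg j.left.1.rank ⊗[ℂ] F.deg j.left.2.rank) :
    leg ((Functor.LeftExtension.mk _ (convUnit E F)).coconeAt ⟨n⟩) j x =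
      indIncl E F (rank_eq j.hom) (toWr j.hom) x :=
  act_indIncl E F j.hom x

lemma splitArrow_toWr {n : ℕ} (j : CostructuredArrow (tensor (Blk G)) ⟨n⟩) :
    splitArrow (p := j.left.1.rank) (q := j.left.2.rank) (rank_eq j.hom) (toWr j.hom) = j := by
  obtain ⟨⟨⟨p⟩, ⟨q⟩⟩, ⟨⟨⟩⟩, k⟩ := j
  exact congrArg (CostructuredArrow.mk (S := tensor (Blk G))
    (Y := ((⟨p⟩, ⟨q⟩) : Blk G × Blk G))) (split_toWr k)

lemma leg_split {E F : WreathRep G} {n : ℕ} (s : Limits.Cocone (CostructuredArrow.proj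
      (tensor (Blk G)) ⟨n⟩ ⋙ (toFun G).obj E ⊠ (toFun G).obj F))
    (p q : ℕ) (h : p + q = n) (u : Wr G p) (v : Wr G q) (w : Wr G n)
    (x : E.deg p) (y : F.deg q) :
    leg s (splitArrow h (w * block G h (u, v))) (x ⊗ₜ y) =
      leg s (splitArrow h w) ((E.deg p).ρ u x ⊗ₜ (F.deg q).ρ v y) :=
  (leg_nat s (j := splitArrow h (w * block G h (u, v))) (j' := splitArrow h w)
    (CostructuredArrow.homMk (ofWr u ×ₘ ofWr v) (split_block h u v w)) x y).symm

/-- The map out of the induction product determined by a cocone. -/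
def convDesc {E F : WreathRep G} {n : ℕ} (s : Limits.Cocone (CostructuredArrow.proj
      (tensor (Blk G)) ⟨n⟩ ⋙ (toFun G).obj E ⊠ (toFun G).obj F)) :
    IndSum E F n →ₗ[ℂ] s.pt :=
  indDesc E F (fun _ _ h w => leg s (splitArrow h w)) (leg_split s)

lemma convDesc_fac {E F : WreathRep G} {n : ℕ} (s : Limits.Cocone (CostructuredArrow.proj
      (tensor (Blk G)) ⟨n⟩ ⋙ (toFun G).obj E ⊠ (toFun G).obj F))
    (j : CostructuredArrow (tensor (Blk G)) ⟨n⟩)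
    (x : E.deg j.left.1.rank ⊗[ℂ] F.deg j.left.2.rank) :
    convDesc s (indIncl E F (rank_eq j.hom) (toWr j.hom) x) = leg s j x := by
  refine (indDesc_incl E F _ _ (rank_eq j.hom) (toWr j.hom) x).trans ?_
  obtain ⟨⟨⟨p⟩, ⟨q⟩⟩, ⟨⟨⟩⟩, k⟩ := j
  exact congrArg (fun k => leg s (CostructuredArrow.mk (S := tensor (Blk G))
    (Y := ((⟨p⟩, ⟨q⟩) : Blk G × Blk G)) k) x) (split_toWr k)

def convIsColimit (E F : WreathRep G) :
    (Functor.LeftExtension.mk _ (convUnit E F)).IsPointwiseLeftKanExtension := fun ⟨n⟩ =>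
  { desc s := ModuleCat.ofHom (convDesc s)
    fac s j := ModuleCat.hom_ext (LinearMap.ext fun x =>
      (congrArg (convDesc s) (cocone_app E F j x)).trans (convDesc_fac s j x))
    uniq s m hm := by
      apply ModuleCat.hom_ext
      apply indIncl_hom_ext
      intro p q h w x y
      have h₁ := LinearMap.congr_fun (congrArg ModuleCat.Hom.hom (hm (splitArrow h w)))
        (x ⊗ₜ[ℂ] y)
      have h₂ := cocone_app E F (splitArrow h w) (x ⊗ₜ[ℂ] y)
      have h₃ : toWr (splitArrow h w).hom = w := toWr_split h w
      rw [h₃] at h₂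
      have h₄ := convDesc_fac s (splitArrow h w) (x ⊗ₜ[ℂ] y)
      rw [h₃] at h₄
      exact (congrArg m.hom h₂).symm.trans (h₁.trans h₄.symm) }

/-- The unit for the induction product: the trivial representation of the trivial group `G ≀ S_0`,
in degree zero. -/
def indUnit (G : Type) [Group G] : WreathRep G where
  obj n := FDRep.of (Representation.trivial ℂ (Wr G n) (PLift (n = 0) → ℂ))
  property := ⟨1, fun n hn => ⟨fun _ _ => funext fun h => absurd h.down (by omega)⟩⟩

/-- The degree zero part of the unit. -/
def unitCan : ℂ →ₗ[ℂ] (indUnit G).deg 0 := LinearMap.pi fun _ => LinearMap.id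

lemma act_unit {n : ℕ} (k : (⟨0⟩ : Blk G) ⟶ ⟨n⟩) (c : ℂ) (h : PLift (n = 0)) :
    (act (indUnit G) k (unitCan c) : PLift (n = 0) → ℂ) h = c := by
  obtain rfl : 0 = n := rank_eq k
  rfl

lemma hom_zero_subsingleton {n : ℕ} (k k' : (⟨0⟩ : Blk G) ⟶ ⟨n⟩) : k = k' :=
  hom_ext (fun i => i.elim0) (fun i => i.elim0)

/-- The canonical map onto the unit, as a left extension. -/
abbrev unitExt (G : Type) [Group G] : (Functor.fromPUnit.{0} (𝟙_ (Blk G))).LeftExtension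
    (Functor.fromPUnit.{0} (𝟙_ (ModuleCat.{0} ℂ))) :=
  Functor.LeftExtension.mk ((toFun G).obj (indUnit G))
    ({ app _ := ModuleCat.ofHom unitCan } : Functor.fromPUnit.{0} (𝟙_ (ModuleCat.{0} ℂ)) ⟶
      Functor.fromPUnit.{0} (𝟙_ (Blk G)) ⋙ (toFun G).obj (indUnit G))

lemma unit_ext {n : ℕ} {T : Type} [AddCommGroup T] [Module ℂ T]
    {f g : (indUnit G).deg n →ₗ[ℂ] T}
    (h : ∀ (k : (⟨0⟩ : Blk G) ⟶ ⟨n⟩) c,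
      f (act (indUnit G) k (unitCan c)) = g (act (indUnit G) k (unitCan c))) : f = g := by
  apply LinearMap.ext
  intro (x : PLift (n = 0) → ℂ)
  by_cases hn : n = 0
  · subst hn
    have hx : (act (indUnit G) (𝟙 (⟨0⟩ : Blk G)) (unitCan (x ⟨rfl⟩))) = x :=
      funext fun _ => rfl
    have := h (𝟙 _) (x ⟨rfl⟩)
    rw [hx] at this
    exact this
  · have hx : x = 0 := funext fun h => absurd h.down hn
    exact (congrArg f hx).trans ((map_zero f).trans ((map_zero g).symm.trans
      (congrArg g hx.symm)))

/-- The map out of the unit determined by a cocone. -/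
def unitDesc {n : ℕ} (s : Limits.Cocone (CostructuredArrow.proj
      (Functor.fromPUnit.{0} (𝟙_ (Blk G))) ⟨n⟩ ⋙
        Functor.fromPUnit.{0} (𝟙_ (ModuleCat.{0} ℂ)))) :
    (indUnit G).deg n →ₗ[ℂ] s.pt :=
  if h : n = 0 then
    (s.ι.app (CostructuredArrow.mk (S := Functor.fromPUnit.{0} (𝟙_ (Blk G))) (Y := ⟨⟨⟩⟩)
      ((castIso (X := ⟨0⟩) (Y := ⟨n⟩) h.symm).hom))).hom ∘ₗ
        (LinearMap.proj (PLift.up h) : (PLift (n = 0) → ℂ) →ₗ[ℂ] ℂ)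
  else 0

lemma unitDesc_fac {n : ℕ} (s : Limits.Cocone (CostructuredArrow.proj
      (Functor.fromPUnit.{0} (𝟙_ (Blk G))) ⟨n⟩ ⋙
        Functor.fromPUnit.{0} (𝟙_ (ModuleCat.{0} ℂ))))
    (j : CostructuredArrow (Functor.fromPUnit.{0} (𝟙_ (Blk G))) ⟨n⟩) (c : ℂ) :
    unitDesc s (act (indUnit G) j.hom (unitCan c)) = (s.ι.app j).hom c := by
  have hn : n = 0 := (rank_eq j.hom).symm
  obtain ⟨⟨⟨⟩⟩, ⟨⟨⟩⟩, k⟩ := j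
  rw [unitDesc, dif_pos hn]
  have hk : (castIso (X := (⟨0⟩ : Blk G)) (Y := ⟨n⟩) hn.symm).hom = k :=
    hom_zero_subsingleton _ _
  rw [hk]
  exact congrArg (s.ι.app (CostructuredArrow.mk (S := Functor.fromPUnit.{0} (𝟙_ (Blk G)))
    (Y := ⟨⟨⟩⟩) k)).hom (act_unit k c ⟨hn⟩)

def unitIsColimit (G : Type) [Group G] [Finite G] : (unitExt G).IsPointwiseLeftKanExtension := fun ⟨n⟩ =>
  { desc s := ModuleCat.ofHom (unitDesc s)
    fac s j := ModuleCat.hom_ext (LinearMap.ext fun c => unitDesc_fac s j c)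
    uniq s m hm := by
      apply ModuleCat.hom_ext
      apply unit_ext (G := G)
      intro k c
      exact (LinearMap.congr_fun (congrArg ModuleCat.Hom.hom (hm (CostructuredArrow.mk
        (S := Functor.fromPUnit.{0} (𝟙_ (Blk G))) (Y := ⟨⟨⟩⟩) k))) c).trans
          (unitDesc_fac s (CostructuredArrow.mk
            (S := Functor.fromPUnit.{0} (𝟙_ (Blk G))) (Y := ⟨⟨⟩⟩) k) c).symm }

/-- The data from which the monoidal structure is built: the induction product, with its universal
property that a map `E · F ⟶ H` is a natural family of maps `E_p ⊗ F_q ⟶ H_{p+q}`. -/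
abbrev indCore (G : Type) [Group G] [Finite G] :
    InducedLawfulDayConvolutionMonoidalCategoryStructCore (Blk G) (ModuleCat.{0} ℂ)
      (WreathRep G) where
  ι := toFun G
  fullyFaithulι := toFunFF G
  tensorObj := indProd
  convolutions' E F :=
    { convolution := (toFun G).obj (indProd E F)
      unit := convUnit E F
      isPointwiseLeftKanExtensionUnit := convIsColimit E F }
  tensorObjIsoConvolution E F := Iso.refl _
  tensorUnit := indUnit G
  tensorUnitConvolutionUnit :=
    { can := ModuleCat.ofHom unitCan
      isPointwiseLeftKanExtensionCan := unitIsColimit G }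

instance indStruct : MonoidalCategoryStruct (WreathRep G) :=
  (indCore G).mkMonoidalCategoryStruct

instance indLawful :
    LawfulDayConvolutionMonoidalCategoryStruct (Blk G) (ModuleCat.{0} ℂ) (WreathRep G) :=
  (indCore G).mkLawfulDayConvolutionMonoidalCategoryStruct

instance indMonoidal : MonoidalCategory (WreathRep G) :=
  monoidalOfLawfulDayConvolutionMonoidalCategoryStruct (Blk G) (ModuleCat.{0} ℂ) (WreathRep G)

lemma tensorObj_eq (E F : WreathRep G) : E ⊗ F = indProd E F := rfl

lemma tensorUnit_eq : 𝟙_ (WreathRep G) = indUnit G := rfl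

end Monoidal

section Target

/-- Polynomial maps `ℂ^s → W` of total degree at most `d`: finite sums of terms `c ↦ P(c) • w` with
`P` a polynomial of total degree at most `d` and `w ∈ W`. -/
def polyMaps (s d : ℕ) (W : Type*) [AddCommGroup W] [Module ℂ W] :
    Submodule ℂ ((Fin s → ℂ) → W) :=
  Submodule.span ℂ {φ | ∃ P : MvPolynomial (Fin s) ℂ, P.totalDegree ≤ d ∧
    ∃ w : W, φ = fun c => MvPolynomial.eval c P • w}

section

variable {s d d' : ℕ} {U W W' : Type*} [AddCommGroup U] [Module ℂ U] [AddCommGroup W] [Module ℂ W]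
  [AddCommGroup W'] [Module ℂ W']

lemma polyMaps_term (P : MvPolynomial (Fin s) ℂ) (hP : P.totalDegree ≤ d) (w : W) :
    (fun c => MvPolynomial.eval c P • w) ∈ polyMaps s d W :=
  Submodule.subset_span ⟨P, hP, w, rfl⟩

lemma polyMaps_mono (h : d ≤ d') : polyMaps s d W ≤ polyMaps s d' W :=
  Submodule.span_mono fun _ ⟨P, hP, w, hw⟩ => ⟨P, hP.trans h, w, hw⟩

lemma polyMaps_comp (L : W →ₗ[ℂ] W') {φ : (Fin s → ℂ) → W} (h : φ ∈ polyMaps s d W) :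
    (fun c => L (φ c)) ∈ polyMaps s d W' := by
  have key : polyMaps s d W ≤ (polyMaps s d W').comap (LinearMap.compLeft L (Fin s → ℂ)) := by
    refine Submodule.span_le.2 ?_
    rintro _ ⟨P, hP, w, rfl⟩
    have := polyMaps_term P hP (L w)
    simp only [← map_smul] at this
    exact this
  exact key h

lemma polyMaps_bilin (B : W →ₗ[ℂ] W' →ₗ[ℂ] U) {φ : (Fin s → ℂ) → W} {ψ : (Fin s → ℂ) → W'}
    (h : φ ∈ polyMaps s d W) (h' : ψ ∈ polyMaps s d' W') :
    (fun c => B (φ c) (ψ c)) ∈ polyMaps s (d + d') U := by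
  induction h using Submodule.span_induction with
  | mem φ hφ =>
    obtain ⟨P, hP, w, rfl⟩ := hφ
    induction h' using Submodule.span_induction with
    | mem ψ hψ =>
      obtain ⟨Q, hQ, w', rfl⟩ := hψ
      refine Eq.mp (congrArg (· ∈ polyMaps s (d + d') U) (funext fun c => ?_))
        (polyMaps_term (P * Q) ((MvPolynomial.totalDegree_mul P Q).trans
          (add_le_add hP hQ)) (B w w'))
      rw [map_mul, mul_smul, map_smul, map_smul, LinearMap.smul_apply]
      exact smul_comm _ _ _
    | zero =>
      refine Eq.mp (congrArg (· ∈ polyMaps s (d + d') U) (funext fun c => ?_))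
        (Submodule.zero_mem _)
      simp
    | add φ ψ _ _ h₁ h₂ =>
      refine Eq.mp (congrArg (· ∈ polyMaps s (d + d') U) (funext fun c => ?_))
        (Submodule.add_mem _ h₁ h₂)
      simp only [Pi.add_apply, map_add]
    | smul a φ _ h =>
      refine Eq.mp (congrArg (· ∈ polyMaps s (d + d') U) (funext fun c => ?_))
        (Submodule.smul_mem _ a h)
      simp only [Pi.smul_apply, map_smul]
  | zero =>
    refine Eq.mp (congrArg (· ∈ polyMaps s (d + d') U) (funext fun c => ?_))
      (Submodule.zero_mem _)
    simp
  | add φ ψ _ _ h₁ h₂ =>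
    refine Eq.mp (congrArg (· ∈ polyMaps s (d + d') U) (funext fun c => ?_))
      (Submodule.add_mem _ h₁ h₂)
    simp only [Pi.add_apply, map_add, LinearMap.add_apply]
  | smul a φ _ h =>
    refine Eq.mp (congrArg (· ∈ polyMaps s (d + d') U) (funext fun c => ?_))
      (Submodule.smul_mem _ a h)
    simp only [Pi.smul_apply, map_smul, LinearMap.smul_apply]

end

variable (G : Type) [Group G]

/-- A functor `F : rep(G) → vect` is polynomial of bounded total degree if there is `d` such that
for all `f_1, …, f_s : X ⟶ Y` the map `(c_1, …, c_s) ↦ F(c_1 f_1 + ⋯ + c_s f_s)` is polynomial of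
total degree at most `d`. -/
def IsPolynomial : ObjectProperty (FDRep ℂ G ⥤ FGModuleCat ℂ) := fun F =>
  ∃ d : ℕ, ∀ (X Y : FDRep ℂ G) (s : ℕ) (f : Fin s → (X ⟶ Y)),
    (fun c : Fin s → ℂ => F.map (∑ i, c i • f i)) ∈ polyMaps s d (F.obj X ⟶ F.obj Y)

instance : (IsPolynomial G).IsMonoidal where
  prop_unit := ⟨0, fun X Y s f => by
    simpa using polyMaps_term (1 : MvPolynomial (Fin s) ℂ) (by simp) (𝟙 (𝟙_ (FGModuleCat ℂ)))⟩
  prop_tensor := by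
    rintro F H ⟨d, hd⟩ ⟨e, he⟩
    refine ⟨d + e, fun X Y s f => ?_⟩
    let B : (F.obj X ⟶ F.obj Y) →ₗ[ℂ] (H.obj X ⟶ H.obj Y) →ₗ[ℂ]
        (F.obj X ⊗ H.obj X ⟶ F.obj Y ⊗ H.obj Y) :=
      LinearMap.mk₂ ℂ (fun a b => a ⊗ₘ b)
        (fun a a' b => by simp [MonoidalPreadditive.add_tensor])
        (fun c a b => by
          rw [MonoidalCategory.tensorHom_def, MonoidalCategory.tensorHom_def,
            MonoidalLinear.smul_whiskerRight, Linear.smul_comp])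
        (fun a b b' => by simp [MonoidalPreadditive.tensor_add])
        (fun c a b => by
          rw [MonoidalCategory.tensorHom_def, MonoidalCategory.tensorHom_def,
            MonoidalLinear.whiskerLeft_smul, Linear.comp_smul])
    exact polyMaps_bilin B (hd X Y s f) (he X Y s f)

/-- The category of polynomial functors `rep(G) → vect` of bounded total degree and natural
transformations; its monoidal structure is the pointwise tensor product. -/
abbrev PolyFun : Type 1 := (IsPolynomial G).FullSubcategory

end Target

section Xi

open WreathRep

variable {G : Type} [Group G]

/-- The tensor power `V^{⊗ n}`. -/
abbrev TPow (n : ℕ) (V : Type) [AddCommGroup V] [Module ℂ V] : Type :=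
  ⨂[ℂ] _ : Fin n, V

/-- The action of `G ≀ S_n` on `V^{⊗ n}` for a `G`-representation `V`:
`(a, π) (v_1 ⊗ ⋯ ⊗ v_n)` has `i`-th factor `a_i v_{π⁻¹ i}`. -/
def tensorPowRep (n : ℕ) {V : Type} [AddCommGroup V] [Module ℂ V] (ρ : Representation ℂ G V) :
    Representation ℂ (Wr G n) (TPow n V) where
  toFun w := PiTensorProduct.map (fun i => ρ (w.left i)) ∘ₗ
    (PiTensorProduct.reindex ℂ (fun _ : Fin n => V) w.right).toLinearMap
  map_one' := by
    apply PiTensorProduct.ext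
    ext v
    simp [PiTensorProduct.reindex_tprod]
    rfl
  map_mul' u w := by
    apply PiTensorProduct.ext
    ext v
    simp [PiTensorProduct.reindex_tprod]
    rfl

lemma tensorPowRep_tprod (n : ℕ) {V : Type} [AddCommGroup V] [Module ℂ V]
    (ρ : Representation ℂ G V) (w : Wr G n) (v : Fin n → V) :
    tensorPowRep n ρ w (PiTensorProduct.tprod ℂ v) =
      PiTensorProduct.tprod ℂ fun i => ρ (w.left i) (v (w.right.symm i)) := by
  simp [tensorPowRep, PiTensorProduct.reindex_tprod]

/-- The linear map underlying a morphism of representations. -/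
def flin {V W : FDRep ℂ G} (f : V ⟶ W) : V →ₗ[ℂ] W := f.hom.hom.hom

lemma flin_rho {V W : FDRep ℂ G} (f : V ⟶ W) (g : G) (x : V) :
    flin f (V.ρ g x) = W.ρ g (flin f x) :=
  LinearMap.congr_fun (congrArg (fun g => g.hom.hom) (f.comm g)) x

/-- The diagonal representation of `G ≀ S_n` on `E_n ⊗ V^{⊗ n}`. -/
abbrev xiRep (E : WreathRep G) (V : FDRep ℂ G) (n : ℕ) :
    Representation ℂ (Wr G n) (E.deg n ⊗[ℂ] TPow n V) :=
  Representation.tprod (E.deg n).ρ (tensorPowRep n V.ρ)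

/-- The space `E_n ⊗_{G ≀ S_n} V^{⊗ n}`, that is, the coinvariants of the diagonal action. -/
abbrev XiDeg (E : WreathRep G) (V : FDRep ℂ G) (n : ℕ) : Type :=
  (xiRep E V n).Coinvariants

/-- The map `E_n ⊗_{G ≀ S_n} V^{⊗ n} → E'_n ⊗_{G ≀ S_n} W^{⊗ n}` induced by `E → E'` and
`V → W`. -/
def xiLin {E E' : WreathRep G} (φ : E ⟶ E') {V W : FDRep ℂ G} (f : V ⟶ W) (n : ℕ) :
    XiDeg E V n →ₗ[ℂ] XiDeg E' W n :=
  Representation.Coinvariants.lift _ (Representation.Coinvariants.mk (xiRep E' W n) ∘ₗ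
      TensorProduct.map (lin φ n) (PiTensorProduct.map fun _ => flin f)) (by
    intro w
    apply TensorProduct.ext
    ext x v
    have := Representation.Coinvariants.mk_self_apply (xiRep E' W n) w
      (lin φ n x ⊗ₜ PiTensorProduct.tprod ℂ fun i => flin f (v i))
    rw [Representation.tprod_apply, TensorProduct.map_tmul, tensorPowRep_tprod] at this
    have h : xiRep E V n w (x ⊗ₜ PiTensorProduct.tprod ℂ v) = (E.deg n).ρ w x ⊗ₜ
        PiTensorProduct.tprod ℂ fun i => V.ρ (w.left i) (v (w.right.symm i)) :=
      congrArg (fun t => (E.deg n).ρ w x ⊗ₜ[ℂ] t) (tensorPowRep_tprod n V.ρ w v)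
    simp only [← lin_rho, ← flin_rho] at this
    change Representation.Coinvariants.mk (xiRep E' W n) (TensorProduct.map (lin φ n)
      (PiTensorProduct.map fun _ => flin f) (xiRep E V n w (x ⊗ₜ PiTensorProduct.tprod ℂ v))) =
        Representation.Coinvariants.mk (xiRep E' W n) (lin φ n x ⊗ₜ
          PiTensorProduct.map (fun _ => flin f) (PiTensorProduct.tprod ℂ v))
    rw [h, TensorProduct.map_tmul, PiTensorProduct.map_tprod, PiTensorProduct.map_tprod]
    exact this)

@[simp] lemma xiLin_mk {E E' : WreathRep G} (φ : E ⟶ E') {V W : FDRep ℂ G} (f : V ⟶ W) (n : ℕ)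
    (t : E.deg n ⊗[ℂ] TPow n V) :
    xiLin φ f n (Representation.Coinvariants.mk (xiRep E V n) t) =
      Representation.Coinvariants.mk (xiRep E' W n)
        (TensorProduct.map (lin φ n) (PiTensorProduct.map fun _ => flin f) t) := rfl

lemma xiLin_id (E : WreathRep G) (V : FDRep ℂ G) (n : ℕ) :
    xiLin (𝟙 E) (𝟙 V) n = LinearMap.id := by
  apply Representation.Coinvariants.hom_ext
  have h : flin (𝟙 V) = LinearMap.id := rfl
  ext x
  simp [h, PiTensorProduct.map_id]

lemma xiLin_comp {E E' E'' : WreathRep G} (φ : E ⟶ E') (ψ : E' ⟶ E'') {V W U : FDRep ℂ G}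
    (f : V ⟶ W) (g : W ⟶ U) (n : ℕ) :
    xiLin (φ ≫ ψ) (f ≫ g) n = xiLin ψ g n ∘ₗ xiLin φ f n := by
  apply Representation.Coinvariants.hom_ext
  have h : flin (f ≫ g) = flin g ∘ₗ flin f := rfl
  apply TensorProduct.ext'
  intro x y
  simp only [LinearMap.comp_apply, xiLin_mk, TensorProduct.map_tmul, lin_comp, h,
    PiTensorProduct.map_comp]

instance xiDeg_finite (E : WreathRep G) (V : FDRep ℂ G) (n : ℕ) :
    Module.Finite ℂ (XiDeg E V n) :=
  Module.Finite.of_surjective (Representation.Coinvariants.mk (xiRep E V n))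
    (Representation.Coinvariants.mk_surjective _)

lemma xiDeg_subsingleton (E : WreathRep G) : ∃ N : ℕ, ∀ (V : FDRep ℂ G) n, N ≤ n →
    Subsingleton (XiDeg E V n) := by
  obtain ⟨N, hN⟩ := E.property
  refine ⟨N, fun V n hn => ?_⟩
  have := hN n hn
  have h : Subsingleton (E.deg n ⊗[ℂ] TPow n V) := by
    refine subsingleton_of_forall_eq 0 fun t => ?_
    induction t with
    | zero => rfl
    | tmul x y => rw [Subsingleton.elim x 0, TensorProduct.zero_tmul]
    | add a b ha hb => rw [ha, hb, add_zero]
  exact (Representation.Coinvariants.mk_surjective (xiRep E V n)).subsingleton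

instance xi_finite (E : WreathRep G) (V : FDRep ℂ G) :
    Module.Finite ℂ (⨁ n, XiDeg E V n) := by
  obtain ⟨N, hN⟩ := xiDeg_subsingleton E
  refine Module.Finite.of_injective
    (LinearMap.pi fun n : Fin N => DirectSum.component ℂ ℕ (XiDeg E V) n) ?_
  intro x y h
  refine DFinsupp.ext fun n => ?_
  by_cases hn : N ≤ n
  · have := hN V n hn
    exact Subsingleton.elim _ _
  · exact congrFun h ⟨n, not_le.1 hn⟩

/-- The functor `V ↦ ⨁_n E_n ⊗_{G ≀ S_n} V^{⊗ n}`. -/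
def xiObj (E : WreathRep G) : FDRep ℂ G ⥤ FGModuleCat ℂ where
  obj V := FGModuleCat.of ℂ (⨁ n, XiDeg E V n)
  map f := FGModuleCat.ofHom (DirectSum.lmap fun n => xiLin (𝟙 E) f n)
  map_id V := FGModuleCat.hom_ext (by
    simp only [xiLin_id, DirectSum.lmap_id]
    rfl)
  map_comp f g := FGModuleCat.hom_ext (by
    have h := fun n => xiLin_comp (𝟙 E) (𝟙 E) f g n
    rw [Category.comp_id] at h
    simp only [h, DirectSum.lmap_comp]
    rfl)

/-- The natural transformation induced by a morphism of families of representations. -/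
def xiMap {E E' : WreathRep G} (φ : E ⟶ E') : xiObj E ⟶ xiObj E' where
  app V := FGModuleCat.ofHom (DirectSum.lmap fun n => xiLin φ (𝟙 V) n)
  naturality V W f := FGModuleCat.hom_ext (by
    have h₁ := fun n => xiLin_comp (𝟙 E) φ f (𝟙 W) n
    have h₂ := fun n => xiLin_comp φ (𝟙 E') (𝟙 V) f n
    simp only [Category.comp_id, Category.id_comp] at h₁ h₂
    exact (DirectSum.lmap_comp (fun n => xiLin (𝟙 E) f n) (fun n => xiLin φ (𝟙 W) n)).symm.trans
      ((congrArg DirectSum.lmap (funext fun n => (h₁ n).symm.trans (h₂ n))).trans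
        (DirectSum.lmap_comp (fun n => xiLin φ (𝟙 V) n) (fun n => xiLin (𝟙 E') f n))))

lemma flin_sum {V W : FDRep ℂ G} {s : ℕ} (f : Fin s → (V ⟶ W)) (c : Fin s → ℂ) :
    flin (∑ i, c i • f i) = ∑ i, c i • flin (f i) := by
  let L : (V ⟶ W) →ₗ[ℂ] (V →ₗ[ℂ] W) :=
    { toFun := flin
      map_add' := fun _ _ => rfl
      map_smul' := fun _ _ => rfl }
  change L _ = ∑ i, c i • L (f i)
  simp

lemma tpow_poly {V W : Type} [AddCommGroup V] [Module ℂ V] [AddCommGroup W] [Module ℂ W]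
    (n : ℕ) {s : ℕ} (f : Fin s → (V →ₗ[ℂ] W)) :
    (fun c : Fin s → ℂ => (PiTensorProduct.map (fun _ => ∑ i, c i • f i) :
      TPow n V →ₗ[ℂ] TPow n W)) ∈ polyMaps s n (TPow n V →ₗ[ℂ] TPow n W) := by
  let Φ : MultilinearMap ℂ (fun _ : Fin n => V →ₗ[ℂ] W) (TPow n V →ₗ[ℂ] TPow n W) :=
    PiTensorProduct.mapMultilinear ℂ (fun _ : Fin n => V) (fun _ : Fin n => W)
  have h : ∀ c : Fin s → ℂ, (PiTensorProduct.map (fun _ => ∑ i, c i • f i) :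
      TPow n V →ₗ[ℂ] TPow n W) = ∑ r : Fin n → Fin s,
        MvPolynomial.eval c (∏ j, MvPolynomial.X (r j)) • Φ fun j => f (r j) := by
    intro c
    refine (MultilinearMap.map_sum Φ fun _ i => c i • f i).trans
      (Finset.sum_congr rfl fun r _ => ?_)
    refine (Φ.map_smul_univ (fun j => c (r j)) (fun j => f (r j))).trans ?_
    simp
  simp only [h]
  have := Submodule.sum_mem (polyMaps s n (TPow n V →ₗ[ℂ] TPow n W)) (t := Finset.univ)
    (f := fun (r : Fin n → Fin s) (c : Fin s → ℂ) =>
        MvPolynomial.eval c (∏ j, MvPolynomial.X (r j)) • Φ fun j => f (r j)) fun r _ => by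
      refine polyMaps_term _ ?_ _
      refine (MvPolynomial.totalDegree_finsetProd _ _).trans ?_
      simp
  refine Eq.mp (congrArg (· ∈ polyMaps s n (TPow n V →ₗ[ℂ] TPow n W)) (funext fun c => ?_)) this
  simp

lemma xiLin_poly (E : WreathRep G) {V W : FDRep ℂ G} (n : ℕ) {s : ℕ} (f : Fin s → (V ⟶ W)) :
    (fun c : Fin s → ℂ => xiLin (𝟙 E) (∑ i, c i • f i) n) ∈
      polyMaps s n (XiDeg E V n →ₗ[ℂ] XiDeg E W n) := by
  obtain ⟨σ, hσ⟩ := LinearMap.exists_rightInverse_of_surjective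
    (Representation.Coinvariants.mk (xiRep E V n))
    (LinearMap.range_eq_top.2 (Representation.Coinvariants.mk_surjective _))
  let L : (TPow n V →ₗ[ℂ] TPow n W) →ₗ[ℂ] (XiDeg E V n →ₗ[ℂ] XiDeg E W n) :=
    { toFun := fun t => Representation.Coinvariants.mk (xiRep E W n) ∘ₗ
        TensorProduct.map LinearMap.id t ∘ₗ σ
      map_add' := fun t t' => by
        simp only [TensorProduct.map_add_right, LinearMap.add_comp, LinearMap.comp_add]
      map_smul' := fun a t => by
        simp only [TensorProduct.map_smul_right, LinearMap.smul_comp, LinearMap.comp_smul,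
          RingHom.id_apply] }
  refine Eq.mp (congrArg (· ∈ polyMaps s n (XiDeg E V n →ₗ[ℂ] XiDeg E W n))
    (funext fun c => ?_)) (polyMaps_comp L (tpow_poly n fun i => flin (f i)))
  refine LinearMap.ext fun x => ?_
  refine Eq.trans ?_ (congrArg (xiLin (𝟙 E) (∑ i, c i • f i) n) (LinearMap.congr_fun hσ x))
  rw [LinearMap.comp_apply, xiLin_mk, flin_sum]
  rfl

lemma xiObj_poly (E : WreathRep G) : IsPolynomial G (xiObj E) := by
  obtain ⟨N, hN⟩ := xiDeg_subsingleton E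
  refine ⟨N, fun V W s f => ?_⟩
  let L (n : ℕ) : (XiDeg E V n →ₗ[ℂ] XiDeg E W n) →ₗ[ℂ] ((xiObj E).obj V ⟶ (xiObj E).obj W) :=
    { toFun := fun t => FGModuleCat.ofHom
        (DirectSum.lof ℂ ℕ (XiDeg E W) n ∘ₗ t ∘ₗ DirectSum.component ℂ ℕ (XiDeg E V) n)
      map_add' := fun t t' => FGModuleCat.hom_ext (by
        simp only [LinearMap.add_comp, LinearMap.comp_add]
        rfl)
      map_smul' := fun a t => FGModuleCat.hom_ext (by
        simp only [LinearMap.smul_comp, LinearMap.comp_smul]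
        rfl) }
  have := Submodule.sum_mem (polyMaps s N ((xiObj E).obj V ⟶ (xiObj E).obj W))
    (t := Finset.range N)
    (f := fun n c => L n (xiLin (𝟙 E) (∑ i, c i • f i) n)) fun n hn =>
      polyMaps_mono (Finset.mem_range.1 hn).le (polyMaps_comp (L n) (xiLin_poly E n f))
  refine Eq.mp (congrArg (· ∈ polyMaps s N ((xiObj E).obj V ⟶ (xiObj E).obj W))
    (funext fun c => ?_)) this
  rw [Finset.sum_apply]
  let ev : ((xiObj E).obj V ⟶ (xiObj E).obj W) →ₗ[ℂ]
      ((⨁ n, XiDeg E V n) →ₗ[ℂ] ⨁ n, XiDeg E W n) :=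
    { toFun := fun t => t.hom.hom
      map_add' := fun _ _ => rfl
      map_smul' := fun _ _ => rfl }
  apply FGModuleCat.hom_ext
  change ev _ = DirectSum.lmap fun n => xiLin (𝟙 E) (∑ i, c i • f i) n
  rw [map_sum]
  apply DirectSum.linearMap_ext
  intro m
  apply LinearMap.ext
  intro x
  rw [LinearMap.comp_apply, LinearMap.comp_apply, LinearMap.sum_apply, DirectSum.lmap_lof]
  have hL : ∀ n, ev (L n (xiLin (𝟙 E) (∑ i, c i • f i) n))
      (DirectSum.lof ℂ ℕ (XiDeg E V) m x) =
        DirectSum.lof ℂ ℕ (XiDeg E W) n (xiLin (𝟙 E) (∑ i, c i • f i) n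
          (DirectSum.component ℂ ℕ (XiDeg E V) n (DirectSum.lof ℂ ℕ (XiDeg E V) m x))) :=
    fun _ => rfl
  simp only [hL]
  by_cases hm : N ≤ m
  · have h₁ := hN V m hm
    have h₂ : x = 0 := Subsingleton.elim _ _
    simp [h₂]
  · rw [Finset.sum_eq_single m]
    · rw [DirectSum.component.lof_self]
    · intro n _ hn
      rw [DirectSum.component.of, dif_neg hn.symm, map_zero, map_zero]
    · intro h
      exact absurd (Finset.mem_range.2 (not_le.1 hm)) h

variable (G)

/-- The functor `Ξ` from families of representations of the groups `G ≀ S_n` to polynomial functors: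
`Ξ(E)(V) = ⨁_n E_n ⊗_{G ≀ S_n} V^{⊗ n}`. -/
def Xi : WreathRep G ⥤ PolyFun G :=
  (IsPolynomial G).lift
    { obj := xiObj
      map := xiMap
      map_id E := by
        ext V : 2
        exact FGModuleCat.hom_ext ((congrArg DirectSum.lmap (funext fun n =>
          xiLin_id E V n)).trans DirectSum.lmap_id)
      map_comp φ ψ := by
        ext V : 2
        refine FGModuleCat.hom_ext (Eq.trans ?_ (DirectSum.lmap_comp (fun n => xiLin φ (𝟙 V) n)
          (fun n => xiLin ψ (𝟙 V) n)))
        refine congrArg DirectSum.lmap (funext fun n => ?_)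
        have := xiLin_comp φ ψ (𝟙 V) (𝟙 V) n
        rwa [Category.comp_id] at this } xiObj_poly

end Xi

section Grothendieck

/-- The Grothendieck group of a category with a given class of short exact sequences
`0 → A → B → C → 0`: the free abelian group on the objects modulo the relations
`[B] = [A] + [C]`. -/
def K0 (𝒞 : Type*) (ses : 𝒞 → 𝒞 → 𝒞 → Prop) : Type _ :=
  FreeAbelianGroup 𝒞 ⧸ AddSubgroup.closure
    {x | ∃ A B C : 𝒞, ses A B C ∧
      x = FreeAbelianGroup.of B - (FreeAbelianGroup.of A + FreeAbelianGroup.of C)}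

instance (𝒞 : Type*) (ses : 𝒞 → 𝒞 → 𝒞 → Prop) : AddCommGroup (K0 𝒞 ses) :=
  inferInstanceAs (AddCommGroup (FreeAbelianGroup 𝒞 ⧸ AddSubgroup.closure _))

/-- The class of an object. -/
def K0.mk {𝒞 : Type*} {ses : 𝒞 → 𝒞 → 𝒞 → Prop} (A : 𝒞) : K0 𝒞 ses :=
  QuotientAddGroup.mk (FreeAbelianGroup.of A)

variable (G : Type) [Group G]

/-- Short exact sequences in `⨁_n rep(G ≀ S_n)`. -/
def wreathSES (A B C : WreathRep G) : Prop :=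
  ∃ (f : A ⟶ B) (g : B ⟶ C), ∀ n, Function.Injective (WreathRep.lin f n) ∧
    Function.Exact (WreathRep.lin f n) (WreathRep.lin g n) ∧
    Function.Surjective (WreathRep.lin g n)

variable {G} in
/-- The value at `V` of a morphism of polynomial functors. -/
def plin {F H : PolyFun G} (f : F ⟶ H) (V : FDRep ℂ G) : F.obj.obj V →ₗ[ℂ] H.obj.obj V :=
  (f.hom.app V).hom.hom

/-- Short exact sequences of polynomial functors: those that are exact at every `V`. -/
def polySES (A B C : PolyFun G) : Prop :=
  ∃ (f : A ⟶ B) (g : B ⟶ C), ∀ V, Function.Injective (plin f V) ∧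
    Function.Exact (plin f V) (plin g V) ∧ Function.Surjective (plin g V)

/-- The Grothendieck group of `⨁_n rep(G ≀ S_n)`. -/
abbrev K0Wreath : Type 1 := K0 (WreathRep G) (wreathSES G)

/-- The Grothendieck group of the category of polynomial functors. -/
abbrev K0Poly : Type 1 := K0 (PolyFun G) (polySES G)

end Grothendieck

section Characters

/-- The free `G`-representation `ℂ[G]^d`. -/
def freeRep (G : Type) [Group G] [Finite G] (d : ℕ) : FDRep ℂ G :=
  FDRep.of (V := Fin d → ℂ[G])
    { toFun g := LinearMap.mulLeft ℂ (fun _ : Fin d => MonoidAlgebra.single g (1 : ℂ))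
      map_one' := by
        refine LinearMap.ext fun v => ?_
        exact one_mul v
      map_mul' g h := by
        refine LinearMap.ext fun v => ?_
        funext i
        simp [MonoidAlgebra.single_mul_single, ← mul_assoc] }

/-- The diagonal endomorphism of `ℂ[G]^d` with entries `x_1, …, x_d ∈ ℂ[G]`. -/
def diagEnd {G : Type} [Group G] [Finite G] {d : ℕ} (x : Fin d → ℂ[G]) :
    freeRep G d ⟶ freeRep G d where
  hom := FGModuleCat.ofHom (LinearMap.mulRight ℂ x)
  comm g := FGModuleCat.hom_ext (LinearMap.ext fun v : Fin d → ℂ[G] =>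
    mul_assoc (fun _ => MonoidAlgebra.single g (1 : ℂ)) v x)

/-- The character of a polynomial functor `F`: the function that sends
`(x_1, …, x_d) ∈ ℂ[G]^d` to the trace of `F(diag(x_1, …, x_d))` on `F(ℂ[G]^d)`. -/
def polyChar {G : Type} [Group G] [Finite G] (F : PolyFun G) (d : ℕ) (x : Fin d → ℂ[G]) : ℂ :=
  LinearMap.trace ℂ (F.obj.obj (freeRep G d)) (F.obj.map (diagEnd x)).hom.hom

variable {G : Type} [CommGroup G]

/-- The linear extension to `ℂ[G]` of a linear character of `G`. -/
def charExt (χ : G →* ℂˣ) : ℂ[G] →ₐ[ℂ] ℂ :=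
  MonoidAlgebra.lift ℂ ℂ G ((Units.coeHom ℂ).comp χ)

/-- The value at `(x_1, …, x_d) ∈ ℂ[G]^d` of a polynomial in the coordinates `χ(x_i)`. -/
def classPoly {R : Type} [CommRing R] [Algebra R ℂ] {d : ℕ}
    (P : MvPolynomial ((G →* ℂˣ) × Fin d) R) (x : Fin d → ℂ[G]) : ℂ :=
  MvPolynomial.aeval (fun p : (G →* ℂˣ) × Fin d => charExt p.1 (x p.2)) P

/-- A polynomial in variables indexed by pairs `(χ, i)` is symmetric if it is invariant under
permuting, separately for each `χ`, the variables with first index `χ`. -/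
def IsSym {R : Type} [CommRing R] {d : ℕ} (P : MvPolynomial ((G →* ℂˣ) × Fin d) R) : Prop :=
  ∀ τ : (G →* ℂˣ) → Equiv.Perm (Fin d),
    MvPolynomial.rename (fun p : (G →* ℂˣ) × Fin d => (p.1, τ p.1 p.2)) P = P

variable (G) in
/-- The ring `Λ(G)` of symmetric polynomial class functions with coefficients in `R`: families of
symmetric polynomial functions `f_d : ℂ[G]^d → ℂ` of bounded degree, compatible with the inclusions
`ℂ[G]^d → ℂ[G]^{d+1}` by a last coordinate zero. -/
def symClassFun (R : Type) [CommRing R] [Algebra R ℂ] :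
    Subalgebra R (∀ d : ℕ, (Fin d → ℂ[G]) → ℂ) where
  carrier := {f | (∃ N : ℕ, ∀ d, ∃ P : MvPolynomial ((G →* ℂˣ) × Fin d) R,
      P.totalDegree ≤ N ∧ IsSym P ∧ ∀ x, f d x = classPoly P x) ∧
    ∀ d (x : Fin d → ℂ[G]), f (d + 1) (Fin.snoc (α := fun _ => ℂ[G]) x 0) = f d x}
  mul_mem' := by
    rintro f g ⟨⟨N, hf⟩, hf'⟩ ⟨⟨M, hg⟩, hg'⟩
    refine ⟨⟨N + M, fun d => ?_⟩, fun d x => ?_⟩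
    · obtain ⟨P, hP, hP', h⟩ := hf d
      obtain ⟨Q, hQ, hQ', k⟩ := hg d
      refine ⟨P * Q, (MvPolynomial.totalDegree_mul P Q).trans (add_le_add hP hQ),
        fun τ => ?_, fun x => ?_⟩
      · rw [map_mul, hP' τ, hQ' τ]
      · rw [classPoly, map_mul]
        exact congrArg₂ (· * ·) (h x) (k x)
    · exact congrArg₂ (· * ·) (hf' d x) (hg' d x)
  add_mem' := by
    rintro f g ⟨⟨N, hf⟩, hf'⟩ ⟨⟨M, hg⟩, hg'⟩
    refine ⟨⟨max N M, fun d => ?_⟩, fun d x => ?_⟩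
    · obtain ⟨P, hP, hP', h⟩ := hf d
      obtain ⟨Q, hQ, hQ', k⟩ := hg d
      refine ⟨P + Q, (MvPolynomial.totalDegree_add P Q).trans (max_le_max hP hQ),
        fun τ => ?_, fun x => ?_⟩
      · rw [map_add, hP' τ, hQ' τ]
      · rw [classPoly, map_add]
        exact congrArg₂ (· + ·) (h x) (k x)
    · exact congrArg₂ (· + ·) (hf' d x) (hg' d x)
  algebraMap_mem' r := by
    refine ⟨⟨0, fun d => ⟨MvPolynomial.C r, (MvPolynomial.totalDegree_C r).le,
      fun τ => MvPolynomial.rename_C _ _, fun x => ?_⟩⟩, fun d x => rfl⟩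
    rw [classPoly, MvPolynomial.aeval_C]
    rfl

/-- The class of `i` in the set of cycles of a permutation. -/
abbrev cycleOf {n : ℕ} (π : Equiv.Perm (Fin n)) (i : Fin n) :
    Quotient (Equiv.Perm.SameCycle.setoid π) := Quotient.mk _ i

/-- The power sum `p_r(c)` for `c ∈ G`, with value `∑_i ∑_χ χ(c) χ(x_i)^r` at `(x_1, …, x_d)`;
here `χ` runs over the characters of `G`. -/
def powerSum (r : ℕ) (c : G) (d : ℕ) (x : Fin d → ℂ[G]) : ℂ :=
  ∑ i, ∑ᶠ χ : G →* ℂˣ, (χ c : ℂ) * charExt χ (x i) ^ r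

/-- The product over the cycles of `π` of the power sums `p_r(c)`, where `r` is the length of the
cycle and `c` is the cycle product, for `w = (a, π) ∈ G ≀ S_n`. -/
def cyclePowerSum {n : ℕ} (w : Wr G n) (d : ℕ) (x : Fin d → ℂ[G]) : ℂ :=
  ∏ᶠ q : Quotient (Equiv.Perm.SameCycle.setoid w.right),
    powerSum (Nat.card {i // cycleOf w.right i = q})
      (∏ᶠ i : {i // cycleOf w.right i = q}, w.left i) d x

/-- The Frobenius characteristic of a family of representations of the groups `G ≀ S_n`. -/
def frob (E : WreathRep G) (d : ℕ) (x : Fin d → ℂ[G]) : ℂ :=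
  ∑ᶠ n : ℕ, (Nat.card (Wr G n) : ℂ)⁻¹ *
    ∑ᶠ w : Wr G n, (E.deg n).character w * cyclePowerSum w d x

end Characters

end WreathPoly

end

open WreathPoly

/-!
Both parts rest on one construction: the multilinear part `wt F n` of a polynomial functor `F`,
that is, the space of vectors of `F(ℂ[G]^n)` on which `diag(t_1, …, t_n)`, `t_i ∈ ℂ`, acts by
`t_1 ⋯ t_n`. Monomial matrices with entries in `G` make it a representation of `G ≀ S_n`.

**The equivalence.** A polynomial map `q` of degree at most `d` between vector spaces is the sum of
the diagonals of multilinear maps. Its `n`-th polarization `pol`, the coefficient of `c_1 ⋯ c_n` in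
`q(∑ c_i f_i)`, is extracted by averaging over roots of unity of order `N ≥ d + 2`, so it is a
linear expression in values of `q` and commutes with everything that is linear. Applied to
`f ↦ F(f)`, this has three consequences.

* `F([v_1, …, v_n])(x)` is multilinear in `v_1, …, v_n ∈ V` when `x ∈ wt F n`. Here
  `[v_1, …, v_n] : ℂ[G]^n → V` (`rowMap`) sends the standard basis to `v_1, …, v_n`.
* The identity of `V` is a sum of maps through `ℂ[G]`. Polarizing `F(id_V)` along this sum shows
  that `F(V)` is spanned by the images of multilinear parts (`wt_span`), and that a natural
  transformation that is injective on multilinear parts is injective (`injective_of_wt`).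
* The multilinear part of `Ξ(E)` in degree `n` is `E_n`, embedded by `x ↦ x ⊗ e_1 ⊗ ⋯ ⊗ e_n`
  (`iotaEquiv`): the projection to the multilinear part sends a generator `x ⊗ v_1 ⊗ ⋯ ⊗ v_m` to a
  combination of generators whose vectors lie in distinct coordinate lines, and the embedding has a
  retraction because the translates of `e_1 ⊗ ⋯ ⊗ e_n` under `G ≀ S_n` are linearly independent.

Hence `Ξ` is fully faithful, and for `E_n = wt F n` the map `x ⊗ v_1 ⊗ ⋯ ⊗ v_n ↦ F([v])(x)` is an
isomorphism `Ξ(E) ≅ F` (`thetaIso`), so `Ξ` is an equivalence. The tensorator of `Ξ` sends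
`(x ⊗ v) ⊗ (y ⊗ v')` to `(x · y) ⊗ (v, v')`; its inverse comes from the universal property of the
induction product, and the coherence conditions are checked on generators (`xi_monoidal`).

**The characteristic.** Let `G` be abelian.

* *The two maps agree and take values in `Λ_ℤ(G)`.* The trace on coinvariants is the average of the
  traces over the group, and in the basis of `ℂ[G]^d` of common eigenvectors of `G` the trace of
  `w ∈ G ≀ S_n` composed with `diag(x)^{⊗ n}` is `Ψ(w)(x)`; hence the character of `Ξ(E)` is
  `ch[E]` (`polyChar_xi`). The diagonal endomorphisms form a torus with coordinates `χ(x_i)`, and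
  the coefficient matrices of a polynomial representation of a torus are orthogonal idempotents, so
  the coefficients of the character are natural numbers (`polyChar_mem`).
* *Injectivity.* The trace of `w ∈ G ≀ S_n` on `wt F n` is a coefficient, again extracted with roots
  of unity, of the trace of `F` on monomial matrices of finite order (`trace_wtRep`). These are
  conjugate to diagonal endomorphisms, since on each isotypic component of `ℂ[G]^n` they are
  matrices of finite order over `ℂ` (`exists_trace_eq`). So the character of `F` determines the
  characters of the representations `wt F n`, hence `F` up to isomorphism
  (`nonempty_iso_of_polyChar`).
* *Surjectivity.* The characteristic of the linear character `sgn ⊗ χ⁻¹` of `G ≀ S_k` is the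
  elementary symmetric function of degree `k` of the coordinates with index `χ` (`frob_signFam`).
  By the fundamental theorem on symmetric polynomials in several sets of variables
  (`mem_adjoin_esymmAt`) products of these, which are characteristics of induction products,
  generate `Λ_R(G)` as an `R`-module; a degree bound reduces this from all `d` to one
  (`mem_span_frob`).
* *Complex coefficients.* Class functions with integer coefficients that are independent over `ℤ`
  are independent over `ℂ`, which gives injectivity of the complex characteristic map
  (`chComplex_injective`).
-/

noncomputable section

namespace WreathPoly

set_option linter.unusedSectionVars false
open Blk WreathRep

/-! ### Polarization of polynomial maps -/

/-- The linear functional on functions of `n` variables that extracts the coefficient of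
`c_1 ⋯ c_n` from a polynomial of degree less than `N` in each variable, written as an average over
`N`-th roots of unity. -/
def mlCoeff (N n : ℕ) {W : Type*} [AddCommGroup W] [Module ℂ W] (φ : (Fin n → ℂ) → W) : W :=
  ((N : ℂ)⁻¹ ^ n) • ∑ k : Fin n → Fin N,
    (∏ j, (Complex.exp (2 * Real.pi * Complex.I / N) ^ (k j : ℕ))⁻¹) •
      φ fun j => Complex.exp (2 * Real.pi * Complex.I / N) ^ (k j : ℕ)

section

variable {U W W' : Type*} [AddCommGroup U] [Module ℂ U] [AddCommGroup W] [Module ℂ W]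
  [AddCommGroup W'] [Module ℂ W']

lemma mlCoeff_map (N n : ℕ) (L : W →ₗ[ℂ] W') (φ : (Fin n → ℂ) → W) :
    mlCoeff N n (fun c => L (φ c)) = L (mlCoeff N n φ) := by
  simp [mlCoeff]

lemma mlCoeff_smul_right (N n : ℕ) (φ : (Fin n → ℂ) → ℂ) (w : W) :
    mlCoeff N n (fun c => φ c • w) = mlCoeff N n φ • w :=
  mlCoeff_map N n (LinearMap.toSpanSingleton ℂ W w) φ

lemma mlCoeff_sum (N n : ℕ) {ι : Type*} (s : Finset ι) (φ : ι → (Fin n → ℂ) → W) :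
    mlCoeff N n (fun c => ∑ i ∈ s, φ i c) = ∑ i ∈ s, mlCoeff N n (φ i) := by
  simp only [mlCoeff, Finset.smul_sum]
  rw [Finset.sum_comm]

/-- Averaging `ζ⁻¹ ζ^e` over the `N`-th roots of unity detects the exponent `e = 1`. -/
lemma rootOfUnity_average {N : ℕ} (hN : 2 ≤ N) {e : ℕ} (he : e < N) :
    (N : ℂ)⁻¹ * ∑ k : Fin N, (Complex.exp (2 * Real.pi * Complex.I / N) ^ (k : ℕ))⁻¹ *
      (Complex.exp (2 * Real.pi * Complex.I / N) ^ (k : ℕ)) ^ e = if e = 1 then 1 else 0 := by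
  have hN0 : (N : ℂ) ≠ 0 := by exact_mod_cast (by omega : N ≠ 0)
  set ζ := Complex.exp (2 * Real.pi * Complex.I / N) with hζ
  have hp : IsPrimitiveRoot ζ N := Complex.isPrimitiveRoot_exp N (by omega)
  have h0 : ζ ≠ 0 := Complex.exp_ne_zero _
  split_ifs with h1
  · subst h1
    simp [h0, hN0]
  · -- the sum is a geometric sum in `ζ⁻¹ ζ^e ≠ 1`
    have hη : ζ⁻¹ * ζ ^ e ≠ 1 := by
      intro h
      have h2 : ζ ^ e = ζ ^ 1 := by
        field_simp at h
        rw [h, pow_one]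
      exact h1 (hp.pow_inj he (by omega) h2)
    have hηN : (ζ⁻¹ * ζ ^ e) ^ N = 1 := by
      rw [mul_pow, inv_pow, hp.pow_eq_one, ← pow_mul, mul_comm e N, pow_mul, hp.pow_eq_one]
      simp
    have hs : ∑ k : Fin N, (ζ ^ (k : ℕ))⁻¹ * (ζ ^ (k : ℕ)) ^ e =
        ∑ k ∈ Finset.range N, (ζ⁻¹ * ζ ^ e) ^ k := by
      rw [Finset.sum_range]
      refine Finset.sum_congr rfl fun k _ => ?_
      rw [mul_pow, inv_pow, ← pow_mul, ← pow_mul, mul_comm e]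
    rw [hs, geom_sum_eq hη, hηN]
    simp

lemma mlCoeff_prod_pow {N : ℕ} (hN : 2 ≤ N) (n : ℕ) (e : Fin n → ℕ) (he : ∀ j, e j < N) :
    mlCoeff N n (fun c : Fin n → ℂ => ∏ j, c j ^ e j) = if ∀ j, e j = 1 then 1 else 0 := by
  rw [mlCoeff]
  simp only [smul_eq_mul, ← Finset.prod_mul_distrib]
  have h := Finset.prod_univ_sum (fun _ : Fin n => (Finset.univ : Finset (Fin N)))
    (fun j k => (Complex.exp (2 * Real.pi * Complex.I / N) ^ (k : ℕ))⁻¹ *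
      (Complex.exp (2 * Real.pi * Complex.I / N) ^ (k : ℕ)) ^ e j)
  rw [Fintype.piFinset_univ] at h
  rw [← h]
  have h2 : ((N : ℂ)⁻¹ ^ n) = ∏ _j : Fin n, (N : ℂ)⁻¹ := by simp
  rw [h2, ← Finset.prod_mul_distrib]
  rw [Finset.prod_congr rfl fun j _ => rootOfUnity_average hN (he j)]
  rw [Finset.prod_ite_zero]
  simp

/-- The functional extracts the monomials in which every variable occurs exactly once; a bound on
the degree excludes aliasing between exponents that agree modulo `N`. -/
lemma mlCoeff_monomial {N m n : ℕ} (hN : 2 ≤ N) (hm : m < N) (r : Fin m → Fin n) :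
    mlCoeff N n (fun c : Fin n → ℂ => ∏ l, c (r l)) =
      if Function.Bijective r then 1 else 0 := by
  have h : ∀ c : Fin n → ℂ, ∏ l, c (r l) =
      ∏ j, c j ^ (Finset.univ.filter fun l => r l = j).card := by
    intro c
    rw [← Finset.prod_fiberwise_of_maps_to (g := r) (t := Finset.univ)
      (fun _ _ => Finset.mem_univ _)]
    refine Finset.prod_congr rfl fun j _ => ?_
    rw [Finset.prod_congr rfl (g := fun _ => c j)
      (fun l hl => by rw [(Finset.mem_filter.1 hl).2]), Finset.prod_const]
  simp only [h]
  rw [mlCoeff_prod_pow hN]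
  · congr 1
    rw [Function.bijective_iff_existsUnique]
    refine propext (forall_congr' fun j => ?_)
    rw [Finset.card_eq_one]
    exact exists_congr fun a => by
      simp [Finset.ext_iff, iff_iff_implies_and_implies, forall_and, and_comm]
  · intro j
    exact ((Finset.card_le_univ _).trans (by simp)).trans_lt hm

/-- A map `q : U → W` that is a sum of the diagonals of multilinear maps of degrees at most `d`. -/
def IsPolyLaw (d : ℕ) (q : U → W) : Prop :=
  ∃ T : ∀ m : ℕ, MultilinearMap ℂ (fun _ : Fin m => U) W,
    ∀ f, q f = ∑ m ∈ Finset.range (d + 1), T m fun _ => f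

lemma isPolyLaw_monomial {s d : ℕ} (b : Module.Basis (Fin s) ℂ U) (e : Fin s →₀ ℕ)
    (he : (e.sum fun _ k => k) ≤ d) (w : W) :
    IsPolyLaw d fun f => (e.prod fun i k => b.repr f i ^ k) • w := by
  set m := (Finsupp.toMultiset e).toList.length with hm
  have hmd : m ≤ d := by
    rw [hm, Multiset.length_toList, Finsupp.card_toMultiset]
    exact he
  let u : Fin m → Fin s := fun l => (Finsupp.toMultiset e).toList.get l
  have hu : ∀ c : Fin s → ℂ, ∏ l, c (u l) = e.prod fun i k => c i ^ k := by
    intro c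
    have h1 : ∏ l, c (u l) = (((Finsupp.toMultiset e).toList.map c)).prod := by
      rw [← List.prod_ofFn]
      congr 1
      apply List.ext_get <;> simp [u, hm]
    rw [h1, ← Multiset.prod_coe, ← Multiset.map_coe, Multiset.coe_toList]
    rw [Finsupp.toMultiset_apply, Finsupp.sum, ← Multiset.coe_mapAddMonoidHom, map_sum,
      Multiset.prod_sum, Finsupp.prod]
    exact Finset.prod_congr rfl fun i _ => by
      rw [Multiset.coe_mapAddMonoidHom, Multiset.map_nsmul, Multiset.prod_nsmul]
      simp
  let T0 : MultilinearMap ℂ (fun _ : Fin m => U) W :=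
    (LinearMap.toSpanSingleton ℂ W w).compMultilinearMap
      ((MultilinearMap.mkPiAlgebra ℂ (Fin m) ℂ).compLinearMap fun l => b.coord (u l))
  refine ⟨Pi.single m T0, fun f => ?_⟩
  rw [Finset.sum_eq_single m]
  · rw [Pi.single_eq_same]
    simp [T0, ← hu (b.repr f)]
  · intro k _ hk
    rw [Pi.single_eq_of_ne hk]
    rfl
  · intro h
    exact absurd (Finset.mem_range.2 (by omega)) h

lemma IsPolyLaw.zero (d : ℕ) : IsPolyLaw d fun _ : U => (0 : W) :=
  ⟨0, fun f => by simp⟩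

lemma IsPolyLaw.add {d : ℕ} {p q : U → W} (hp : IsPolyLaw d p) (hq : IsPolyLaw d q) :
    IsPolyLaw d fun f => p f + q f := by
  obtain ⟨T, hT⟩ := hp
  obtain ⟨S, hS⟩ := hq
  exact ⟨T + S, fun f => by simp [hT, hS, Finset.sum_add_distrib]⟩

lemma IsPolyLaw.smul {d : ℕ} {p : U → W} (a : ℂ) (hp : IsPolyLaw d p) :
    IsPolyLaw d fun f => a • p f := by
  obtain ⟨T, hT⟩ := hp
  exact ⟨a • T, fun f => by simp [hT, Finset.smul_sum]⟩

lemma IsPolyLaw.sum {d : ℕ} {ι : Type*} (s : Finset ι) {p : ι → U → W}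
    (hp : ∀ i ∈ s, IsPolyLaw d (p i)) : IsPolyLaw d fun f => ∑ i ∈ s, p i f := by
  classical
  induction s using Finset.induction_on with
  | empty => simpa using IsPolyLaw.zero d
  | insert a s ha ih =>
    simp only [Finset.sum_insert ha]
    exact (hp a (Finset.mem_insert_self a s)).add
      (ih fun i hi => hp i (Finset.mem_insert_of_mem hi))

/-- A map that is polynomial in the coordinates with respect to a basis is a sum of diagonals of
multilinear maps. -/
lemma isPolyLaw_of_polyMaps {s d : ℕ} (b : Module.Basis (Fin s) ℂ U) {φ : (Fin s → ℂ) → W}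
    (h : φ ∈ polyMaps s d W) : IsPolyLaw d fun f => φ (b.repr f) := by
  induction h using Submodule.span_induction with
  | mem φ hφ =>
    obtain ⟨P, hP, w, rfl⟩ := hφ
    simp only [MvPolynomial.eval_eq, Finset.sum_smul, mul_smul]
    refine IsPolyLaw.sum _ fun e he => IsPolyLaw.smul _ ?_
    exact isPolyLaw_monomial b e ((MvPolynomial.le_totalDegree he).trans hP) w
  | zero => exact IsPolyLaw.zero d
  | add φ ψ _ _ h₁ h₂ => exact h₁.add h₂
  | smul a φ _ h => exact h.smul a

/-- The `n`-th polarization of a map. -/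
def pol (N n : ℕ) (q : U → W) (f : Fin n → U) : W :=
  mlCoeff N n fun c => q (∑ i, c i • f i)

/-- The `n`-th polarization sees only the homogeneous component of degree `n`, and symmetrizes the
corresponding multilinear map. -/
lemma pol_eq {d N n : ℕ} (hN : d + 2 ≤ N) {q : U → W}
    {T : ∀ m : ℕ, MultilinearMap ℂ (fun _ : Fin m => U) W}
    (hT : ∀ f, q f = ∑ m ∈ Finset.range (d + 1), T m fun _ => f) (f : Fin n → U) :
    pol N n q f = if n ≤ d then ∑ σ : Equiv.Perm (Fin n), T n fun i => f (σ i) else 0 := by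
  have h1 : pol N n q f = ∑ m ∈ Finset.range (d + 1), ∑ r : Fin m → Fin n,
      (if Function.Bijective r then (1 : ℂ) else 0) • T m fun l => f (r l) := by
    rw [pol]
    simp only [hT]
    rw [mlCoeff_sum]
    refine Finset.sum_congr rfl fun m hm => ?_
    have h2 : ∀ c : Fin n → ℂ, (T m fun _ => ∑ i, c i • f i) =
        ∑ r : Fin m → Fin n, (∏ l, c (r l)) • T m fun l => f (r l) := by
      intro c
      refine (MultilinearMap.map_sum (T m) fun _ i => c i • f i).trans
        (Finset.sum_congr rfl fun r _ => ?_)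
      exact (T m).map_smul_univ (fun l => c (r l)) (fun l => f (r l))
    simp only [h2]
    rw [mlCoeff_sum]
    refine Finset.sum_congr rfl fun r _ => ?_
    rw [mlCoeff_smul_right, mlCoeff_monomial (by omega)]
    exact (Finset.mem_range.1 hm).trans_le (by omega)
  rw [h1]
  have h3 : ∀ m ≠ n, ∑ r : Fin m → Fin n,
      (if Function.Bijective r then (1 : ℂ) else 0) • (T m fun l => f (r l)) = 0 := by
    intro m hm
    refine Finset.sum_eq_zero fun r _ => ?_
    rw [if_neg, zero_smul]
    intro hr
    exact hm (by simpa using Fintype.card_of_bijective hr)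
  split_ifs with hn
  · rw [Finset.sum_eq_single_of_mem n (Finset.mem_range.2 (by omega)) fun m _ hm => h3 m hm]
    simp only [ite_smul, one_smul, zero_smul]
    rw [← Finset.sum_filter]
    refine (Finset.sum_bij (fun (σ : Equiv.Perm (Fin n)) _ => ⇑σ) ?_ ?_ ?_ ?_).symm
    · intro σ _
      exact Finset.mem_filter.2 ⟨Finset.mem_univ _, σ.bijective⟩
    · intro σ _ τ _ h
      exact DFunLike.coe_injective h
    · intro r hr
      exact ⟨Equiv.ofBijective r (Finset.mem_filter.1 hr).2, Finset.mem_univ _, rfl⟩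
    · intro σ _
      rfl
  · exact Finset.sum_eq_zero fun m hm => h3 m (by
      have := Finset.mem_range.1 hm
      omega)

lemma exists_pol_multilinear {d : ℕ} {q : U → W} (hq : IsPolyLaw d q) (n : ℕ) :
    ∃ S : MultilinearMap ℂ (fun _ : Fin n => U) W, ∀ N, d + 2 ≤ N → ∀ f, pol N n q f = S f := by
  obtain ⟨T, hT⟩ := hq
  by_cases hn : n ≤ d
  · refine ⟨∑ σ : Equiv.Perm (Fin n), (T n).domDomCongr σ, fun N hN f => ?_⟩
    rw [pol_eq hN hT, if_pos hn]
    simp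
  · refine ⟨0, fun N hN f => ?_⟩
    rw [pol_eq hN hT, if_neg hn]
    rfl

lemma pol_eq_zero {d N n : ℕ} (hN : d + 2 ≤ N) {q : U → W} (hq : IsPolyLaw d q) (hn : d < n)
    (f : Fin n → U) : pol N n q f = 0 := by
  obtain ⟨T, hT⟩ := hq
  rw [pol_eq hN hT, if_neg (by omega)]

/-- A polynomial map is recovered from its polarizations. -/
lemma eq_sum_pol {d N : ℕ} (hN : d + 2 ≤ N) {q : U → W} (hq : IsPolyLaw d q) (f : U) :
    q f = ∑ n ∈ Finset.range (d + 1), ((n.factorial : ℂ)⁻¹) • pol N n q fun _ => f := by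
  obtain ⟨T, hT⟩ := hq
  rw [hT]
  refine Finset.sum_congr rfl fun n hn => ?_
  rw [pol_eq hN hT, if_pos (by have := Finset.mem_range.1 hn; omega)]
  rw [Finset.sum_const, Finset.card_univ, Fintype.card_perm, Fintype.card_fin,
    ← Nat.cast_smul_eq_nsmul ℂ, smul_smul, inv_mul_cancel₀ (by exact_mod_cast n.factorial_ne_zero),
    one_smul]

end

/-! ### The induction product on elements -/

section

variable {G : Type} [Group G] [Finite G]

/-- The product `E_p × F_q → (E ⊗ F)_{p + q}`. -/
def star {E F : WreathRep G} {p q : ℕ} (x : E.deg p) (y : F.deg q) : (E ⊗ F).deg (p + q) :=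
  indIncl E F (rfl : p + q = p + q) 1 (x ⊗ₜ y)

open LawfulDayConvolutionMonoidalCategoryStruct

lemma lin_whiskerRight {E E' : WreathRep G} (f : E ⟶ E') (F : WreathRep G) {p q : ℕ}
    (x : E.deg p) (y : F.deg q) :
    lin (f ▷ F) (p + q) (star x y) = star (lin f p x) y := by
  have := convolutionExtensionUnit_comp_ι_map_whiskerRight_app (Blk G) (ModuleCat.{0} ℂ) f F
    ⟨p⟩ ⟨q⟩
  exact LinearMap.congr_fun (congrArg ModuleCat.Hom.hom this) (x ⊗ₜ[ℂ] y)

lemma lin_whiskerLeft (E : WreathRep G) {F F' : WreathRep G} (f : F ⟶ F') {p q : ℕ}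
    (x : E.deg p) (y : F.deg q) :
    lin (E ◁ f) (p + q) (star x y) = star x (lin f q y) := by
  have := convolutionExtensionUnit_comp_ι_map_whiskerLeft_app (C := Blk G) (ModuleCat.{0} ℂ) E f
    ⟨p⟩ ⟨q⟩
  exact LinearMap.congr_fun (congrArg ModuleCat.Hom.hom this) (x ⊗ₜ[ℂ] y)

/-- On elements, the associator is the transport along the associativity of juxtaposition. -/
lemma lin_associator {E F H : WreathRep G} {p q r : ℕ} (x : E.deg p) (y : F.deg q)
    (z : H.deg r) :
    lin (α_ E F H).hom (p + q + r) (star (star x y) z) =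
      act (E ⊗ F ⊗ H) (assoc (⟨p⟩ : Blk G) ⟨q⟩ ⟨r⟩).inv (star x (star y z)) := by
  have := associator_hom_unit_unit (C := Blk G) (ModuleCat.{0} ℂ) E F H ⟨p⟩ ⟨q⟩ ⟨r⟩
  have h := LinearMap.congr_fun (congrArg ModuleCat.Hom.hom this) ((x ⊗ₜ[ℂ] y) ⊗ₜ[ℂ] z)
  simp only [ModuleCat.hom_comp, LinearMap.comp_apply] at h
  refine Eq.trans ?_ (h.trans ?_)
  · rfl
  · rfl

lemma lin_leftUnitor {E : WreathRep G} {n : ℕ} (c : ℂ) (x : E.deg n) :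
    lin (λ_ E).hom (0 + n) (star (E := 𝟙_ (WreathRep G)) (unitCan c) x) =
      act E (leftU (⟨n⟩ : Blk G)).inv (c • x) := by
  have := leftUnitor_hom_unit_app (C := Blk G) (ModuleCat.{0} ℂ) E ⟨n⟩
  exact LinearMap.congr_fun (congrArg ModuleCat.Hom.hom this) (c ⊗ₜ[ℂ] x)

lemma lin_rightUnitor {E : WreathRep G} {n : ℕ} (c : ℂ) (x : E.deg n) :
    lin (ρ_ E).hom (n + 0) (star (F := 𝟙_ (WreathRep G)) x (unitCan c)) =
      act E (rightU (⟨n⟩ : Blk G)).inv (c • x) := by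
  have := rightUnitor_hom_unit_app (C := Blk G) (ModuleCat.{0} ℂ) E ⟨n⟩
  exact LinearMap.congr_fun (congrArg ModuleCat.Hom.hom this) (x ⊗ₜ[ℂ] c)

end

/-! ### Generators of `Ξ(E)(V)` and the tensorator -/

section

variable {G : Type} [Group G]

/-- The underlying space of `Ξ(E)(V)`. -/
abbrev XiSp (E : WreathRep G) (V : FDRep ℂ G) : Type := ⨁ n, XiDeg E V n

/-- The class of `x ⊗ t` in `Ξ(E)(V)`, bilinear in `x ∈ E_n` and `t ∈ V^{⊗ n}`. -/
def xiBil (E : WreathRep G) (V : FDRep ℂ G) (n : ℕ) :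
    E.deg n →ₗ[ℂ] TPow n V →ₗ[ℂ] XiSp E V :=
  (TensorProduct.mk ℂ (E.deg n) (TPow n V)).compr₂
    (DirectSum.lof ℂ ℕ (XiDeg E V) n ∘ₗ Representation.Coinvariants.mk (xiRep E V n))

/-- The generator `x ⊗ v_1 ⊗ ⋯ ⊗ v_n` of `Ξ(E)(V)`. -/
def xg {E : WreathRep G} {V : FDRep ℂ G} {n : ℕ} (x : E.deg n) (v : Fin n → V) : XiSp E V :=
  xiBil E V n x (PiTensorProduct.tprod ℂ v)

lemma xi_hom_ext {E : WreathRep G} {V : FDRep ℂ G} {T : Type*} [AddCommGroup T] [Module ℂ T]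
    {f g : XiSp E V →ₗ[ℂ] T}
    (h : ∀ n (x : E.deg n) (v : Fin n → V), f (xg x v) = g (xg x v)) : f = g := by
  apply DirectSum.linearMap_ext
  intro n
  apply Representation.Coinvariants.hom_ext
  apply TensorProduct.ext
  refine LinearMap.ext fun x => PiTensorProduct.ext (MultilinearMap.ext fun v => h n x v)

/-- The action of the wreath product on tuples of vectors. -/
def wact {V : FDRep ℂ G} {n : ℕ} (w : Wr G n) (v : Fin n → V) : Fin n → V :=
  fun i => V.ρ (w.left i) (v (w.right.symm i))

lemma xiBil_rho {E : WreathRep G} {V : FDRep ℂ G} {n : ℕ} (w : Wr G n) (x : E.deg n)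
    (t : TPow n V) :
    xiBil E V n ((E.deg n).ρ w x) (tensorPowRep n V.ρ w t) = xiBil E V n x t :=
  congrArg (DirectSum.lof ℂ ℕ (XiDeg E V) n)
    (Representation.Coinvariants.mk_self_apply (xiRep E V n) w (x ⊗ₜ t))

lemma xg_rho {E : WreathRep G} {V : FDRep ℂ G} {n : ℕ} (w : Wr G n) (x : E.deg n)
    (v : Fin n → V) : xg ((E.deg n).ρ w x) (wact w v) = xg x v := by
  refine Eq.trans ?_ (xiBil_rho w x (PiTensorProduct.tprod ℂ v))
  rw [tensorPowRep_tprod]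
  rfl

/-- The generators are invariant under labelled bijections acting simultaneously on `x` and on the
tuple of vectors. -/
lemma xg_act {E : WreathRep G} {V : FDRep ℂ G} {X Y : Blk G} (f : X ⟶ Y) (x : E.deg X.rank)
    (v : Fin X.rank → V) (v' : Fin Y.rank → V)
    (h : ∀ i, v' (Hom.perm f i) = V.ρ (val f i) (v i)) : xg (act E f x) v' = xg x v := by
  obtain ⟨m⟩ := X
  obtain ⟨n⟩ := Y
  obtain rfl : m = n := rank_eq f
  refine Eq.trans ?_ (xg_rho (toWr f) x v)
  refine congrArg (xg ((E.deg m).ρ (toWr f) x)) (funext fun i => ?_)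
  obtain ⟨j, rfl⟩ := (Hom.perm f).surjective i
  rw [h]
  have : (toWr f).right.symm (Hom.perm f j) = j := (Hom.perm f).symm_apply_apply j
  rw [wact, this]
  rfl

/-- `Ξ(φ)(f)`. -/
def xiHom {E E' : WreathRep G} (φ : E ⟶ E') {V W : FDRep ℂ G} (f : V ⟶ W) :
    XiSp E V →ₗ[ℂ] XiSp E' W :=
  DirectSum.lmap fun n => xiLin φ f n

lemma xiHom_xg {E E' : WreathRep G} (φ : E ⟶ E') {V W : FDRep ℂ G} (f : V ⟶ W) {n : ℕ}
    (x : E.deg n) (v : Fin n → V) :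
    xiHom φ f (xg x v) = xg (lin φ n x) fun i => flin f (v i) := by
  refine (DirectSum.lmap_lof _ n _).trans ?_
  refine congrArg (DirectSum.lof ℂ ℕ (XiDeg E' W) n) ?_
  refine (xiLin_mk φ f n _).trans ?_
  exact congrArg (fun t => Representation.Coinvariants.mk (xiRep E' W n) (lin φ n x ⊗ₜ t))
    (PiTensorProduct.map_tprod _ _)

/-- Concatenation of tuples. -/
def conc {V : Type*} {p q : ℕ} (v : Fin p → V) (v' : Fin q → V) : Fin (p + q) → V :=
  fun i => Sum.elim v v' (finSumFinEquiv.symm i)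

@[simp] lemma conc_inl {V : Type*} {p q : ℕ} (v : Fin p → V) (v' : Fin q → V) (i : Fin p) :
    conc v v' (Fin.castAdd q i) = v i := by
  simp [conc]

@[simp] lemma conc_inr {V : Type*} {p q : ℕ} (v : Fin p → V) (v' : Fin q → V) (i : Fin q) :
    conc v v' (Fin.natAdd p i) = v' i := by
  simp [conc]

lemma wact_block {V : FDRep ℂ G} {p q : ℕ} (u : Wr G p) (w : Wr G q) (v : Fin p → V)
    (v' : Fin q → V) :
    wact (block G rfl (u, w)) (conc v v') = conc (wact u v) (wact w v') := by
  funext i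
  obtain ⟨j, rfl⟩ := finSumFinEquiv.surjective i
  have hj : (block G rfl (u, w)).right.symm (finSumFinEquiv j) =
      finSumFinEquiv ((Equiv.sumCongr u.right w.right).symm j) :=
    (Equiv.symm_apply_eq _).2 (by cases j <;> simp [block, juxt, Equiv.permCongr_apply])
  rw [wact, hj]
  cases j with
  | inl j => simp [conc, block, juxt, wact]
  | inr j => simp [conc, block, juxt, wact]

lemma xi_pre_ext {E : WreathRep G} {V : FDRep ℂ G} {n : ℕ} {T : Type*} [AddCommGroup T]
    [Module ℂ T] {f g : (E.deg n ⊗[ℂ] TPow n V) →ₗ[ℂ] T}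
    (h : ∀ (x : E.deg n) (v : Fin n → V),
      f (x ⊗ₜ PiTensorProduct.tprod ℂ v) = g (x ⊗ₜ PiTensorProduct.tprod ℂ v)) : f = g :=
  TensorProduct.ext (LinearMap.ext fun x => PiTensorProduct.ext (MultilinearMap.ext (h x)))

lemma xiRep_tprod {E : WreathRep G} {V : FDRep ℂ G} {n : ℕ} (w : Wr G n) (x : E.deg n)
    (v : Fin n → V) : xiRep E V n w (x ⊗ₜ PiTensorProduct.tprod ℂ v) =
      (E.deg n).ρ w x ⊗ₜ PiTensorProduct.tprod ℂ (wact w v) :=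
  congrArg (fun t => (E.deg n).ρ w x ⊗ₜ[ℂ] t) (tensorPowRep_tprod n V.ρ w v)

lemma wact_one {V : FDRep ℂ G} {n : ℕ} (v : Fin n → V) : wact (1 : Wr G n) v = v := by
  funext i
  simp only [wact, SemidirectProduct.one_left, Pi.one_apply, map_one]
  rfl

variable [Finite G]

/-- The product is equivariant for the block inclusion `(G ≀ S_p) × (G ≀ S_q) → G ≀ S_{p+q}`. -/
lemma star_rho {E F : WreathRep G} {p q : ℕ} (u : Wr G p) (w : Wr G q) (x : E.deg p)
    (y : F.deg q) :
    (star ((E.deg p).ρ u x) ((F.deg q).ρ w y) : (E ⊗ F).deg (p + q)) =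
      ((E ⊗ F).deg (p + q)).ρ (block G rfl (u, w)) (star x y) := by
  have h₁ := indIncl_block E F (rfl : p + q = p + q) u w 1 x y
  have h₂ := indIncl_rho E F (rfl : p + q = p + q) (block G rfl (u, w)) 1 (x ⊗ₜ y)
  rw [one_mul] at h₁
  rw [mul_one] at h₂
  exact h₁.symm.trans h₂.symm

lemma xg_star_rho {E F : WreathRep G} {V : FDRep ℂ G} {p q : ℕ} (u : Wr G p) (w : Wr G q)
    (x : E.deg p) (y : F.deg q) (v : Fin p → V) (v' : Fin q → V) :
    xg (star ((E.deg p).ρ u x) ((F.deg q).ρ w y)) (conc (wact u v) (wact w v')) =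
      xg (star x y) (conc v v') := by
  rw [star_rho, ← wact_block, xg_rho]

/-- Concatenation of tensors. -/
def tconc (p q : ℕ) (V : Type) [AddCommGroup V] [Module ℂ V] :
    TPow p V ⊗[ℂ] TPow q V ≃ₗ[ℂ] TPow (p + q) V :=
  (PiTensorProduct.tmulEquiv ℂ V).trans
    (PiTensorProduct.reindex ℂ (fun _ => V) finSumFinEquiv)

lemma tconc_tprod (p q : ℕ) {V : Type} [AddCommGroup V] [Module ℂ V] (v : Fin p → V)
    (v' : Fin q → V) :
    tconc p q V (PiTensorProduct.tprod ℂ v ⊗ₜ PiTensorProduct.tprod ℂ v') =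
      PiTensorProduct.tprod ℂ (conc v v') := by
  rw [tconc, LinearEquiv.trans_apply, PiTensorProduct.tmulEquiv_apply,
    PiTensorProduct.reindex_tprod]
  rfl

/-- The tensorator before passing to coinvariants. -/
def muPre (E F : WreathRep G) (V : FDRep ℂ G) (p q : ℕ) :
    (E.deg p ⊗[ℂ] TPow p V) →ₗ[ℂ] (F.deg q ⊗[ℂ] TPow q V) →ₗ[ℂ] XiSp (E ⊗ F) V :=
  TensorProduct.curry
    (TensorProduct.lift ((xiBil (E ⊗ F) V (p + q)).compl₁₂ (indIncl E F rfl 1)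
      (tconc p q V).toLinearMap) ∘ₗ
        (TensorProduct.tensorTensorTensorComm ℂ (E.deg p) (TPow p V) (F.deg q)
          (TPow q V)).toLinearMap)

lemma muPre_tprod (E F : WreathRep G) (V : FDRep ℂ G) (p q : ℕ) (x : E.deg p) (y : F.deg q)
    (v : Fin p → V) (v' : Fin q → V) :
    muPre E F V p q (x ⊗ₜ PiTensorProduct.tprod ℂ v) (y ⊗ₜ PiTensorProduct.tprod ℂ v') =
      xg (star x y) (conc v v') :=
  congrArg (xiBil (E ⊗ F) V (p + q) (star x y)) (tconc_tprod p q v v')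

/-- The tensorator in degrees `p` and `q`. -/
def muDeg (E F : WreathRep G) (V : FDRep ℂ G) (p q : ℕ) :
    XiDeg E V p →ₗ[ℂ] XiDeg F V q →ₗ[ℂ] XiSp (E ⊗ F) V :=
  LinearMap.flip (Representation.Coinvariants.lift (xiRep F V q)
    (LinearMap.flip (Representation.Coinvariants.lift (xiRep E V p) (muPre E F V p q) (by
      intro u
      refine xi_pre_ext fun x v => xi_pre_ext fun y v' => ?_
      rw [LinearMap.comp_apply, xiRep_tprod, muPre_tprod, muPre_tprod]
      have := xg_star_rho u (1 : Wr G q) x y v v'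
      rwa [map_one, wact_one] at this))) (by
    intro w
    refine xi_pre_ext fun y v' => Representation.Coinvariants.hom_ext
      (xi_pre_ext fun x v => ?_)
    change muPre E F V p q (x ⊗ₜ PiTensorProduct.tprod ℂ v)
      (xiRep F V q w (y ⊗ₜ PiTensorProduct.tprod ℂ v')) = muPre E F V p q
        (x ⊗ₜ PiTensorProduct.tprod ℂ v) (y ⊗ₜ PiTensorProduct.tprod ℂ v')
    rw [xiRep_tprod, muPre_tprod, muPre_tprod]
    have := xg_star_rho (1 : Wr G p) w x y v v'
    rwa [map_one, wact_one] at this))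

/-- The tensorator `Ξ(E)(V) ⊗ Ξ(F)(V) → Ξ(E ⊗ F)(V)`. -/
def muLin (E F : WreathRep G) (V : FDRep ℂ G) :
    XiSp E V ⊗[ℂ] XiSp F V →ₗ[ℂ] XiSp (E ⊗ F) V :=
  TensorProduct.lift (DirectSum.toModule ℂ ℕ _ fun p =>
    LinearMap.flip (DirectSum.toModule ℂ ℕ _ fun q => LinearMap.flip (muDeg E F V p q)))

lemma muLin_xg {E F : WreathRep G} {V : FDRep ℂ G} {p q : ℕ} (x : E.deg p) (y : F.deg q)
    (v : Fin p → V) (v' : Fin q → V) :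
    muLin E F V (xg x v ⊗ₜ xg y v') = xg (star x y) (conc v v') := by
  rw [muLin, TensorProduct.lift.tmul]
  have h₁ : ∀ z, DirectSum.toModule ℂ ℕ (XiSp F V →ₗ[ℂ] XiSp (E ⊗ F) V) (fun p =>
      LinearMap.flip (DirectSum.toModule ℂ ℕ _ fun q => LinearMap.flip (muDeg E F V p q)))
        (DirectSum.lof ℂ ℕ (XiDeg E V) p z) = _ := fun z => DirectSum.toModule_lof ℂ p z
  refine (LinearMap.congr_fun (h₁ (Representation.Coinvariants.mk (xiRep E V p)
    (x ⊗ₜ PiTensorProduct.tprod ℂ v))) (xg y v')).trans ?_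
  rw [LinearMap.flip_apply]
  refine (LinearMap.congr_fun (DirectSum.toModule_lof ℂ q _) _).trans ?_
  exact muPre_tprod E F V p q x y v v'

end

section

variable {G : Type} [Group G]

lemma wact_mul {V : FDRep ℂ G} {n : ℕ} (u w : Wr G n) (v : Fin n → V) :
    wact (u * w) v = wact u (wact w v) := by
  funext i
  simp only [wact, SemidirectProduct.mul_left, Pi.mul_apply, map_mul]
  rfl

lemma wact_inv_wact {V : FDRep ℂ G} {n : ℕ} (u : Wr G n) (v : Fin n → V) :
    wact u⁻¹ (wact u v) = v := by
  rw [← wact_mul, inv_mul_cancel, wact_one]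

lemma wact_wact_inv {V : FDRep ℂ G} {n : ℕ} (u : Wr G n) (v : Fin n → V) :
    wact u (wact u⁻¹ v) = v := by
  rw [← wact_mul, mul_inv_cancel, wact_one]

lemma conc_surj {V : Type*} {p q : ℕ} (v : Fin (p + q) → V) : ∃ a b, v = conc a b :=
  ⟨fun i => v (Fin.castAdd q i), fun i => v (Fin.natAdd p i), by
    funext i
    obtain ⟨j, rfl⟩ := finSumFinEquiv.surjective i
    cases j <;> simp [conc]⟩

variable [Finite G]

/-- Splitting a tensor in `V^{⊗ n}` into its first `p` and last `q` factors, after applying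
`w⁻¹`, and pairing it with `E_p ⊗ F_q`. -/
def nuPre (E F : WreathRep G) (V : FDRep ℂ G) {n : ℕ} (p q : ℕ) (h : p + q = n) (w : Wr G n) :
    E.deg p ⊗[ℂ] F.deg q →ₗ[ℂ] TPow n V →ₗ[ℂ] XiSp E V ⊗[ℂ] XiSp F V :=
  LinearMap.lcomp ℂ _ ((tconc p q V).symm.toLinearMap ∘ₗ
      (PiTensorProduct.reindex ℂ (fun _ => V) (finCongr h.symm)).toLinearMap ∘ₗ
        tensorPowRep n V.ρ w⁻¹) ∘ₗ
    TensorProduct.homTensorHomMap (.id ℂ) (TPow p V) (TPow q V) (XiSp E V) (XiSp F V) ∘ₗ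
      TensorProduct.map (xiBil E V p) (xiBil F V q)

lemma nuPre_tprod (E F : WreathRep G) (V : FDRep ℂ G) {p q : ℕ} (w : Wr G (p + q))
    (x : E.deg p) (y : F.deg q) (a : Fin p → V) (b : Fin q → V) :
    nuPre E F V p q rfl w (x ⊗ₜ y) (PiTensorProduct.tprod ℂ (wact w (conc a b))) =
      xg x a ⊗ₜ xg y b := by
  have h₁ : (tconc p q V).symm (PiTensorProduct.reindex ℂ (fun _ => V)
      (finCongr (rfl : p + q = p + q)) (tensorPowRep (p + q) V.ρ w⁻¹
        (PiTensorProduct.tprod ℂ (wact w (conc a b))))) =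
      PiTensorProduct.tprod ℂ a ⊗ₜ PiTensorProduct.tprod ℂ b := by
    rw [LinearEquiv.symm_apply_eq, tconc_tprod, tensorPowRep_tprod, PiTensorProduct.reindex_tprod]
    exact congrArg _ (wact_inv_wact w (conc a b))
  rw [nuPre]
  simp only [LinearMap.comp_apply, LinearMap.lcomp_apply, TensorProduct.map_tmul]
  refine Eq.trans (congrArg _ h₁) ?_
  rfl

/-- The balancing condition of the induction product, which makes the inverse of the tensorator well
defined. -/
lemma nuPre_block (E F : WreathRep G) (V : FDRep ℂ G) {n : ℕ} (p q : ℕ) (h : p + q = n)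
    (u : Wr G p) (v : Wr G q) (w : Wr G n) (x : E.deg p) (y : F.deg q) :
    nuPre E F V p q h (w * block G h (u, v)) (x ⊗ₜ y) =
      nuPre E F V p q h w ((E.deg p).ρ u x ⊗ₜ (F.deg q).ρ v y) := by
  subst h
  refine PiTensorProduct.ext (MultilinearMap.ext fun t => ?_)
  obtain ⟨a, b, hab⟩ := conc_surj (wact (w * block G rfl (u, v))⁻¹ t)
  obtain rfl : t = wact (w * block G rfl (u, v)) (conc a b) := by
    rw [← hab, wact_wact_inv]
  simp only [LinearMap.compMultilinearMap_apply]
  rw [nuPre_tprod, wact_mul, wact_block, nuPre_tprod, xg_rho, xg_rho]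

/-- The map out of `(E ⊗ F)_n` assembled from the maps `nuPre`. -/
def nuInd (E F : WreathRep G) (V : FDRep ℂ G) (n : ℕ) :
    (E ⊗ F).deg n →ₗ[ℂ] TPow n V →ₗ[ℂ] XiSp E V ⊗[ℂ] XiSp F V :=
  indDesc E F (T := TPow n V →ₗ[ℂ] XiSp E V ⊗[ℂ] XiSp F V) (nuPre E F V) (nuPre_block E F V)

lemma rho_star {E F : WreathRep G} {p q : ℕ} (w : Wr G (p + q)) (x : E.deg p) (y : F.deg q) :
    ((E ⊗ F).deg (p + q)).ρ w (star x y) = indIncl E F rfl w (x ⊗ₜ y) := by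
  have h := indIncl_rho E F (rfl : p + q = p + q) w 1 (x ⊗ₜ y)
  rw [mul_one] at h
  exact h

/-- The degree `n` part of `E ⊗ F` is spanned by the translates of the products of elements. -/
lemma tensor_hom_ext {E F : WreathRep G} {n : ℕ} {T : Type} [AddCommGroup T]
    [Module ℂ T] {f g : (E ⊗ F).deg n →ₗ[ℂ] T}
    (h : ∀ (p q : ℕ) (h : p + q = n) (w : Wr G n) (x : E.deg p) (y : F.deg q),
      f (((E ⊗ F).deg n).ρ w ((E ⊗ F).cast h (star x y))) =
        g (((E ⊗ F).deg n).ρ w ((E ⊗ F).cast h (star x y)))) : f = g := by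
  refine indIncl_hom_ext E F fun p q hpq w x y => ?_
  have := h p q hpq w x y
  subst hpq
  refine (congrArg f (rho_star w x y)).symm.trans (this.trans ?_)
  exact congrArg g (rho_star w x y)

lemma nuInd_rho (E F : WreathRep G) (V : FDRep ℂ G) {p q : ℕ} (w : Wr G (p + q))
    (x : E.deg p) (y : F.deg q) (a : Fin p → V) (b : Fin q → V) :
    nuInd E F V (p + q) (((E ⊗ F).deg (p + q)).ρ w (star x y))
      (PiTensorProduct.tprod ℂ (wact w (conc a b))) = xg x a ⊗ₜ xg y b := by
  have h₁ := indDesc_incl E F (T := TPow (p + q) V →ₗ[ℂ] XiSp E V ⊗[ℂ] XiSp F V)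
    (nuPre E F V) (nuPre_block E F V) rfl w (x ⊗ₜ y)
  have h₂ : nuInd E F V (p + q) (((E ⊗ F).deg (p + q)).ρ w (star x y)) =
    nuPre E F V p q rfl w (x ⊗ₜ y) := (congrArg (nuInd E F V (p + q)) (rho_star w x y)).trans h₁
  rw [h₂, nuPre_tprod]

/-- The inverse of the tensorator in degree `n`. -/
def nuDeg (E F : WreathRep G) (V : FDRep ℂ G) (n : ℕ) :
    XiDeg (E ⊗ F) V n →ₗ[ℂ] XiSp E V ⊗[ℂ] XiSp F V :=
  Representation.Coinvariants.lift (xiRep (E ⊗ F) V n)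
    (TensorProduct.lift (nuInd E F V n)) (by
      intro u
      apply TensorProduct.ext
      refine tensor_hom_ext (T := TPow n V →ₗ[ℂ] XiSp E V ⊗[ℂ] XiSp F V) fun p q hpq w x y => ?_
      refine PiTensorProduct.ext (MultilinearMap.ext fun t => ?_)
      subst hpq
      obtain ⟨a, b, hab⟩ := conc_surj (wact w⁻¹ t)
      obtain rfl : t = wact w (conc a b) := by rw [← hab, wact_wact_inv]
      refine Eq.trans (congrArg (TensorProduct.lift (nuInd E F V (p + q)))
        (xiRep_tprod (E := E ⊗ F) u (((E ⊗ F).deg (p + q)).ρ w (star x y))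
          (wact w (conc a b)))) ?_
      refine Eq.trans ?_ (nuInd_rho E F V w x y a b).symm
      refine Eq.trans ?_ (nuInd_rho E F V (u * w) x y a b)
      rw [TensorProduct.lift.tmul, ← wact_mul, map_mul]
      rfl)

/-- The inverse of the tensorator. -/
def nuLin (E F : WreathRep G) (V : FDRep ℂ G) :
    XiSp (E ⊗ F) V →ₗ[ℂ] XiSp E V ⊗[ℂ] XiSp F V :=
  DirectSum.toModule ℂ ℕ _ (nuDeg E F V)

lemma nuLin_xg {E F : WreathRep G} {V : FDRep ℂ G} {p q : ℕ}
    (x : E.deg p) (y : F.deg q) (a : Fin p → V) (b : Fin q → V) :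
    nuLin E F V (xg (star x y) (conc a b)) = xg x a ⊗ₜ xg y b := by
  refine (DirectSum.toModule_lof ℂ (p + q) _).trans ?_
  refine Eq.trans ?_ (nuInd_rho E F V 1 x y a b)
  rw [map_one, wact_one]
  rfl

/-- `Ξ(E ⊗ F)(V)` is spanned by the generators attached to products and concatenated tuples, because
translates can be absorbed in the tuple. -/
lemma xi_tensor_ext {E F : WreathRep G} {V : FDRep ℂ G} {T : Type} [AddCommGroup T] [Module ℂ T]
    {f g : XiSp (E ⊗ F) V →ₗ[ℂ] T}
    (h : ∀ (p q : ℕ) (x : E.deg p) (y : F.deg q) (a : Fin p → V) (b : Fin q → V),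
      f (xg (star x y) (conc a b)) = g (xg (star x y) (conc a b))) : f = g := by
  apply DirectSum.linearMap_ext
  intro n
  apply Representation.Coinvariants.hom_ext
  apply TensorProduct.ext
  refine tensor_hom_ext fun p q hpq w x y => ?_
  refine PiTensorProduct.ext (MultilinearMap.ext fun t => ?_)
  subst hpq
  obtain ⟨a, b, hab⟩ := conc_surj (wact w⁻¹ t)
  obtain rfl : t = wact w (conc a b) := by rw [← hab, wact_wact_inv]
  have h₂ := h p q x y a b
  rw [← xg_rho w (star x y) (conc a b)] at h₂
  exact h₂

lemma xi_tmul_ext {E F : WreathRep G} {V : FDRep ℂ G} {T : Type*} [AddCommGroup T] [Module ℂ T]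
    {f g : XiSp E V ⊗[ℂ] XiSp F V →ₗ[ℂ] T}
    (h : ∀ (p q : ℕ) (x : E.deg p) (y : F.deg q) (a : Fin p → V) (b : Fin q → V),
      f (xg x a ⊗ₜ xg y b) = g (xg x a ⊗ₜ xg y b)) : f = g :=
  TensorProduct.ext (xi_hom_ext fun p x a => xi_hom_ext fun q y b => h p q x y a b)

/-- The tensorator as a linear equivalence. -/
def muEquiv (E F : WreathRep G) (V : FDRep ℂ G) :
    (XiSp E V ⊗[ℂ] XiSp F V) ≃ₗ[ℂ] XiSp (E ⊗ F) V := by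
  refine LinearEquiv.ofLinearMap (muLin E F V) (nuLin E F V) ?_ ?_
  · refine xi_tensor_ext fun p q x y a b => ?_
    rw [LinearMap.comp_apply, nuLin_xg, muLin_xg]
    rfl
  · refine xi_tmul_ext fun p q x y a b => ?_
    rw [LinearMap.comp_apply, muLin_xg, nuLin_xg]
    rfl

/-- The counit `Ξ(𝟙)(V) → ℂ` in degree `n`. -/
def unitPre (V : FDRep ℂ G) : ∀ n : ℕ, (𝟙_ (WreathRep G)).deg n →ₗ[ℂ] TPow n V →ₗ[ℂ] ℂ
  | 0 => (LinearMap.mul ℂ ℂ).compl₁₂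
      (LinearMap.proj (PLift.up rfl) : (PLift (0 = 0) → ℂ) →ₗ[ℂ] ℂ)
      (PiTensorProduct.isEmptyEquiv (Fin 0)).toLinearMap
  | _ + 1 => 0

/-- The inverse of the unit map. -/
def unitInv (V : FDRep ℂ G) : XiSp (𝟙_ (WreathRep G)) V →ₗ[ℂ] ℂ :=
  DirectSum.toModule ℂ ℕ _ fun n => Representation.Coinvariants.lift
    (xiRep (𝟙_ (WreathRep G)) V n) (TensorProduct.lift (unitPre V n)) (by
      intro w
      refine xi_pre_ext fun x v => ?_
      rw [LinearMap.comp_apply, xiRep_tprod, TensorProduct.lift.tmul, TensorProduct.lift.tmul]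
      cases n with
      | zero =>
        have h : wact w v = v := funext fun i => i.elim0
        rw [h]
        rfl
      | succ n => rfl)

/-- The unit isomorphism `ℂ ≃ Ξ(𝟙)(V)`. -/
def unitEquiv (V : FDRep ℂ G) : ℂ ≃ₗ[ℂ] XiSp (𝟙_ (WreathRep G)) V := by
  have key : ∀ c : ℂ,
      unitInv V (xg (E := 𝟙_ (WreathRep G)) (n := 0) (unitCan c) Fin.elim0) = c := by
    intro c
    refine (DirectSum.toModule_lof ℂ 0 _).trans ?_
    change c * PiTensorProduct.isEmptyEquiv (Fin 0) (PiTensorProduct.tprod ℂ _) = c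
    rw [PiTensorProduct.isEmptyEquiv_apply_tprod, mul_one]
  refine LinearEquiv.ofLinearMap ((xiBil (𝟙_ (WreathRep G)) V 0).flip
    (PiTensorProduct.tprod ℂ Fin.elim0) ∘ₗ unitCan) (unitInv V) ?_ (LinearMap.ext key)
  refine xi_hom_ext fun n x v => ?_
  by_cases hn : n = 0
  · subst hn
    obtain rfl : v = Fin.elim0 := funext fun i => i.elim0
    obtain ⟨c, rfl⟩ : ∃ c : ℂ, x = unitCan (G := G) c :=
      ⟨(x : PLift (0 = 0) → ℂ) ⟨rfl⟩, funext fun _ => rfl⟩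
    exact congrArg (fun c => xg (E := 𝟙_ (WreathRep G)) (n := 0) (unitCan c) Fin.elim0) (key _)
  · obtain rfl : x = 0 := funext (f := (x : PLift (n = 0) → ℂ)) fun h => absurd h.down hn
    have : xg (E := 𝟙_ (WreathRep G)) (0 : (𝟙_ (WreathRep G)).deg n) v = 0 := by
      simp [xg]
    rw [this, map_zero, map_zero]

end

/-! ### The monoidal structure on `Ξ` -/

section

variable {G : Type} [Group G] [Finite G]

/-- The tensorator as a natural isomorphism. -/
def muIso (E F : WreathRep G) : (Xi G).obj E ⊗ (Xi G).obj F ≅ (Xi G).obj (E ⊗ F) :=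
  (IsPolynomial G).isoMk (NatIso.ofComponents (fun V => (muEquiv E F V).toFGModuleCatIso) (by
    intro V W f
    apply FGModuleCat.hom_ext
    refine xi_tmul_ext fun p q x y a b => ?_
    change muLin E F W (xiHom (𝟙 E) f (xg x a) ⊗ₜ xiHom (𝟙 F) f (xg y b)) =
      xiHom (𝟙 (E ⊗ F)) f (muLin E F V (xg x a ⊗ₜ xg y b))
    rw [xiHom_xg, xiHom_xg, muLin_xg, muLin_xg, xiHom_xg]
    refine congrArg (xg (star x y)) (funext fun i => ?_)
    obtain ⟨j, rfl⟩ := finSumFinEquiv.surjective i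
    cases j <;> simp))

/-- The unit map as a natural isomorphism. -/
def epsIso : 𝟙_ (PolyFun G) ≅ (Xi G).obj (𝟙_ (WreathRep G)) :=
  (IsPolynomial G).isoMk (NatIso.ofComponents (fun V => (unitEquiv V).toFGModuleCatIso) (by
    intro V W f
    apply FGModuleCat.hom_ext
    refine LinearMap.ext fun c => ?_
    change xg (E := 𝟙_ (WreathRep G)) (V := W) (unitCan c) Fin.elim0 =
      xiHom (𝟙 (𝟙_ (WreathRep G))) f
        (xg (E := 𝟙_ (WreathRep G)) (V := V) (unitCan c) Fin.elim0)
    refine Eq.trans ?_ (xiHom_xg _ f _ _).symm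
    exact congrArg (xg _) (funext fun i => i.elim0)))

lemma xiHom_id_xg {E E' : WreathRep G} (φ : E ⟶ E') {V : FDRep ℂ G} {n : ℕ} (x : E.deg n)
    (v : Fin n → V) : xiHom φ (𝟙 V) (xg x v) = xg (lin φ n x) v :=
  xiHom_xg φ (𝟙 V) x v

lemma xg_act_inv {E : WreathRep G} {V : FDRep ℂ G} {X Y : Blk G} (e : X ≅ Y)
    (x : E.deg Y.rank) (v : Fin X.rank → V) (v' : Fin Y.rank → V)
    (h : ∀ i, v' (Hom.perm e.hom i) = V.ρ (val e.hom i) (v i)) :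
    xg (act E e.inv x) v = xg x v' := by
  rw [← xg_act e.hom (act E e.inv x) v v' h, ← LinearMap.comp_apply, ← act_comp, e.inv_hom_id]
  exact congrArg (fun z => xg z v') (LinearMap.congr_fun (E.deg Y.rank).ρ.map_one x)

lemma conc_assoc {E : WreathRep G} {V : FDRep ℂ G} {p q r : ℕ} (x : E.deg (p + (q + r)))
    (a : Fin p → V) (b : Fin q → V) (c : Fin r → V) :
    xg (act E (assoc (⟨p⟩ : Blk G) ⟨q⟩ ⟨r⟩).inv x) (conc (conc a b) c) =
      xg x (conc a (conc b c)) := by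
  refine xg_act_inv (assoc (⟨p⟩ : Blk G) ⟨q⟩ ⟨r⟩) x _ _ fun i => ?_
  have h1 : V.ρ (val (assoc (⟨p⟩ : Blk G) ⟨q⟩ ⟨r⟩).hom i) = LinearMap.id := V.ρ.map_one
  rw [h1, LinearMap.id_apply]
  clear h1
  revert i
  refine add_cases (X := add (⟨p⟩ : Blk G) ⟨q⟩) (add_cases ?_ ?_) ?_
  · intro j
    refine (conc_inl a (conc b c) j).trans ?_
    exact ((conc_inl (conc a b) c (Fin.castAdd q j)).trans (conc_inl a b j)).symm
  · intro j
    refine ((conc_inr a (conc b c) (Fin.castAdd r j)).trans (conc_inl b c j)).trans ?_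
    exact ((conc_inl (conc a b) c (Fin.natAdd p j)).trans (conc_inr a b j)).symm
  · intro j
    rw [assoc_perm₃]
    refine ((conc_inr a (conc b c) (Fin.natAdd q j)).trans (conc_inr b c j)).trans ?_
    exact (conc_inr (conc a b) c j).symm

lemma conc_leftU {E : WreathRep G} {V : FDRep ℂ G} {n : ℕ} (x : E.deg n) (v : Fin n → V) :
    xg (act E (leftU (⟨n⟩ : Blk G)).inv x) (conc Fin.elim0 v) = xg x v := by
  refine xg_act_inv (leftU (⟨n⟩ : Blk G)) x _ _ fun i => ?_
  have h1 : V.ρ (val (leftU (⟨n⟩ : Blk G)).hom i) = LinearMap.id := V.ρ.map_one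
  rw [h1, LinearMap.id_apply]
  clear h1
  revert i
  refine add_cases (X := (⟨0⟩ : Blk G)) (fun i => i.elim0) (fun j => ?_)
  rw [leftU_perm]
  exact (conc_inr Fin.elim0 v j).symm

lemma conc_rightU {E : WreathRep G} {V : FDRep ℂ G} {n : ℕ} (x : E.deg n) (v : Fin n → V) :
    xg (act E (rightU (⟨n⟩ : Blk G)).inv x) (conc v Fin.elim0) = xg x v := by
  refine xg_act_inv (rightU (⟨n⟩ : Blk G)) x _ _ fun i => ?_
  have h1 : V.ρ (val (rightU (⟨n⟩ : Blk G)).hom i) = LinearMap.id := V.ρ.map_one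
  rw [h1, LinearMap.id_apply]
  clear h1
  revert i
  refine add_cases (X := (⟨n⟩ : Blk G)) (fun j => ?_) (fun i => i.elim0)
  rw [rightU_perm]
  exact (conc_inl v Fin.elim0 j).symm

/-- The tensorator is compatible with the associators; on generators both sides are products of
three elements and concatenations of three tuples. -/
lemma muLin_assoc (E F H : WreathRep G) (V : FDRep ℂ G) :
    xiHom (α_ E F H).hom (𝟙 V) ∘ₗ muLin (E ⊗ F) H V ∘ₗ
        LinearMap.rTensor (XiSp H V) (muLin E F V) =
      muLin E (F ⊗ H) V ∘ₗ LinearMap.lTensor (XiSp E V) (muLin F H V) ∘ₗ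
        (TensorProduct.assoc ℂ (XiSp E V) (XiSp F V) (XiSp H V)).toLinearMap := by
  refine TensorProduct.ext (xi_tmul_ext fun p q x y a b => xi_hom_ext fun r z c => ?_)
  change xiHom (α_ E F H).hom (𝟙 V) (muLin (E ⊗ F) H V
      (muLin E F V (xg x a ⊗ₜ xg y b) ⊗ₜ xg z c)) =
    muLin E (F ⊗ H) V (xg x a ⊗ₜ muLin F H V (xg y b ⊗ₜ xg z c))
  rw [muLin_xg, muLin_xg, muLin_xg, muLin_xg, xiHom_id_xg, lin_associator]
  exact conc_assoc _ a b c

lemma polyHom_ext {F H : PolyFun G} {f g : F ⟶ H} (h : ∀ V, plin f V = plin g V) : f = g := by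
  apply ObjectProperty.hom_ext
  apply NatTrans.ext
  funext V
  exact FGModuleCat.hom_ext (h V)

lemma plin_comp {F H K : PolyFun G} (f : F ⟶ H) (g : H ⟶ K) (V : FDRep ℂ G) :
    plin (f ≫ g) V = plin g V ∘ₗ plin f V := rfl

lemma plin_whiskerRight {F F' : PolyFun G} (f : F ⟶ F') (H : PolyFun G) (V : FDRep ℂ G) :
    plin (f ▷ H) V = LinearMap.rTensor (H.obj.obj V) (plin f V) := rfl

lemma plin_whiskerLeft {F F' : PolyFun G} (H : PolyFun G) (f : F ⟶ F') (V : FDRep ℂ G) :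
    plin (H ◁ f) V = LinearMap.lTensor (H.obj.obj V) (plin f V) := rfl

lemma plin_associator (F H K : PolyFun G) (V : FDRep ℂ G) :
    plin (α_ F H K).hom V =
      (TensorProduct.assoc ℂ (F.obj.obj V) (H.obj.obj V) (K.obj.obj V)).toLinearMap := rfl

lemma plin_leftUnitor (F : PolyFun G) (V : FDRep ℂ G) :
    plin (λ_ F).hom V = (TensorProduct.lid ℂ (F.obj.obj V)).toLinearMap := rfl

lemma plin_rightUnitor (F : PolyFun G) (V : FDRep ℂ G) :
    plin (ρ_ F).hom V = (TensorProduct.rid ℂ (F.obj.obj V)).toLinearMap := rfl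

lemma plin_xi {E F : WreathRep G} (φ : E ⟶ F) (V : FDRep ℂ G) :
    plin ((Xi G).map φ) V = xiHom φ (𝟙 V) := rfl

lemma plin_mu (E F : WreathRep G) (V : FDRep ℂ G) :
    plin (muIso E F).hom V = muLin E F V := rfl

lemma muLin_leftUnit (E : WreathRep G) (V : FDRep ℂ G) :
    (TensorProduct.lid ℂ (XiSp E V)).toLinearMap =
      xiHom (λ_ E).hom (𝟙 V) ∘ₗ muLin (𝟙_ (WreathRep G)) E V ∘ₗ
        LinearMap.rTensor (XiSp E V) (unitEquiv V).toLinearMap := by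
  refine TensorProduct.ext (LinearMap.ext fun (c : ℂ) => xi_hom_ext fun n x v => ?_)
  change c • xg x v = xiHom (λ_ E).hom (𝟙 V) (muLin (𝟙_ (WreathRep G)) E V
    (xg (E := 𝟙_ (WreathRep G)) (unitCan c) Fin.elim0 ⊗ₜ xg x v))
  rw [muLin_xg, xiHom_id_xg, lin_leftUnitor]
  refine Eq.trans ?_ (conc_leftU (c • x) v).symm
  simp [xg]

lemma muLin_rightUnit (E : WreathRep G) (V : FDRep ℂ G) :
    (TensorProduct.rid ℂ (XiSp E V)).toLinearMap =
      xiHom (ρ_ E).hom (𝟙 V) ∘ₗ muLin E (𝟙_ (WreathRep G)) V ∘ₗ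
        LinearMap.lTensor (XiSp E V) (unitEquiv V).toLinearMap := by
  refine TensorProduct.ext (xi_hom_ext fun n x v => LinearMap.ext fun (c : ℂ) => ?_)
  change c • xg x v = xiHom (ρ_ E).hom (𝟙 V) (muLin E (𝟙_ (WreathRep G)) V
    (xg x v ⊗ₜ xg (E := 𝟙_ (WreathRep G)) (unitCan c) Fin.elim0))
  rw [muLin_xg, xiHom_id_xg, lin_rightUnitor]
  refine Eq.trans ?_ (conc_rightU (c • x) v).symm
  simp [xg]

lemma muLin_natural_left {E E' : WreathRep G} (φ : E ⟶ E') (F : WreathRep G) (V : FDRep ℂ G) :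
    muLin E' F V ∘ₗ LinearMap.rTensor (XiSp F V) (xiHom φ (𝟙 V)) =
      xiHom (φ ▷ F) (𝟙 V) ∘ₗ muLin E F V := by
  refine xi_tmul_ext fun p q x y a b => ?_
  change muLin E' F V (xiHom φ (𝟙 V) (xg x a) ⊗ₜ xg y b) =
    xiHom (φ ▷ F) (𝟙 V) (muLin E F V (xg x a ⊗ₜ xg y b))
  rw [xiHom_id_xg, muLin_xg, muLin_xg, xiHom_id_xg, lin_whiskerRight]

lemma muLin_natural_right (E : WreathRep G) {F F' : WreathRep G} (φ : F ⟶ F') (V : FDRep ℂ G) :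
    muLin E F' V ∘ₗ LinearMap.lTensor (XiSp E V) (xiHom φ (𝟙 V)) =
      xiHom (E ◁ φ) (𝟙 V) ∘ₗ muLin E F V := by
  refine xi_tmul_ext fun p q x y a b => ?_
  change muLin E F' V (xg x a ⊗ₜ xiHom φ (𝟙 V) (xg y b)) =
    xiHom (E ◁ φ) (𝟙 V) (muLin E F V (xg x a ⊗ₜ xg y b))
  rw [xiHom_id_xg, muLin_xg, muLin_xg, xiHom_id_xg, lin_whiskerLeft]

set_option maxHeartbeats 2000000 in
/-- `Ξ` is a monoidal functor. -/
def xiCoreMonoidal : (Xi G).CoreMonoidal where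
  εIso := epsIso
  μIso := muIso
  μIso_hom_natural_left φ F := polyHom_ext fun V => by
    rw [plin_comp, plin_comp, plin_whiskerRight, plin_mu, plin_mu, plin_xi, plin_xi]
    exact muLin_natural_left φ F V
  μIso_hom_natural_right E φ := polyHom_ext fun V => by
    rw [plin_comp, plin_comp, plin_whiskerLeft, plin_mu, plin_mu, plin_xi, plin_xi]
    exact muLin_natural_right E φ V
  associativity E F H := polyHom_ext fun V => by
    simp only [plin_comp, plin_whiskerLeft, plin_whiskerRight, plin_mu, plin_xi, plin_associator]
    exact muLin_assoc E F H V
  left_unitality E := polyHom_ext fun V => by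
    simp only [plin_comp, plin_whiskerRight, plin_mu, plin_xi, plin_leftUnitor]
    exact muLin_leftUnit E V
  right_unitality E := polyHom_ext fun V => by
    simp only [plin_comp, plin_whiskerLeft, plin_mu, plin_xi, plin_rightUnitor]
    exact muLin_rightUnit E V

lemma xi_monoidal : Nonempty (Xi G).Monoidal := ⟨xiCoreMonoidal.toMonoidal⟩

end

/-! ### Polarization of polynomial functors -/

section

variable {G : Type} [Group G]

/-- A morphism of representations from an equivariant linear map. -/
def fmk {V W : FDRep ℂ G} (f : V →ₗ[ℂ] W) (h : ∀ g x, f (V.ρ g x) = W.ρ g (f x)) : V ⟶ W where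
  hom := ObjectProperty.homMk (ModuleCat.ofHom f)
  comm g := FGModuleCat.hom_ext (LinearMap.ext (h g))

lemma flin_ext {V W : FDRep ℂ G} {f g : V ⟶ W} (h : ∀ x, flin f x = flin g x) : f = g := by
  apply Action.hom_ext
  exact FGModuleCat.hom_ext (LinearMap.ext h)

@[simp] lemma flin_comp {V W U : FDRep ℂ G} (f : V ⟶ W) (g : W ⟶ U) :
    flin (f ≫ g) = flin g ∘ₗ flin f := rfl

/-- The map `F(f)` as a linear map. -/
def fm (F : FDRep ℂ G ⥤ FGModuleCat ℂ) {V W : FDRep ℂ G} (f : V ⟶ W) : F.obj V →ₗ[ℂ] F.obj W :=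
  (F.map f).hom.hom

lemma fm_comp (F : FDRep ℂ G ⥤ FGModuleCat ℂ) {V W U : FDRep ℂ G} (f : V ⟶ W) (g : W ⟶ U) :
    fm F (f ≫ g) = fm F g ∘ₗ fm F f := by
  rw [fm, F.map_comp]
  rfl

lemma fm_id (F : FDRep ℂ G ⥤ FGModuleCat ℂ) (V : FDRep ℂ G) : fm F (𝟙 V) = LinearMap.id := by
  rw [fm, F.map_id]
  rfl

lemma fm_comp_apply (F : FDRep ℂ G ⥤ FGModuleCat ℂ) {V W U : FDRep ℂ G} (f : V ⟶ W) (g : W ⟶ U)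
    (x : F.obj V) : fm F (f ≫ g) x = fm F g (fm F f x) := by
  rw [fm_comp]
  rfl

/-- For a polynomial functor the maps `f ↦ F(f)` are polynomial of uniformly bounded degree. -/
lemma IsPolynomial.exists_degree {F : FDRep ℂ G ⥤ FGModuleCat ℂ} (hF : IsPolynomial G F) :
    ∃ d : ℕ, ∀ V W : FDRep ℂ G, IsPolyLaw d (fun f : V ⟶ W => fm F f) := by
  obtain ⟨d, hd⟩ := hF
  refine ⟨d, fun V W => ?_⟩
  let b := Module.finBasis ℂ (V ⟶ W)
  let L : (F.obj V ⟶ F.obj W) →ₗ[ℂ] (F.obj V →ₗ[ℂ] F.obj W) :=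
    { toFun := fun t => t.hom.hom
      map_add' := fun _ _ => rfl
      map_smul' := fun _ _ => rfl }
  have := isPolyLaw_of_polyMaps b (polyMaps_comp L (hd V W _ b))
  simp only [b.sum_repr] at this
  exact this

/-- Polarization commutes with composition on both sides, because it is a linear expression in
values of `F`. -/
lemma comp_pol {F : FDRep ℂ G ⥤ FGModuleCat ℂ} (N n : ℕ) {V W V' W' : FDRep ℂ G} (g : V' ⟶ V)
    (h : W ⟶ W') (f : Fin n → (V ⟶ W)) :
    pol N n (fm F) (fun i => g ≫ f i ≫ h) = fm F h ∘ₗ pol N n (fm F) f ∘ₗ fm F g := by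
  let L : (F.obj V →ₗ[ℂ] F.obj W) →ₗ[ℂ] (F.obj V' →ₗ[ℂ] F.obj W') :=
    LinearMap.lcomp ℂ _ (fm F g) ∘ₗ LinearMap.llcomp ℂ _ _ _ (fm F h)
  refine Eq.trans ?_ (mlCoeff_map N n L fun c => fm F (∑ i, c i • f i))
  refine congrArg (mlCoeff N n) (funext fun c => ?_)
  have h1 : ∑ i, c i • (g ≫ f i ≫ h) = g ≫ (∑ i, c i • f i) ≫ h := by
    rw [Preadditive.sum_comp, Preadditive.comp_sum]
    simp
  rw [h1, fm_comp, fm_comp]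
  rfl

variable [Finite G]

/-- The vectors of the standard basis of `ℂ[G]^n`. -/
def stdv (G : Type) [Group G] [Finite G] (n : ℕ) (j : Fin n) : freeRep G n :=
  (Pi.single j 1 : Fin n → ℂ[G])

lemma freeRep_rho (n : ℕ) (g : G) (x : Fin n → ℂ[G]) (j : Fin n) :
    (((freeRep G n).ρ g x : Fin n → ℂ[G]) j) = MonoidAlgebra.single g 1 * x j := rfl

/-- The linear map underlying a morphism, as a linear function of the morphism. -/
def flinL (V W : FDRep ℂ G) : (V ⟶ W) →ₗ[ℂ] (V →ₗ[ℂ] W) where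
  toFun := flin
  map_add' _ _ := rfl
  map_smul' _ _ := rfl

/-- The action of the group algebra on a representation. -/
def modAct (V : FDRep ℂ G) : ℂ[G] →ₗ[ℂ] V →ₗ[ℂ] V :=
  (Representation.asAlgebraHom (V.ρ : Representation ℂ G V)).toLinearMap

lemma modAct_single (V : FDRep ℂ G) (g : G) (c : ℂ) (v : V) :
    modAct V (MonoidAlgebra.single g c) v = c • V.ρ g v := by
  rw [modAct, AlgHom.toLinearMap_apply, Representation.asAlgebraHom_single]
  rfl

lemma modAct_one (V : FDRep ℂ G) (v : V) : modAct V 1 v = v := by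
  rw [modAct, AlgHom.toLinearMap_apply, map_one]
  rfl

lemma modAct_mul (V : FDRep ℂ G) (a b : ℂ[G]) (v : V) :
    modAct V (a * b) v = modAct V a (modAct V b v) := by
  rw [modAct, AlgHom.toLinearMap_apply, map_mul]
  rfl

/-- The linear map underlying `rowMap`. -/
def rowLin {V : FDRep ℂ G} {n : ℕ} (v : Fin n → V) : (Fin n → ℂ[G]) →ₗ[ℂ] V :=
  ∑ j, ((modAct V).flip (v j)) ∘ₗ (LinearMap.proj j : (Fin n → ℂ[G]) →ₗ[ℂ] ℂ[G])

lemma rowLin_apply {V : FDRep ℂ G} {n : ℕ} (v : Fin n → V) (x : Fin n → ℂ[G]) :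
    rowLin v x = ∑ j, modAct V (x j) (v j) := by
  rw [rowLin, LinearMap.sum_apply]
  rfl

/-- The `G`-map `ℂ[G]^n → V` that sends the standard basis to `v_1, …, v_n`. -/
def rowMap {V : FDRep ℂ G} {n : ℕ} (v : Fin n → V) : freeRep G n ⟶ V :=
  fmk (V := freeRep G n) (rowLin v) (fun g (x : Fin n → ℂ[G]) => by
    refine (rowLin_apply v _).trans (Eq.trans ?_ (congrArg (V.ρ g) (rowLin_apply v x).symm))
    rw [map_sum]
    refine Finset.sum_congr rfl fun j _ => ?_
    rw [freeRep_rho, modAct_mul, modAct_single, one_smul])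

lemma rowMap_apply {V : FDRep ℂ G} {n : ℕ} (v : Fin n → V) (x : Fin n → ℂ[G]) :
    flin (rowMap v) x = ∑ j, modAct V (x j) (v j) := rowLin_apply v x

lemma rowLin_single {V : FDRep ℂ G} {n : ℕ} (v : Fin n → V) (j : Fin n) (a : ℂ[G]) :
    rowLin v (Pi.single j a) = modAct V a (v j) := by
  rw [rowLin_apply, Finset.sum_eq_single j]
  · rw [Pi.single_eq_same]
  · intro i _ hi
    rw [Pi.single_eq_of_ne hi, map_zero, LinearMap.zero_apply]
  · intro h
    exact absurd (Finset.mem_univ j) h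

lemma rowMap_stdv {V : FDRep ℂ G} {n : ℕ} (v : Fin n → V) (j : Fin n) :
    flin (rowMap v) (stdv G n j) = v j :=
  (rowLin_single v j 1).trans (modAct_one V _)

lemma single_eq_rho_smul {n : ℕ} (j : Fin n) (g : G) (c : ℂ) :
    (Pi.single j (MonoidAlgebra.single g c) : Fin n → ℂ[G]) =
      c • (freeRep G n).ρ g (stdv G n j) := by
  funext i
  change _ = c • (MonoidAlgebra.single g 1 * (Pi.single j 1 : Fin n → ℂ[G]) i)
  by_cases hi : i = j
  · subst hi
    simp
  · simp [hi]

lemma freeRep_lin_ext {W : Type*} [AddCommGroup W] [Module ℂ W] {n : ℕ}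
    {f g : freeRep G n →ₗ[ℂ] W}
    (h : ∀ j a, f ((freeRep G n).ρ a (stdv G n j)) = g ((freeRep G n).ρ a (stdv G n j))) :
    f = g := by
  refine LinearMap.pi_ext' (R := ℂ) (φ := fun _ : Fin n => ℂ[G]) (f := f) (g := g) fun j => ?_
  refine LinearMap.ext fun b => ?_
  change f (Pi.single j b : Fin n → ℂ[G]) = g (Pi.single j b : Fin n → ℂ[G])
  induction b using MonoidAlgebra.induction_linear with
  | zero =>
    rw [Pi.single_zero]
    exact (map_zero f).trans (map_zero g).symm
  | add a b ha hb =>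
    rw [Pi.single_add]
    exact (map_add f _ _).trans ((congrArg₂ (· + ·) ha hb).trans (map_add g _ _).symm)
  | single a c =>
    rw [single_eq_rho_smul]
    exact (map_smul f _ _).trans ((congrArg (c • ·) (h j a)).trans (map_smul g _ _).symm)

/-- `ℂ[G]^n` is free on its standard basis. -/
lemma freeRep_hom_ext {V : FDRep ℂ G} {n : ℕ} {f g : freeRep G n ⟶ V}
    (h : ∀ j, flin f (stdv G n j) = flin g (stdv G n j)) : f = g :=
  flin_ext fun x => LinearMap.congr_fun (freeRep_lin_ext (f := flin f) (g := flin g)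
    fun j a => by rw [flin_rho, flin_rho, h]) x

lemma freeRep_span {V : FDRep ℂ G} {n : ℕ} (f : freeRep G n ⟶ V) :
    f = rowMap fun j => flin f (stdv G n j) :=
  freeRep_hom_ext fun j => (rowMap_stdv (fun j => flin f (stdv G n j)) j).symm

lemma rowMap_comp {V W : FDRep ℂ G} {n : ℕ} (v : Fin n → V) (f : V ⟶ W) :
    rowMap v ≫ f = rowMap fun j => flin f (v j) := by
  rw [freeRep_span (rowMap v ≫ f)]
  refine congrArg rowMap (funext fun j => ?_)
  rw [flin_comp, LinearMap.comp_apply, rowMap_stdv]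

lemma rowMap_stdv_eq_id (n : ℕ) : rowMap (stdv G n) = 𝟙 (freeRep G n) := by
  rw [freeRep_span (𝟙 (freeRep G n))]
  rfl

/-- The diagonal endomorphism of `ℂ[G]^n` with scalar entries `t_1, …, t_n`. -/
def tdiag (G : Type) [Group G] [Finite G] {n : ℕ} (t : Fin n → ℂ) : freeRep G n ⟶ freeRep G n :=
  rowMap fun j => t j • stdv G n j

/-- The projection of `ℂ[G]^n` to its `j`-th coordinate. -/
def cproj (G : Type) [Group G] [Finite G] {n : ℕ} (j : Fin n) : freeRep G n ⟶ freeRep G n :=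
  tdiag G (Pi.single j 1)

/-- The map `ℂ[G]^n → V` through the `j`-th coordinate, linear in the image of `1`. -/
def rowAt {V : FDRep ℂ G} {n : ℕ} (j : Fin n) : V →ₗ[ℂ] (freeRep G n ⟶ V) where
  toFun v := rowMap (Pi.single j v)
  map_add' v w := freeRep_hom_ext fun i => by
    refine (rowMap_stdv _ i).trans ?_
    rw [Pi.single_add]
    exact (congrArg₂ (· + ·) (rowMap_stdv (Pi.single j v) i) (rowMap_stdv (Pi.single j w) i)).symm
  map_smul' c v := freeRep_hom_ext fun i => by
    refine (rowMap_stdv _ i).trans ?_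
    rw [Pi.single_smul]
    exact (congrArg (c • ·) (rowMap_stdv (Pi.single j v) i)).symm

lemma rowMap_eq_sum {V : FDRep ℂ G} {n : ℕ} (v : Fin n → V) :
    rowMap v = ∑ j, rowAt j (v j) := by
  refine freeRep_hom_ext fun i => ?_
  have h : flin (∑ j, rowAt j (v j)) = ∑ j, flin (rowAt j (v j)) := map_sum (flinL _ _) _ _
  rw [rowMap_stdv, h, LinearMap.sum_apply, Finset.sum_eq_single i]
  · refine ((rowMap_stdv (Pi.single i (v i)) i).trans ?_).symm
    simp
  · intro j _ hj
    refine (rowMap_stdv (Pi.single j (v j)) i).trans ?_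
    simp [hj.symm]
  · intro h
    exact absurd (Finset.mem_univ i) h

lemma tdiag_comp_rowMap {V : FDRep ℂ G} {n : ℕ} (t : Fin n → ℂ) (v : Fin n → V) :
    tdiag G t ≫ rowMap v = rowMap fun j => t j • v j := by
  rw [tdiag, rowMap_comp]
  refine congrArg rowMap (funext fun j => ?_)
  rw [map_smul, rowMap_stdv]

lemma cproj_comp_rowMap {V : FDRep ℂ G} {n : ℕ} (j : Fin n) (v : Fin n → V) :
    cproj G j ≫ rowMap v = rowAt j (v j) := by
  rw [cproj, tdiag_comp_rowMap]
  refine freeRep_hom_ext fun i => (rowMap_stdv _ i).trans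
    (Eq.trans ?_ (rowMap_stdv (Pi.single j (v j)) i).symm)
  by_cases hi : i = j
  · subst hi
    simp
  · simp [hi]

lemma sum_smul_rowAt {V : FDRep ℂ G} {n : ℕ} (t : Fin n → ℂ) (v : Fin n → V) :
    ∑ j, t j • rowAt j (v j) = tdiag G t ≫ rowMap v := by
  rw [tdiag_comp_rowMap, rowMap_eq_sum]
  simp

/-- The multilinear part of `F(ℂ[G]^n)`: the vectors on which `diag(t_1, …, t_n)` acts by
`t_1 ⋯ t_n`. -/
def wt (F : FDRep ℂ G ⥤ FGModuleCat ℂ) (n : ℕ) : Submodule ℂ (F.obj (freeRep G n)) where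
  carrier := {x | ∀ t : Fin n → ℂ, fm F (tdiag G t) x = (∏ j, t j) • x}
  add_mem' hx hy t := by rw [map_add, hx t, hy t, smul_add]
  zero_mem' t := by rw [map_zero, smul_zero]
  smul_mem' c x hx t := by rw [map_smul, hx t, smul_comm]

lemma mlCoeff_prod {N : ℕ} (hN : 2 ≤ N) (n : ℕ) :
    mlCoeff N n (fun c : Fin n → ℂ => ∏ j, c j) = 1 := by
  have := mlCoeff_prod_pow hN n (fun _ => 1) (fun _ => by omega)
  simpa using this

/-- On the multilinear part, `F([v_1, …, v_n])` is the polarization of `F` at the maps through the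
single coordinates. -/
lemma wt_rowMap {F : FDRep ℂ G ⥤ FGModuleCat ℂ} {N n : ℕ} (hN : 2 ≤ N) {V : FDRep ℂ G}
    {x : F.obj (freeRep G n)} (hx : x ∈ wt F n) (v : Fin n → V) :
    pol N n (fm F) (fun j => rowAt j (v j)) x = fm F (rowMap v) x := by
  rw [pol]
  let L : (F.obj (freeRep G n) →ₗ[ℂ] F.obj V) →ₗ[ℂ] F.obj V := LinearMap.applyₗ x
  refine (mlCoeff_map N n L fun c => fm F (∑ j, c j • rowAt j (v j))).symm.trans ?_
  have h : ∀ c : Fin n → ℂ, L (fm F (∑ j, c j • rowAt j (v j))) =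
      (∏ j, c j) • fm F (rowMap v) x := by
    intro c
    change fm F (∑ j, c j • rowAt j (v j)) x = _
    rw [sum_smul_rowAt, fm_comp_apply, hx c, map_smul]
  simp only [h]
  rw [mlCoeff_smul_right, mlCoeff_prod hN, one_smul]

/-- The projection of `F(ℂ[G]^n)` to its multilinear part. -/
def wtProj (F : FDRep ℂ G ⥤ FGModuleCat ℂ) (N n : ℕ) :
    F.obj (freeRep G n) →ₗ[ℂ] F.obj (freeRep G n) :=
  pol N n (fm F) fun j => cproj G j

lemma cproj_eq {n : ℕ} (j : Fin n) : cproj G j = rowAt j (stdv G n j) := by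
  rw [← cproj_comp_rowMap, rowMap_stdv_eq_id, Category.comp_id]

lemma wtProj_of_mem {F : FDRep ℂ G ⥤ FGModuleCat ℂ} {N n : ℕ} (hN : 2 ≤ N)
    {x : F.obj (freeRep G n)} (hx : x ∈ wt F n) : wtProj F N n x = x := by
  have := wt_rowMap hN hx (stdv G n)
  rw [rowMap_stdv_eq_id, fm_id] at this
  simp only [wtProj, cproj_eq]
  exact this

/-- The `n`-th polarization of `F` at the coordinate projections is multilinear, hence takes values
in the multilinear part. -/
lemma wtProj_mem {F : FDRep ℂ G ⥤ FGModuleCat ℂ} {d N n : ℕ} (hN : d + 2 ≤ N)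
    (hF : ∀ V W : FDRep ℂ G, IsPolyLaw d (fun f : V ⟶ W => fm F f)) (x : F.obj (freeRep G n)) :
    wtProj F N n x ∈ wt F n := by
  intro t
  obtain ⟨S, hS⟩ := exists_pol_multilinear (hF (freeRep G n) (freeRep G n)) n
  have h₁ := comp_pol (F := F) N n (𝟙 (freeRep G n)) (tdiag G t) fun j => cproj G j
  have h₂ : ∀ j : Fin n, 𝟙 (freeRep G n) ≫ cproj G j ≫ tdiag G t = t j • cproj G j := by
    intro j
    rw [Category.id_comp, tdiag, cproj_comp_rowMap, map_smul, ← cproj_eq]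
  simp only [h₂] at h₁
  rw [hS N hN, MultilinearMap.map_smul_univ, ← hS N hN, fm_id] at h₁
  exact (LinearMap.congr_fun h₁ x).symm

/-- `F([v_1, …, v_n])(x)` is multilinear in `v_1, …, v_n ∈ V` for `x` in the multilinear part. -/
lemma exists_multilinear {F : FDRep ℂ G ⥤ FGModuleCat ℂ} (hF : IsPolynomial G F) {n : ℕ}
    (V : FDRep ℂ G) (x : wt F n) : ∃ S : MultilinearMap ℂ (fun _ : Fin n => V) (F.obj V),
      ∀ v, S v = fm F (rowMap v) x := by
  obtain ⟨d, hd⟩ := hF.exists_degree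
  obtain ⟨S, hS⟩ := exists_pol_multilinear (hd (freeRep G n) V) n
  refine ⟨(LinearMap.applyₗ (x : F.obj (freeRep G n))).compMultilinearMap
    (S.compLinearMap fun j => rowAt j), fun v => ?_⟩
  rw [← wt_rowMap (N := d + 2) (by omega) x.2 v, hS (d + 2) le_rfl]
  rfl

end

/-! ### Polynomial functors are determined by their multilinear parts -/

section

variable {G : Type} [Group G] [Finite G]

/-- The equivariant map `V → ℂ[G]` attached to the `i`-th coordinate of a basis, by averaging. -/
def colLin (V : FDRep ℂ G) (i : Fin (Module.finrank ℂ V)) : V →ₗ[ℂ] ℂ[G] :=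
  letI := Fintype.ofFinite G
  (Nat.card G : ℂ)⁻¹ • ∑ g : G, (MonoidAlgebra.lsingle g) ∘ₗ
    (Module.finBasis ℂ V).coord i ∘ₗ V.ρ g⁻¹

lemma colLin_rho (V : FDRep ℂ G) (i : Fin (Module.finrank ℂ V)) (h : G) (x : V) :
    colLin V i (V.ρ h x) = MonoidAlgebra.single h 1 * colLin V i x := by
  let := Fintype.ofFinite G
  simp only [colLin, LinearMap.smul_apply, LinearMap.sum_apply, LinearMap.comp_apply]
  rw [mul_smul_comm, Finset.mul_sum]
  refine congrArg _ (Fintype.sum_equiv (Equiv.mulLeft h⁻¹) _ _ fun g => ?_)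
  rw [MonoidAlgebra.lsingle_apply, MonoidAlgebra.lsingle_apply, MonoidAlgebra.single_mul_single,
    Equiv.coe_mulLeft, mul_inv_cancel_left, one_mul]
  have : V.ρ (h⁻¹ * g)⁻¹ x = V.ρ g⁻¹ (V.ρ h x) := by
    rw [mul_inv_rev, inv_inv, map_mul]
    rfl
  exact congrArg (fun z => MonoidAlgebra.single g ((Module.finBasis ℂ V).coord i z)) this.symm

/-- Averaging the resolution of the identity of `V` by a basis resolves it through `ℂ[G]`. -/
lemma sum_colLin (V : FDRep ℂ G) (x : V) :
    ∑ i, modAct V (colLin V i x) (Module.finBasis ℂ V i) = x := by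
  let := Fintype.ofFinite G
  have h : ∀ i, modAct V (colLin V i x) (Module.finBasis ℂ V i) = (Nat.card G : ℂ)⁻¹ •
      ∑ g : G, V.ρ g ((Module.finBasis ℂ V).coord i (V.ρ g⁻¹ x) • Module.finBasis ℂ V i) := by
    intro i
    simp only [colLin, LinearMap.smul_apply, LinearMap.sum_apply, LinearMap.comp_apply,
      MonoidAlgebra.lsingle_apply, map_smul, map_sum, modAct_single]
  simp only [h]
  rw [← Finset.smul_sum, Finset.sum_comm]
  have h2 : ∀ g : G, ∑ i, V.ρ g ((Module.finBasis ℂ V).coord i (V.ρ g⁻¹ x) •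
      Module.finBasis ℂ V i) = x := by
    intro g
    rw [← map_sum]
    simp only [Module.Basis.coord_apply]
    rw [(Module.finBasis ℂ V).sum_repr]
    have := V.ρ.map_mul g g⁻¹
    rw [mul_inv_cancel, map_one] at this
    exact (LinearMap.congr_fun this x).symm
  simp only [h2]
  rw [Finset.sum_const, Finset.card_univ, ← Nat.card_eq_fintype_card,
    ← Nat.cast_smul_eq_nsmul ℂ, smul_smul, inv_mul_cancel₀
      (by exact_mod_cast Nat.card_pos.ne'), one_smul]

/-- The map `V → ℂ[G]^n` whose coordinates are the `u_j`-th equivariant coordinates. -/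
def colMap (V : FDRep ℂ G) {n : ℕ} (u : Fin n → Fin (Module.finrank ℂ V)) : V ⟶ freeRep G n :=
  fmk (W := freeRep G n) (LinearMap.pi fun j => colLin V (u j)) fun g x =>
    funext fun j => colLin_rho V (u j) g x

/-- The summand of the identity of `V` through `ℂ[G]` given by the `i`-th basis vector. -/
def rankOne (V : FDRep ℂ G) (i : Fin (Module.finrank ℂ V)) : V ⟶ V :=
  fmk ((modAct V).flip (Module.finBasis ℂ V i) ∘ₗ colLin V i) fun g x => by
    change modAct V (colLin V i (V.ρ g x)) _ = V.ρ g (modAct V (colLin V i x) _)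
    rw [colLin_rho, modAct_mul, modAct_single, one_smul]

lemma rankOne_eq (V : FDRep ℂ G) {n : ℕ} (u : Fin n → Fin (Module.finrank ℂ V)) (j : Fin n) :
    rankOne V (u j) =
      colMap V u ≫ cproj G j ≫ rowMap fun j => Module.finBasis ℂ V (u j) := by
  rw [cproj_comp_rowMap]
  refine flin_ext fun x => ?_
  refine Eq.trans ?_ (rowMap_apply (Pi.single j (Module.finBasis ℂ V (u j)))
    (fun j => colLin V (u j) x)).symm
  rw [Finset.sum_eq_single j]
  · rw [Pi.single_eq_same]
    rfl
  · intro i _ hi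
    rw [Pi.single_eq_of_ne hi, map_zero]
  · intro h
    exact absurd (Finset.mem_univ j) h

lemma sum_rankOne (V : FDRep ℂ G) : ∑ i, rankOne V i = 𝟙 V := by
  refine flin_ext fun x => ?_
  have h : flin (∑ i, rankOne V i) = ∑ i, flin (rankOne V i) := map_sum (flinL _ _) _ _
  rw [h, LinearMap.sum_apply]
  exact sum_colLin V x

/-- Every vector of `F(V)` is a combination of images of multilinear parts. -/
lemma sum_wtProj {F : FDRep ℂ G ⥤ FGModuleCat ℂ} {d N : ℕ} (hN : d + 2 ≤ N)
    (hF : ∀ V W : FDRep ℂ G, IsPolyLaw d (fun f : V ⟶ W => fm F f)) (V : FDRep ℂ G)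
    (y : F.obj V) :
    y = ∑ n ∈ Finset.range (d + 1), ((n.factorial : ℂ)⁻¹) •
      ∑ u : Fin n → Fin (Module.finrank ℂ V),
        fm F (rowMap fun j => Module.finBasis ℂ V (u j))
          (wtProj F N n (fm F (colMap V u) y)) := by
  have h₁ := eq_sum_pol hN (hF V V) (𝟙 V)
  have h₂ : ∀ n, pol N n (fun f : V ⟶ V => fm F f) (fun _ => 𝟙 V) =
      ∑ u : Fin n → Fin (Module.finrank ℂ V), fm F (rowMap fun j => Module.finBasis ℂ V (u j)) ∘ₗ
          wtProj F N n ∘ₗ fm F (colMap V u) := by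
    intro n
    obtain ⟨S, hS⟩ := exists_pol_multilinear (hF V V) n
    rw [hS N hN, ← sum_rankOne, MultilinearMap.map_sum S fun _ i => rankOne V i]
    refine Finset.sum_congr rfl fun u _ => ?_
    rw [← hS N hN]
    simp only [rankOne_eq V u]
    exact comp_pol N n _ _ _
  simp only [h₂, fm_id] at h₁
  refine (LinearMap.congr_fun h₁ y).trans ?_
  simp only [LinearMap.sum_apply, LinearMap.smul_apply]
  rfl

/-- `F(V)` is spanned by the images of the multilinear parts. -/
lemma wt_span {F : FDRep ℂ G ⥤ FGModuleCat ℂ} (hF : IsPolynomial G F) {V : FDRep ℂ G}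
    (P : Submodule ℂ (F.obj V))
    (hP : ∀ n, ∀ x ∈ wt F n, ∀ v : Fin n → V, fm F (rowMap v) x ∈ P) (y : F.obj V) : y ∈ P := by
  obtain ⟨d, hd⟩ := hF.exists_degree
  rw [sum_wtProj (le_refl (d + 2)) hd V y]
  refine Submodule.sum_mem _ fun n _ => Submodule.smul_mem _ _ (Submodule.sum_mem _ fun u _ => ?_)
  exact hP n _ (wtProj_mem le_rfl hd _) _

/-- A natural transformation that is injective on multilinear parts is injective. -/
lemma injective_of_wt {F H : FDRep ℂ G ⥤ FGModuleCat ℂ} (hF : IsPolynomial G F)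
    (α : ∀ V : FDRep ℂ G, F.obj V →ₗ[ℂ] H.obj V)
    (hα : ∀ {V W : FDRep ℂ G} (f : V ⟶ W), α W ∘ₗ fm F f = fm H f ∘ₗ α V)
    (h : ∀ n, ∀ x ∈ wt F n, α _ x = 0 → x = 0) (V : FDRep ℂ G) : Function.Injective (α V) := by
  rw [← LinearMap.ker_eq_bot, LinearMap.ker_eq_bot']
  intro y hy
  obtain ⟨d, hd⟩ := hF.exists_degree
  rw [sum_wtProj (le_refl (d + 2)) hd V y]
  refine Finset.sum_eq_zero fun n _ => ?_
  rw [Finset.sum_eq_zero, smul_zero]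
  intro u _
  rw [h n _ (wtProj_mem le_rfl hd _), map_zero]
  -- the projection to the multilinear part commutes with natural transformations
  have h₁ : α _ ∘ₗ wtProj F (d + 2) n = wtProj H (d + 2) n ∘ₗ α _ := by
    let L : (F.obj (freeRep G n) →ₗ[ℂ] F.obj (freeRep G n)) →ₗ[ℂ]
      (F.obj (freeRep G n) →ₗ[ℂ] H.obj (freeRep G n)) := LinearMap.llcomp ℂ _ _ _ (α _)
    let M : (H.obj (freeRep G n) →ₗ[ℂ] H.obj (freeRep G n)) →ₗ[ℂ]
      (F.obj (freeRep G n) →ₗ[ℂ] H.obj (freeRep G n)) := LinearMap.lcomp ℂ _ (α _)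
    refine (mlCoeff_map (d + 2) n L fun c => fm F (∑ j, c j • cproj G j)).symm.trans
      (Eq.trans ?_ (mlCoeff_map (d + 2) n M fun c => fm H (∑ j, c j • cproj G j)))
    exact congrArg (mlCoeff (d + 2) n) (funext fun c => hα (∑ j, c j • cproj G j))
  have h₂ := LinearMap.congr_fun h₁ (fm F (colMap V u) y)
  have h₃ := LinearMap.congr_fun (hα (colMap V u)) y
  simp only [LinearMap.comp_apply] at h₂ h₃
  rw [h₂, h₃, hy, map_zero, map_zero]

/-- A polynomial functor of degree at most `d` has no multilinear part in degrees above `d`. -/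
lemma wt_eq_zero {F : FDRep ℂ G ⥤ FGModuleCat ℂ} {d n : ℕ}
    (hF : ∀ V W : FDRep ℂ G, IsPolyLaw d (fun f : V ⟶ W => fm F f)) (hn : d < n)
    {x : F.obj (freeRep G n)} (hx : x ∈ wt F n) : x = 0 := by
  rw [← wtProj_of_mem (N := d + 2) (by omega) hx, wtProj, pol_eq_zero le_rfl (hF _ _) hn]
  rfl

end

/-! ### The multilinear part of `Ξ(E)` -/

section

variable {G : Type} [Group G] [Finite G]

lemma fm_xi (E : WreathRep G) {V W : FDRep ℂ G} (f : V ⟶ W) : fm (xiObj E) f = xiHom (𝟙 E) f := rfl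

lemma fm_xi_xg {E : WreathRep G} {V W : FDRep ℂ G} (f : V ⟶ W) {n : ℕ} (x : E.deg n)
    (v : Fin n → V) : fm (xiObj E) f (xg x v) = xg x fun i => flin f (v i) := by
  rw [fm_xi]
  exact xiHom_xg (𝟙 E) f x v

/-- The generators `x ⊗ v_1 ⊗ ⋯ ⊗ v_n`, as a multilinear map in `v_1, …, v_n`. -/
def xgMulti {E : WreathRep G} (V : FDRep ℂ G) {n : ℕ} (x : E.deg n) :
    MultilinearMap ℂ (fun _ : Fin n => V) (XiSp E V) :=
  (xiBil E V n x).compMultilinearMap (PiTensorProduct.tprod ℂ)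

lemma xgMulti_apply {E : WreathRep G} {V : FDRep ℂ G} {n : ℕ} (x : E.deg n) (v : Fin n → V) :
    xgMulti V x v = xg x v := rfl

/-- The embedding `x ↦ x ⊗ e_1 ⊗ ⋯ ⊗ e_n` of `E_n` into `Ξ(E)(ℂ[G]^n)`. -/
def iota (E : WreathRep G) (n : ℕ) : E.deg n →ₗ[ℂ] (xiObj E).obj (freeRep G n) :=
  (xiBil E (freeRep G n) n).flip (PiTensorProduct.tprod ℂ (stdv G n))

lemma iota_apply (E : WreathRep G) {n : ℕ} (x : E.deg n) : iota E n x = xg x (stdv G n) := rfl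

lemma fm_rowMap_iota {E : WreathRep G} {V : FDRep ℂ G} {n : ℕ} (x : E.deg n) (v : Fin n → V) :
    fm (xiObj E) (rowMap v) (iota E n x) = xg x v := by
  rw [iota_apply]
  refine (fm_xi_xg _ x _).trans ?_
  exact congrArg (xg x) (funext fun i => rowMap_stdv v i)

lemma iota_mem (E : WreathRep G) {n : ℕ} (x : E.deg n) : iota E n x ∈ wt (xiObj E) n := by
  intro t
  rw [tdiag, fm_rowMap_iota]
  exact (xgMulti (freeRep G n) x).map_smul_univ t (stdv G n)

/-- The coefficient of the group element `g` in the `j`-th coordinate. -/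
def coeffAt {n : ℕ} (j : Fin n) (g : G) : freeRep G n →ₗ[ℂ] ℂ :=
  (Finsupp.lapply g ∘ₗ (MonoidAlgebra.coeffLinearEquiv ℂ).toLinearMap) ∘ₗ
    (LinearMap.proj j : (Fin n → ℂ[G]) →ₗ[ℂ] ℂ[G])

lemma coeffAt_rho {n : ℕ} (j : Fin n) (g h : G) (x : freeRep G n) :
    coeffAt j (h * g) ((freeRep G n).ρ h x) = coeffAt j g x := by
  change (MonoidAlgebra.single h 1 * (x : Fin n → ℂ[G]) j).coeff (h * g) =
    ((x : Fin n → ℂ[G]) j).coeff g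
  simp

open Classical in
lemma coeffAt_stdv {n : ℕ} (i j : Fin n) (g h : G) :
    coeffAt j g ((freeRep G n).ρ h (stdv G n i)) = if i = j ∧ h = g then 1 else 0 := by
  change (MonoidAlgebra.single h 1 * (Pi.single i 1 : Fin n → ℂ[G]) j).coeff g = _
  by_cases hij : i = j
  · subst hij
    by_cases hg : h = g
    · subst hg
      simp
    · simp [hg]
  · rw [Pi.single_eq_of_ne (Ne.symm hij)]
    simp [hij]

/-- The functional on `(ℂ[G]^n)^{⊗ n}` dual to the basis vector `w (e_1 ⊗ ⋯ ⊗ e_n)`. -/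
def kap {n : ℕ} (w : Wr G n) : TPow n (freeRep G n) →ₗ[ℂ] ℂ :=
  PiTensorProduct.lift ((MultilinearMap.mkPiAlgebra ℂ (Fin n) ℂ).compLinearMap
    fun l => coeffAt (w.right.symm l) (w.left l))

lemma kap_tprod {n : ℕ} (w : Wr G n) (v : Fin n → freeRep G n) :
    kap w (PiTensorProduct.tprod ℂ v) = ∏ l, coeffAt (w.right.symm l) (w.left l) (v l) := by
  rw [kap, PiTensorProduct.lift.tprod]
  rfl

lemma kap_wact {n : ℕ} (u w : Wr G n) (v : Fin n → freeRep G n) :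
    kap (u * w) (PiTensorProduct.tprod ℂ (wact u v)) = kap w (PiTensorProduct.tprod ℂ v) := by
  rw [kap_tprod, kap_tprod]
  refine Fintype.prod_equiv u.right.symm _ _ fun l => ?_
  exact coeffAt_rho _ _ _ _

open Classical in
/-- The translates of `e_1 ⊗ ⋯ ⊗ e_n` by distinct elements of `G ≀ S_n` are distinct basis vectors,
so the functional dual to one of them vanishes on the others. -/
lemma kap_stdv {n : ℕ} (w : Wr G n) :
    kap w (PiTensorProduct.tprod ℂ (stdv G n)) = if w = 1 then 1 else 0 := by
  rw [kap_tprod]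
  have h : ∀ l, coeffAt (w.right.symm l) (w.left l) (stdv G n l) =
      if l = w.right.symm l ∧ 1 = w.left l then 1 else 0 := by
    intro l
    rw [← coeffAt_stdv]
    congr 1
    exact (LinearMap.congr_fun (freeRep G n).ρ.map_one _).symm
  simp only [h]
  rw [Finset.prod_ite_zero]
  simp only [Finset.prod_const_one, Finset.mem_univ, true_implies]
  refine if_congr ⟨fun h => ?_, ?_⟩ rfl rfl
  · refine SemidirectProduct.ext (funext fun l => (h l).2.symm) (Equiv.ext fun l => ?_)
    exact (w.right.eq_symm_apply.1 (h l).1)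
  · rintro rfl l
    exact ⟨rfl, rfl⟩

/-- The map `E_n ⊗ (ℂ[G]^n)^{⊗ n} → E_n` before passing to coinvariants. -/
def retrPre (E : WreathRep G) (n : ℕ) : E.deg n ⊗[ℂ] TPow n (freeRep G n) →ₗ[ℂ] E.deg n :=
  letI := Fintype.ofFinite (Wr G n)
  TensorProduct.lift (∑ w : Wr G n, ((LinearMap.lsmul ℂ (E.deg n)).flip ∘ₗ
    (E.deg n).ρ w⁻¹).compl₂ (kap w))

lemma retrPre_tmul (E : WreathRep G) {n : ℕ} [Fintype (Wr G n)] (x : E.deg n)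
    (t : TPow n (freeRep G n)) :
    retrPre E n (x ⊗ₜ t) = ∑ w : Wr G n, kap w t • (E.deg n).ρ w⁻¹ x := by
  rw [retrPre, TensorProduct.lift.tmul, LinearMap.sum_apply, LinearMap.sum_apply]
  refine Finset.sum_congr (by ext; simp) fun w _ => rfl

/-- A retraction of `iota` in degree `n`. -/
def retr (E : WreathRep G) (n : ℕ) : XiDeg E (freeRep G n) n →ₗ[ℂ] E.deg n :=
  Representation.Coinvariants.lift (xiRep E (freeRep G n) n) (retrPre E n) (by
    let := Fintype.ofFinite (Wr G n)
    intro u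
    refine xi_pre_ext fun x v => ?_
    rw [LinearMap.comp_apply, xiRep_tprod, retrPre_tmul, retrPre_tmul]
    refine (Fintype.sum_equiv (Equiv.mulLeft u) _ _ fun w => ?_).symm
    rw [Equiv.coe_mulLeft, kap_wact, mul_inv_rev, map_mul]
    change _ = _ • (E.deg n).ρ w⁻¹ ((E.deg n).ρ u⁻¹ ((E.deg n).ρ u x))
    have := (E.deg n).ρ.map_mul u⁻¹ u
    rw [inv_mul_cancel, map_one] at this
    exact congrArg (fun z => kap w (PiTensorProduct.tprod ℂ v) • (E.deg n).ρ w⁻¹ z)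
      (LinearMap.congr_fun this x))

/-- The composite of `iota` with the retraction is the identity, because only `w = 1` contributes.
-/
lemma iota_injective (E : WreathRep G) (n : ℕ) : Function.Injective (iota E n) := by
  let := Fintype.ofFinite (Wr G n)
  have h : ∀ x, retr E n (DirectSum.component ℂ ℕ (XiDeg E (freeRep G n)) n (iota E n x)) = x := by
    intro x
    refine (congrArg (retr E n) (DirectSum.component.lof_self ℂ n _)).trans ?_
    refine (retrPre_tmul E x _).trans ?_
    rw [Finset.sum_eq_single 1]
    · rw [kap_stdv, if_pos rfl, one_smul, inv_one, map_one]
      rfl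
    · intro w _ hw
      rw [kap_stdv, if_neg hw, zero_smul]
    · intro h
      exact absurd (Finset.mem_univ _) h
  exact Function.LeftInverse.injective (g := fun y => retr E n (DirectSum.component ℂ ℕ
    (XiDeg E (freeRep G n)) n y)) h

lemma iota_rho (E : WreathRep G) {n : ℕ} (w : Wr G n) (x : E.deg n) :
    iota E n ((E.deg n).ρ w x) = xg x (wact w⁻¹ (stdv G n)) := by
  rw [iota_apply, ← xg_rho w x, wact_wact_inv]

lemma tdiag_proj {n : ℕ} (j : Fin n) (x : Fin n → ℂ[G]) :
    flin (cproj G j) x = (Pi.single j (x j) : Fin n → ℂ[G]) := by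
  have : (flin (cproj G j) : freeRep G n →ₗ[ℂ] freeRep G n) =
      (LinearMap.single ℂ (fun _ : Fin n => ℂ[G]) j ∘ₗ LinearMap.proj j :
        (Fin n → ℂ[G]) →ₗ[ℂ] (Fin n → ℂ[G])) := by
    refine freeRep_lin_ext fun i a => ?_
    rw [flin_rho]
    have h1 : flin (cproj G j) (stdv G n i) = (Pi.single j 1 : Fin n → ℂ) i • stdv G n i :=
      rowMap_stdv _ i
    rw [h1]
    change _ = (Pi.single j (MonoidAlgebra.single a 1 * (Pi.single i 1 : Fin n → ℂ[G]) j) :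
      Fin n → ℂ[G])
    by_cases hij : i = j
    · subst hij
      rw [Pi.single_eq_same, one_smul, Pi.single_eq_same, mul_one]
      exact ((single_eq_rho_smul i a 1).trans (one_smul _ _)).symm
    · rw [Pi.single_eq_of_ne hij, zero_smul, map_zero, Pi.single_eq_of_ne (Ne.symm hij), mul_zero,
        Pi.single_zero]
      rfl
  exact LinearMap.congr_fun this x

/-- A generator whose vectors lie in distinct coordinate lines of `ℂ[G]^n` comes from `E_n`: expand
the vectors in group elements and move the monomial matrix to `E_n`. -/
lemma xg_perm_mem (E : WreathRep G) {n : ℕ} (x : E.deg n) (r : Fin n → Fin n)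
    (hr : Function.Bijective r) (a : Fin n → ℂ[G]) :
    xg (V := freeRep G n) x (fun l => (Pi.single (r l) (a l) : Fin n → ℂ[G])) ∈
      LinearMap.range (iota E n) := by
  let := Fintype.ofFinite G
  have ha : (fun l => (Pi.single (r l) (a l) : Fin n → ℂ[G])) = fun l => ∑ g : G,
      ((a l).coeff g • (freeRep G n).ρ g (stdv G n (r l)) : freeRep G n) := by
    funext l
    have h2 : a l = ∑ g : G, MonoidAlgebra.single g ((a l).coeff g) := by
      conv_lhs => rw [← MonoidAlgebra.sum_coeff_single (a l)]
      exact Finsupp.sum_fintype _ _ fun _ => MonoidAlgebra.single_zero _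
    refine Eq.trans ?_ (Finset.sum_congr rfl fun g _ => single_eq_rho_smul (r l) g ((a l).coeff g))
    conv_lhs => rw [h2]
    exact map_sum (LinearMap.single ℂ (fun _ : Fin n => ℂ[G]) (r l)) _ _
  rw [ha, ← xgMulti_apply, MultilinearMap.map_sum (xgMulti (freeRep G n) x) fun l g =>
    ((a l).coeff g • (freeRep G n).ρ g (stdv G n (r l)) : freeRep G n)]
  refine Submodule.sum_mem _ fun g _ => ?_
  rw [MultilinearMap.map_smul_univ (xgMulti (freeRep G n) x) (fun l => (a l).coeff (g l))
    fun l => (freeRep G n).ρ (g l) (stdv G n (r l))]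
  refine Submodule.smul_mem _ _ ⟨(E.deg n).ρ (⟨g, (Equiv.ofBijective r hr).symm⟩ : Wr G n)⁻¹ x, ?_⟩
  rw [iota_rho, inv_inv]
  rfl

/-- The projection to the multilinear part expands a generator `x ⊗ v_1 ⊗ ⋯ ⊗ v_m` over the maps `r`
from `{1, …, m}` to `{1, …, n}`, replacing each `v_l` by its coordinate `r(l)`, and keeps the terms
with `r` bijective. -/
lemma wt_xi_le_range (E : WreathRep G) {n : ℕ} {z : (xiObj E).obj (freeRep G n)}
    (hz : z ∈ wt (xiObj E) n) : z ∈ LinearMap.range (iota E n) := by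
  obtain ⟨N₀, hN₀⟩ := E.property
  rw [← wtProj_of_mem (N := N₀ + 2) (by omega) hz]
  clear hz
  have h : (LinearMap.range (iota E n)).mkQ ∘ₗ wtProj (xiObj E) (N₀ + 2) n = 0 := by
    refine xi_hom_ext (E := E) fun m x v => ?_
    refine (Submodule.Quotient.mk_eq_zero _).2 ?_
    by_cases hm : N₀ ≤ m
    · have := hN₀ m hm
      obtain rfl : x = 0 := Subsingleton.elim _ _
      have : xg (0 : E.deg m) v = 0 := by simp [xg]
      rw [this]
      exact (map_zero (wtProj (xiObj E) (N₀ + 2) n)).symm ▸ Submodule.zero_mem _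
    · have h1 : wtProj (xiObj E) (N₀ + 2) n (xg x v) = ∑ r : Fin m → Fin n,
          (if Function.Bijective r then (1 : ℂ) else 0) •
            xg x fun l => flin (cproj G (r l)) (v l) := by
        let L : ((xiObj E).obj (freeRep G n) →ₗ[ℂ] (xiObj E).obj (freeRep G n)) →ₗ[ℂ]
          (xiObj E).obj (freeRep G n) := LinearMap.applyₗ (xg x v)
        refine (mlCoeff_map (N₀ + 2) n L fun c => fm (xiObj E) (∑ j, c j • cproj G j)).symm.trans ?_
        have h2 : ∀ c : Fin n → ℂ, L (fm (xiObj E) (∑ j, c j • cproj G j)) =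
            ∑ r : Fin m → Fin n, (∏ l, c (r l)) • xg x fun l => flin (cproj G (r l)) (v l) := by
          intro c
          refine (fm_xi_xg (∑ j, c j • cproj G j) x v).trans ?_
          have h3 : (fun l => flin (∑ j, c j • cproj G j) (v l)) =
              fun l => ∑ j, c j • flin (cproj G j) (v l) := by
            funext l
            rw [flin_sum, LinearMap.sum_apply]
            rfl
          rw [h3, ← xgMulti_apply]
          refine (MultilinearMap.map_sum (xgMulti (freeRep G n) x) _).trans
            (Finset.sum_congr rfl fun r _ => ?_)
          exact (xgMulti (freeRep G n) x).map_smul_univ (fun l => c (r l)) _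
        simp only [h2]
        refine (mlCoeff_sum (W := XiSp E (freeRep G n)) (N₀ + 2) n Finset.univ
          fun (r : Fin m → Fin n) c => (∏ l, c (r l)) •
            xg x fun l => flin (cproj G (r l)) (v l)).trans ?_
        refine Finset.sum_congr rfl fun r _ => ?_
        rw [mlCoeff_smul_right, mlCoeff_monomial (by omega) (by omega)]
      refine h1.symm ▸ Submodule.sum_mem _ fun r _ => ?_
      by_cases hr : Function.Bijective r
      · obtain rfl : m = n := by simpa using Fintype.card_of_bijective hr
        refine Submodule.smul_mem _ _ ?_
        have h4 : (fun l => flin (cproj G (r l)) (v l)) = fun l =>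
            (Pi.single (r l) ((v l : Fin m → ℂ[G]) (r l)) : Fin m → ℂ[G]) :=
          funext fun l => tdiag_proj (r l) (v l)
        rw [h4]
        exact xg_perm_mem E x r hr fun l => (v l : Fin m → ℂ[G]) (r l)
      · rw [if_neg hr, zero_smul]
        exact Submodule.zero_mem _
  have h2 := LinearMap.congr_fun h z
  rwa [LinearMap.comp_apply, LinearMap.zero_apply, Submodule.mkQ_apply,
      Submodule.Quotient.mk_eq_zero] at h2

end

/-! ### `Ξ` is an equivalence -/

section

variable {G : Type} [Group G] [Finite G]

/-- The multilinear part of `Ξ(E)` in degree `n` is `E_n`. -/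
def iotaEquiv (E : WreathRep G) (n : ℕ) : E.deg n ≃ₗ[ℂ] wt (xiObj E) n :=
  LinearEquiv.ofBijective ((iota E n).codRestrict (wt (xiObj E) n) (iota_mem E))
    ⟨fun x y h => iota_injective E n (congrArg Subtype.val h), fun z => by
      obtain ⟨x, hx⟩ := wt_xi_le_range E z.2
      exact ⟨x, Subtype.ext hx⟩⟩

lemma iotaEquiv_apply (E : WreathRep G) {n : ℕ} (x : E.deg n) :
    (iotaEquiv E n x : (xiObj E).obj (freeRep G n)) = iota E n x := rfl

lemma plin_natural {F H : PolyFun G} (α : F ⟶ H) {V W : FDRep ℂ G} (f : V ⟶ W)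
    (x : F.obj.obj V) : plin α W (fm F.obj f x) = fm H.obj f (plin α V x) :=
  LinearMap.congr_fun (congrArg (fun g => g.hom.hom) (α.hom.naturality f)) x

lemma plin_mem_wt {F H : PolyFun G} (α : F ⟶ H) {n : ℕ} {x : F.obj.obj (freeRep G n)}
    (hx : x ∈ wt F.obj n) : plin α _ x ∈ wt H.obj n := by
  intro t
  rw [← plin_natural, hx t, map_smul]

lemma plin_xg {E E' : WreathRep G} (α : (Xi G).obj E ⟶ (Xi G).obj E') {V : FDRep ℂ G} {n : ℕ}
    (x : E.deg n) (v : Fin n → V) :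
    plin α V (xg x v) = fm (xiObj E') (rowMap v) (plin α _ (iota E n x)) :=
  (congrArg (plin α V) (fm_rowMap_iota x v)).symm.trans (plin_natural α (rowMap v) _)

/-- A natural transformation out of `Ξ(E)` is determined by its values on multilinear parts. -/
instance : (Xi G).Faithful where
  map_injective {E E'} φ ψ h := by
    refine lin_ext fun n x => iota_injective E' n ?_
    have h1 := LinearMap.congr_fun (congrArg (fun α => plin α (freeRep G n)) h) (iota E n x)
    refine Eq.trans ?_ (h1.trans ?_)
    · exact (xiHom_id_xg φ x (stdv G n)).symm
    · exact xiHom_id_xg ψ x (stdv G n)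

/-- The map on multilinear parts induced by a natural transformation `Ξ(E) → Ξ(E')`. -/
def xiPre {E E' : WreathRep G} (α : (Xi G).obj E ⟶ (Xi G).obj E') (n : ℕ) :
    E.deg n →ₗ[ℂ] E'.deg n :=
  (iotaEquiv E' n).symm.toLinearMap ∘ₗ
    (plin α (freeRep G n) ∘ₗ iota E n).codRestrict (wt (xiObj E') n) fun x =>
      plin_mem_wt α (iota_mem E x)

lemma iota_xiPre {E E' : WreathRep G} (α : (Xi G).obj E ⟶ (Xi G).obj E') {n : ℕ} (x : E.deg n) :
    iota E' n (xiPre α n x) = plin α (freeRep G n) (iota E n x) := by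
  rw [← iotaEquiv_apply, xiPre, LinearMap.comp_apply, LinearEquiv.coe_coe,
    LinearEquiv.apply_symm_apply]
  rfl

/-- A natural transformation `Ξ(E) → Ξ(E')` is induced by its restriction to multilinear parts. -/
instance : (Xi G).Full where
  map_surjective {E E'} α := by
    refine ⟨mkHom (xiPre α) fun n w x => iota_injective E' n ?_, polyHom_ext fun V =>
      xi_hom_ext fun n x v => ?_⟩
    · rw [iota_xiPre, iota_rho, iota_rho, ← fm_rowMap_iota (xiPre α n x), iota_xiPre]
      exact plin_xg α x _
    · refine (xiHom_id_xg _ x v).trans ?_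
      rw [lin_mkHom, ← fm_rowMap_iota, iota_xiPre]
      exact (plin_xg α x v).symm

lemma flin_wact {V W : FDRep ℂ G} (f : V ⟶ W) {n : ℕ} (w : Wr G n) (v : Fin n → V) :
    (fun j => flin f (wact w v j)) = wact w fun j => flin f (v j) :=
  funext fun _ => flin_rho f _ _

/-- The endomorphism of `ℂ[G]^n` through which `w ∈ G ≀ S_n` acts on multilinear parts. -/
def wrMap {n : ℕ} (w : Wr G n) : freeRep G n ⟶ freeRep G n := rowMap (wact w⁻¹ (stdv G n))

lemma wrMap_comp {n : ℕ} (w : Wr G n) {V : FDRep ℂ G} (v : Fin n → V) :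
    wrMap w ≫ rowMap v = rowMap (wact w⁻¹ v) := by
  rw [wrMap, rowMap_comp, flin_wact]
  simp only [rowMap_stdv]

lemma wrMap_one (n : ℕ) : wrMap (1 : Wr G n) = 𝟙 (freeRep G n) := by
  rw [wrMap, inv_one, wact_one, rowMap_stdv_eq_id]

lemma wrMap_mul {n : ℕ} (u w : Wr G n) : wrMap (u * w) = wrMap w ≫ wrMap u := by
  conv_rhs => rw [wrMap.eq_def u, wrMap_comp, ← wact_mul, ← mul_inv_rev]
  rfl

lemma wrMap_tdiag {n : ℕ} (w : Wr G n) (t : Fin n → ℂ) :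
    wrMap w ≫ tdiag G t = tdiag G (fun i => t (w.right i)) ≫ wrMap w := by
  rw [tdiag, wrMap_comp, wrMap, tdiag_comp_rowMap]
  refine congrArg rowMap (funext fun j => ?_)
  have : (w⁻¹).right.symm j = w.right j := rfl
  rw [wact, wact, map_smul, this]

lemma wrMap_mem {F : FDRep ℂ G ⥤ FGModuleCat ℂ} {n : ℕ} (w : Wr G n)
    {x : F.obj (freeRep G n)} (hx : x ∈ wt F n) : fm F (wrMap w) x ∈ wt F n := by
  intro t
  rw [← fm_comp_apply, wrMap_tdiag, fm_comp_apply, hx, map_smul, Equiv.prod_comp w.right t]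

/-- The action of `G ≀ S_n` on the multilinear part of a functor. -/
def wtRep (F : FDRep ℂ G ⥤ FGModuleCat ℂ) (n : ℕ) : Representation ℂ (Wr G n) (wt F n) where
  toFun w := (fm F (wrMap w)).restrict fun _ hx => wrMap_mem w hx
  map_one' := LinearMap.ext fun x => Subtype.ext (by
    change fm F (wrMap 1) x = (x : F.obj (freeRep G n))
    rw [wrMap_one, fm_id]
    rfl)
  map_mul' u w := LinearMap.ext fun x => Subtype.ext (by
    change fm F (wrMap (u * w)) x = fm F (wrMap u) (fm F (wrMap w) x)
    rw [← fm_comp_apply, wrMap_mul])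

/-- The family of multilinear parts of a polynomial functor. -/
def wtFam (F : PolyFun G) : WreathRep G where
  obj n := FDRep.of (wtRep F.obj n)
  property := by
    obtain ⟨d, hd⟩ := F.property.exists_degree
    refine ⟨d + 1, fun n hn => ⟨fun x y => Subtype.ext ?_⟩⟩
    rw [wt_eq_zero hd hn x.2, wt_eq_zero hd hn y.2]

/-- The vector of the multilinear part of `F` given by an element of `wtFam F`. -/
def wtVal (F : PolyFun G) (n : ℕ) : (wtFam F).deg n →ₗ[ℂ] F.obj.obj (freeRep G n) :=
  (wt F.obj n).subtype

lemma wtVal_mem (F : PolyFun G) {n : ℕ} (x : (wtFam F).deg n) : wtVal F n x ∈ wt F.obj n :=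
  Subtype.property (p := fun z => z ∈ wt F.obj n) x

lemma wtVal_rho (F : PolyFun G) {n : ℕ} (w : Wr G n) (x : (wtFam F).deg n) :
    wtVal F n (((wtFam F).deg n).ρ w x) = fm F.obj (wrMap w) (wtVal F n x) := rfl

/-- `F([v_1, …, v_n])(x)` for `x` in the multilinear part, as a multilinear map. -/
def evMulti (F : PolyFun G) {n : ℕ} (V : FDRep ℂ G) (x : (wtFam F).deg n) :
    MultilinearMap ℂ (fun _ : Fin n => V) (F.obj.obj V) :=
  (exists_multilinear F.property V ⟨wtVal F n x, wtVal_mem F x⟩).choose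

lemma evMulti_apply (F : PolyFun G) {n : ℕ} (V : FDRep ℂ G) (x : (wtFam F).deg n)
    (v : Fin n → V) : evMulti F V x v = fm F.obj (rowMap v) (wtVal F n x) :=
  (exists_multilinear F.property V ⟨wtVal F n x, wtVal_mem F x⟩).choose_spec v

/-- The map `E_n ⊗ V^{⊗ n} → F(V)`, `x ⊗ v_1 ⊗ ⋯ ⊗ v_n ↦ F([v_1, …, v_n])(x)`, where `E_n` is the
multilinear part of `F`. -/
def thetaPre (F : PolyFun G) (V : FDRep ℂ G) (n : ℕ) :
    (wtFam F).deg n →ₗ[ℂ] TPow n V →ₗ[ℂ] F.obj.obj V where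
  toFun x := PiTensorProduct.lift (evMulti F V x)
  map_add' x y := PiTensorProduct.ext (MultilinearMap.ext fun v => by
    simp [evMulti_apply])
  map_smul' c x := PiTensorProduct.ext (MultilinearMap.ext fun v => by
    simp [evMulti_apply])

lemma thetaPre_tprod (F : PolyFun G) {V : FDRep ℂ G} {n : ℕ} (x : (wtFam F).deg n)
    (v : Fin n → V) : thetaPre F V n x (PiTensorProduct.tprod ℂ v) =
      fm F.obj (rowMap v) (wtVal F n x) :=
  (PiTensorProduct.lift.tprod v).trans (evMulti_apply F V x v)

/-- The comparison map `Ξ(E)(V) → F(V)` for the family `E` of multilinear parts of `F`. -/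
def theta (F : PolyFun G) (V : FDRep ℂ G) : XiSp (wtFam F) V →ₗ[ℂ] F.obj.obj V :=
  DirectSum.toModule ℂ ℕ _ fun n => Representation.Coinvariants.lift (xiRep (wtFam F) V n)
    (TensorProduct.lift (thetaPre F V n)) fun w => xi_pre_ext fun x v => by
      rw [LinearMap.comp_apply, xiRep_tprod, TensorProduct.lift.tmul, TensorProduct.lift.tmul,
        thetaPre_tprod, thetaPre_tprod, wtVal_rho, ← fm_comp_apply, wrMap_comp, wact_inv_wact]

lemma theta_xg (F : PolyFun G) {V : FDRep ℂ G} {n : ℕ} (x : (wtFam F).deg n) (v : Fin n → V) :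
    theta F V (xg x v) = fm F.obj (rowMap v) (wtVal F n x) :=
  (DirectSum.toModule_lof ℂ n _).trans (thetaPre_tprod F x v)

lemma theta_natural (F : PolyFun G) {V W : FDRep ℂ G} (f : V ⟶ W) :
    theta F W ∘ₗ fm (xiObj (wtFam F)) f = fm F.obj f ∘ₗ theta F V := by
  refine xi_hom_ext fun n x v => ?_
  refine (congrArg (theta F W) (fm_xi_xg f x v)).trans ?_
  refine Eq.trans ?_ (congrArg (fm F.obj f) (theta_xg F x v)).symm
  rw [theta_xg, ← fm_comp_apply, rowMap_comp]

/-- On the multilinear part the comparison map is the inclusion of `wt F n` in `F(ℂ[G]^n)`, hence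
injective. -/
lemma theta_injective (F : PolyFun G) (V : FDRep ℂ G) : Function.Injective (theta F V) := by
  refine injective_of_wt (xiObj_poly (wtFam F)) (H := F.obj) (theta F) (theta_natural F) ?_ V
  intro n z hz h
  obtain ⟨x, rfl⟩ := wt_xi_le_range _ hz
  have h1 : theta F _ (iota (wtFam F) n x) = wtVal F n x := by
    refine (theta_xg F x (stdv G n)).trans ?_
    rw [rowMap_stdv_eq_id, fm_id]
    rfl
  have h2 : x = 0 := Subtype.ext (h1.symm.trans h)
  rw [h2, map_zero]

lemma theta_surjective (F : PolyFun G) (V : FDRep ℂ G) : Function.Surjective (theta F V) :=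
  fun y => wt_span F.property (LinearMap.range (theta F V))
    (fun n x hx v => ⟨xg (E := wtFam F) (n := n) (⟨x, hx⟩ : wt F.obj n) v, theta_xg F _ v⟩) y

/-- Every polynomial functor is of the form `Ξ(E)`. -/
def thetaIso (F : PolyFun G) : (Xi G).obj (wtFam F) ≅ F :=
  (IsPolynomial G).isoMk (NatIso.ofComponents (fun V => (LinearEquiv.ofBijective (theta F V)
    ⟨theta_injective F V, theta_surjective F V⟩).toFGModuleCatIso) fun f =>
      FGModuleCat.hom_ext (theta_natural F f))

instance : (Xi G).EssSurj where
  mem_essImage F := ⟨wtFam F, ⟨thetaIso F⟩⟩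

lemma xi_isEquivalence : (Xi G).IsEquivalence where

end

/-! ### Fourier analysis on a finite abelian group -/

section

variable {G : Type} [CommGroup G] [Finite G]

instance charFinite : Finite (G →* ℂˣ) := by
  have : NeZero (Monoid.exponent G) := ⟨Monoid.exponent_ne_zero_of_finite⟩
  obtain ⟨e⟩ := CommGroup.monoidHom_mulEquiv_of_hasEnoughRootsOfUnity G ℂ
  exact Finite.of_equiv G e.symm.toEquiv

instance charFintype : Fintype (G →* ℂˣ) := Fintype.ofFinite _

@[simp] lemma charExt_single (χ : G →* ℂˣ) (g : G) (c : ℂ) :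
    charExt χ (MonoidAlgebra.single g c) = c * (χ g : ℂ) := by
  simp [charExt]

lemma sum_char_apply {g : G} (hg : g ≠ 1) : ∑ χ : G →* ℂˣ, (χ g : ℂ) = 0 := by
  have : NeZero (Monoid.exponent G) := ⟨Monoid.exponent_ne_zero_of_finite⟩
  obtain ⟨ψ, hψ⟩ := CommGroup.exists_apply_ne_one_of_hasEnoughRootsOfUnity G ℂ hg
  have h : (ψ g : ℂ) * ∑ χ : G →* ℂˣ, (χ g : ℂ) = ∑ χ : G →* ℂˣ, (χ g : ℂ) := by
    rw [Finset.mul_sum]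
    refine Fintype.sum_equiv (Equiv.mulLeft ψ) _ _ fun χ => ?_
    simp
  have h2 : (ψ g : ℂ) ≠ 1 := fun h => hψ (Units.ext h)
  by_contra h0
  exact h2 (mul_right_cancel₀ h0 (h.trans (one_mul _).symm))

lemma card_char : (Fintype.card (G →* ℂˣ) : ℂ) = Nat.card G := by
  have : NeZero (Monoid.exponent G) := ⟨Monoid.exponent_ne_zero_of_finite⟩
  obtain ⟨e⟩ := CommGroup.monoidHom_mulEquiv_of_hasEnoughRootsOfUnity G ℂ
  rw [← Nat.card_eq_fintype_card, Nat.card_congr e.toEquiv]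

lemma sum_apply_char [Fintype G] {χ : G →* ℂˣ} (hχ : χ ≠ 1) : ∑ g : G, (χ g : ℂ) = 0 := by
  obtain ⟨h, hh⟩ : ∃ h, χ h ≠ 1 := by
    by_contra hc
    push Not at hc
    exact hχ (MonoidHom.ext hc)
  have h1 : (χ h : ℂ) * ∑ g : G, (χ g : ℂ) = ∑ g : G, (χ g : ℂ) := by
    rw [Finset.mul_sum]
    refine Fintype.sum_equiv (Equiv.mulLeft h) _ _ fun g => ?_
    simp
  have h2 : (χ h : ℂ) ≠ 1 := fun h => hh (Units.ext h)
  by_contra h0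
  exact h2 (mul_right_cancel₀ h0 (h1.trans (one_mul _).symm))

/-- The primitive idempotent of `ℂ[G]` on which `G` acts through `χ`. -/
def cidem (χ : G →* ℂˣ) : ℂ[G] :=
  letI := Fintype.ofFinite G
  (Nat.card G : ℂ)⁻¹ • ∑ g : G, MonoidAlgebra.single g ((χ g⁻¹ : ℂˣ) : ℂ)

lemma charExt_cidem [DecidableEq (G →* ℂˣ)] (χ ψ : G →* ℂˣ) :
    charExt ψ (cidem χ) = if ψ = χ then 1 else 0 := by
  let := Fintype.ofFinite G
  rw [cidem, map_smul, map_sum]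
  simp only [charExt_single]
  split_ifs with h
  · subst h
    simp
  · have h2 : ∑ g : G, ((χ g⁻¹ : ℂˣ) : ℂ) * (ψ g : ℂ) = 0 := by
      rw [← sum_apply_char (χ := χ⁻¹ * ψ) fun hc => h (inv_mul_eq_one.1 hc).symm]
      exact Finset.sum_congr rfl fun g _ => by simp
    rw [h2, smul_zero]

lemma sum_cidem : ∑ χ : G →* ℂˣ, cidem χ = 1 := by
  let := Fintype.ofFinite G
  have hG : (Nat.card G : ℂ) ≠ 0 := by exact_mod_cast Nat.card_pos.ne'
  simp only [cidem]
  rw [← Finset.smul_sum, Finset.sum_comm]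
  rw [Finset.sum_eq_single 1]
  · have h : ∀ χ : G →* ℂˣ, MonoidAlgebra.single (1 : G) ((χ 1⁻¹ : ℂˣ) : ℂ) = 1 := by
      intro χ
      simp [MonoidAlgebra.one_def]
    simp only [h]
    rw [Finset.sum_const, Finset.card_univ, ← Nat.cast_smul_eq_nsmul ℂ, card_char, smul_smul,
      inv_mul_cancel₀ hG, one_smul]
  · intro g _ hg
    have h := map_sum (MonoidAlgebra.lsingle g : ℂ →ₗ[ℂ] ℂ[G])
      (fun χ : G →* ℂˣ => ((χ g⁻¹ : ℂˣ) : ℂ))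
      Finset.univ
    rw [sum_char_apply (inv_ne_one.2 hg), map_zero] at h
    exact h.symm
  · intro h
    exact absurd (Finset.mem_univ _) h

lemma mul_cidem (a : ℂ[G]) (χ : G →* ℂˣ) : a * cidem χ = charExt χ a • cidem χ := by
  let := Fintype.ofFinite G
  induction a using MonoidAlgebra.induction_linear with
  | zero => simp
  | add a b ha hb => rw [add_mul, ha, hb, map_add, add_smul]
  | single h c =>
    rw [cidem, mul_smul_comm, smul_comm, charExt_single]
    refine congrArg ((Nat.card G : ℂ)⁻¹ • ·) ?_
    rw [Finset.mul_sum, Finset.smul_sum]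
    refine Fintype.sum_equiv (Equiv.mulLeft h) _ _ fun g => ?_
    rw [MonoidAlgebra.single_mul_single, Equiv.coe_mulLeft, MonoidAlgebra.smul_single]
    congr 1
    simp only [mul_inv_rev, map_mul, Units.val_mul, smul_eq_mul, map_inv]
    have : (χ h : ℂ) * ((χ h)⁻¹ : ℂˣ) = 1 := Units.mul_inv _
    linear_combination (-c * ((χ g)⁻¹ : ℂˣ)) * this

lemma eq_sum_cidem (a : ℂ[G]) : a = ∑ χ : G →* ℂˣ, charExt χ a • cidem χ := by
  conv_lhs => rw [← mul_one a, ← sum_cidem, Finset.mul_sum]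
  exact Finset.sum_congr rfl fun χ _ => mul_cidem a χ

/-- The element of `ℂ[G]^d` with coordinates `χ(x_i) = y_{χ, i}`. -/
def ofCoord {d : ℕ} (y : (G →* ℂˣ) × Fin d → ℂ) (i : Fin d) : ℂ[G] :=
  ∑ χ : G →* ℂˣ, y (χ, i) • cidem χ

lemma charExt_ofCoord {d : ℕ} (y : (G →* ℂˣ) × Fin d → ℂ) (χ : G →* ℂˣ) (i : Fin d) :
    charExt χ (ofCoord y i) = y (χ, i) := by
  classical
  rw [ofCoord, map_sum]
  simp only [map_smul, charExt_cidem]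
  simp

/-- The coordinates `χ(x_i)` of an element of `ℂ[G]^d`. -/
def coord {d : ℕ} (x : Fin d → ℂ[G]) (p : (G →* ℂˣ) × Fin d) : ℂ := charExt p.1 (x p.2)

lemma coord_ofCoord {d : ℕ} (y : (G →* ℂˣ) × Fin d → ℂ) : coord (ofCoord y) = y :=
  funext fun p => charExt_ofCoord y p.1 p.2

lemma ofCoord_coord {d : ℕ} (x : Fin d → ℂ[G]) : ofCoord (coord x) = x :=
  funext fun i => (eq_sum_cidem (x i)).symm

lemma coord_injective {d : ℕ} : Function.Injective (coord (G := G) (d := d)) :=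
  Function.LeftInverse.injective ofCoord_coord

end

/-! ### Traces of polynomial representations of a torus are integral -/

section

/-- The trace of an idempotent matrix is its rank. -/
lemma trace_natCast_of_idempotent {k : Type*} [Fintype k] [DecidableEq k] {A : Matrix k k ℂ}
    (hA : A * A = A) : ∃ z : ℕ, A.trace = z := by
  have h : IsIdempotentElem (Matrix.toLin' A) := by
    rw [IsIdempotentElem, Module.End.mul_eq_comp, ← Matrix.toLin'_mul, hA]
  refine ⟨Module.finrank ℂ (LinearMap.range (Matrix.toLin' A)), ?_⟩
  rw [← (LinearMap.IsIdempotentElem.isProj_range _ h).trace, Matrix.trace_toLin'_eq]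

/-- The polynomial `P(t_1 X_1, …, t_s X_s)`. -/
def scaleVars {σ : Type*} (t : σ → ℂ) : MvPolynomial σ ℂ →ₐ[ℂ] MvPolynomial σ ℂ :=
  MvPolynomial.aeval fun p => MvPolynomial.C (t p) * MvPolynomial.X p

lemma coeff_scaleVars {σ : Type*} (t : σ → ℂ) (P : MvPolynomial σ ℂ) (m : σ →₀ ℕ) :
    (scaleVars t P).coeff m = P.coeff m * m.prod fun p k => t p ^ k := by
  classical
  induction P using MvPolynomial.induction_on' with
  | monomial e a =>
    have h : scaleVars t (MvPolynomial.monomial e a) =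
        MvPolynomial.C (e.prod fun p k => t p ^ k) * MvPolynomial.monomial e a := by
      rw [scaleVars, MvPolynomial.aeval_monomial, MvPolynomial.monomial_eq]
      simp only [mul_pow, Finsupp.prod_mul, MvPolynomial.algebraMap_eq]
      simp only [Finsupp.prod, map_prod, map_pow]
      ring
    rw [h, MvPolynomial.coeff_C_mul, MvPolynomial.coeff_monomial]
    split_ifs with hm
    · subst hm
      exact mul_comm _ _
    · rw [mul_zero, zero_mul]
  | add P Q hP hQ => rw [map_add, MvPolynomial.coeff_add, MvPolynomial.coeff_add, hP, hQ, add_mul]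

lemma eval_scaleVars {σ : Type*} (t y : σ → ℂ) (P : MvPolynomial σ ℂ) :
    MvPolynomial.eval y (scaleVars t P) = MvPolynomial.eval (y * t) P := by
  have : (MvPolynomial.aeval y).comp (scaleVars t) = MvPolynomial.aeval (R := ℂ) (y * t) := by
    refine MvPolynomial.algHom_ext fun p => ?_
    simp [scaleVars, mul_comm]
  exact DFunLike.congr_fun this P

/-- The coefficient matrices of a polynomial representation of a torus are orthogonal idempotents,
so their traces are natural numbers. -/
lemma coeff_trace_natCast {σ k : Type*} [Fintype k] [DecidableEq k]
    (Q : Matrix k k (MvPolynomial σ ℂ))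
    (hQ : ∀ y t : σ → ℂ, Q.map (MvPolynomial.eval y) * Q.map (MvPolynomial.eval t) =
      Q.map (MvPolynomial.eval (y * t))) (m : σ →₀ ℕ) :
    ∃ z : ℕ, Q.trace.coeff m = z := by
  classical
  have h₁ : ∀ (t : σ → ℂ) (i l : k), ∑ j, Q i j * MvPolynomial.C (MvPolynomial.eval t (Q j l)) =
      scaleVars t (Q i l) := by
    intro t i l
    refine MvPolynomial.funext fun y => ?_
    rw [eval_scaleVars, map_sum]
    refine Eq.trans ?_ (congrFun (congrFun (hQ y t) i) l)
    simp [Matrix.mul_apply]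
  have h₂ : ∀ i l : k, ∑ j, MvPolynomial.C ((Q i j).coeff m) * Q j l =
      MvPolynomial.monomial m ((Q i l).coeff m) := by
    intro i l
    refine MvPolynomial.funext fun t => ?_
    have h := congrArg (MvPolynomial.coeff m) (h₁ t i l)
    rw [coeff_scaleVars, MvPolynomial.coeff_sum] at h
    rw [MvPolynomial.eval_monomial, ← h, map_sum]
    refine Finset.sum_congr rfl fun j _ => ?_
    rw [mul_comm (Q i j), MvPolynomial.coeff_C_mul, map_mul, MvPolynomial.eval_C, mul_comm]
  obtain ⟨z, hz⟩ := trace_natCast_of_idempotent (A := Q.map (MvPolynomial.coeff m)) (by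
    ext i l
    have h := congrArg (MvPolynomial.coeff m) (h₂ i l)
    rw [MvPolynomial.coeff_sum, MvPolynomial.coeff_monomial, if_pos rfl] at h
    simpa only [Matrix.mul_apply, Matrix.map_apply, MvPolynomial.coeff_C_mul] using h)
  refine ⟨z, ?_⟩
  rw [← hz, Matrix.trace, Matrix.trace, MvPolynomial.coeff_sum]
  rfl

lemma polyMaps_functional {s d : ℕ} {W : Type*} [AddCommGroup W] [Module ℂ W] (ℓ : W →ₗ[ℂ] ℂ)
    {φ : (Fin s → ℂ) → W} (h : φ ∈ polyMaps s d W) :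
    ∃ P : MvPolynomial (Fin s) ℂ, P.totalDegree ≤ d ∧ ∀ c, ℓ (φ c) = MvPolynomial.eval c P := by
  induction h using Submodule.span_induction with
  | mem φ hφ =>
    obtain ⟨P, hP, w, rfl⟩ := hφ
    refine ⟨MvPolynomial.C (ℓ w) * P, ?_, fun c => ?_⟩
    · exact (MvPolynomial.totalDegree_mul _ _).trans (by simpa using hP)
    · rw [map_smul, map_mul, MvPolynomial.eval_C, smul_eq_mul, mul_comm]
  | zero => exact ⟨0, by simp, fun c => by simp⟩
  | add φ ψ _ _ h₁ h₂ =>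
    obtain ⟨P, hP, h⟩ := h₁
    obtain ⟨Q, hQ, h'⟩ := h₂
    exact ⟨P + Q, (MvPolynomial.totalDegree_add P Q).trans (max_le hP hQ), fun c => by
      rw [Pi.add_apply, map_add, map_add, h, h']⟩
  | smul a φ _ h₁ =>
    obtain ⟨P, hP, h⟩ := h₁
    refine ⟨MvPolynomial.C a * P, ?_, fun c => ?_⟩
    · exact (MvPolynomial.totalDegree_mul _ _).trans (by simpa using hP)
    · rw [Pi.smul_apply, map_smul, map_mul, MvPolynomial.eval_C, smul_eq_mul, h]

lemma exists_int_polynomial {σ : Type*} (P : MvPolynomial σ ℂ)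
    (hP : ∀ m, ∃ z : ℤ, P.coeff m = z) :
    ∃ Q : MvPolynomial σ ℤ, MvPolynomial.map (algebraMap ℤ ℂ) Q = P := by
  have : P ∈ Set.range (MvPolynomial.map (σ := σ) (algebraMap ℤ ℂ)) := by
    rw [MvPolynomial.mem_range_map_iff_coeffs_subset]
    intro c hc
    obtain ⟨m, _, rfl⟩ := MvPolynomial.mem_coeffs_iff.1 hc
    obtain ⟨z, hz⟩ := hP m
    exact ⟨z, by rw [hz]; rfl⟩
  exact this

lemma totalDegree_of_map {σ R : Type*} [CommRing R] [Algebra R ℂ]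
    (hR : Function.Injective (algebraMap R ℂ)) (Q : MvPolynomial σ R) :
    (MvPolynomial.map (algebraMap R ℂ) Q).totalDegree = Q.totalDegree := by
  rw [MvPolynomial.totalDegree, MvPolynomial.totalDegree,
    MvPolynomial.support_map_of_injective _ hR]

end

/-! ### Characters of polynomial functors -/

section

lemma trace_exact {A B C : Type*} [AddCommGroup A] [Module ℂ A] [AddCommGroup B] [Module ℂ B]
    [AddCommGroup C] [Module ℂ C] [Module.Finite ℂ A] [Module.Finite ℂ B] [Module.Finite ℂ C]
    {i : A →ₗ[ℂ] B} {p : B →ₗ[ℂ] C} (hi : Function.Injective i) (hip : Function.Exact i p)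
    (hp : Function.Surjective p) {a : A →ₗ[ℂ] A} {b : B →ₗ[ℂ] B} {c : C →ₗ[ℂ] C}
    (ha : i ∘ₗ a = b ∘ₗ i) (hc : p ∘ₗ b = c ∘ₗ p) :
    LinearMap.trace ℂ B b = LinearMap.trace ℂ A a + LinearMap.trace ℂ C c := by
  obtain ⟨s, hs⟩ := LinearMap.exists_rightInverse_of_surjective p (LinearMap.range_eq_top.2 hp)
  obtain ⟨r, hr⟩ := LinearMap.exists_leftInverse_of_injective i (LinearMap.ker_eq_bot.2 hi)
  -- correct the retraction so that it vanishes on the image of the section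
  set r' : B →ₗ[ℂ] A := r - r ∘ₗ s ∘ₗ p with hr'
  have hpi : p ∘ₗ i = 0 := LinearMap.ext fun x => hip.apply_apply_eq_zero x
  have h1 : r' ∘ₗ i = LinearMap.id := by
    rw [hr', LinearMap.sub_comp, hr, LinearMap.comp_assoc, LinearMap.comp_assoc, hpi]
    simp
  have h2 : i ∘ₗ r' + s ∘ₗ p = LinearMap.id := by
    refine LinearMap.ext fun x => ?_
    have h3 : p (x - s (p x)) = 0 := by
      rw [map_sub, sub_eq_zero]
      exact (LinearMap.congr_fun hs (p x)).symm
    obtain ⟨y, hy⟩ := (hip _).1 h3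
    have h4 : r' x = y := by
      have : r' x = r (x - s (p x)) := by simp [hr']
      rw [this, ← hy]
      exact LinearMap.congr_fun hr y
    rw [LinearMap.add_apply, LinearMap.comp_apply, h4, hy]
    simp
  have h5 : b = (b ∘ₗ i) ∘ₗ r' + (b ∘ₗ s) ∘ₗ p := by
    rw [LinearMap.comp_assoc, LinearMap.comp_assoc, ← LinearMap.comp_add, h2, LinearMap.comp_id]
  rw [h5, map_add]
  congr 1
  · rw [← ha, LinearMap.trace_comp_comm', ← LinearMap.comp_assoc, h1, LinearMap.id_comp]
  · rw [LinearMap.trace_comp_comm', ← LinearMap.comp_assoc, hc, LinearMap.comp_assoc, hs,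
      LinearMap.comp_id]

variable {G : Type} [Group G] [Finite G]

lemma polyChar_eq (F : PolyFun G) (d : ℕ) (x : Fin d → ℂ[G]) :
    polyChar F d x = LinearMap.trace ℂ _ (fm F.obj (diagEnd x)) := rfl

lemma polyChar_iso {F H : PolyFun G} (e : F ≅ H) : polyChar F = polyChar H := by
  funext d x
  rw [polyChar_eq, polyChar_eq]
  have h1 : plin e.inv (freeRep G d) ∘ₗ plin e.hom (freeRep G d) = LinearMap.id := by
    rw [← plin_comp, e.hom_inv_id]
    rfl
  have h2 : plin e.hom (freeRep G d) ∘ₗ fm F.obj (diagEnd x) =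
      fm H.obj (diagEnd x) ∘ₗ plin e.hom (freeRep G d) :=
    LinearMap.ext fun y => plin_natural e.hom (diagEnd x) y
  rw [← LinearMap.comp_id (fm F.obj (diagEnd x)), ← h1, ← LinearMap.comp_assoc,
    LinearMap.trace_comp_comm', ← LinearMap.comp_assoc, h2, LinearMap.comp_assoc]
  have h3 : plin e.hom (freeRep G d) ∘ₗ plin e.inv (freeRep G d) = LinearMap.id := by
    rw [← plin_comp, e.inv_hom_id]
    rfl
  rw [h3, LinearMap.comp_id]

lemma polyChar_exact {A B C : PolyFun G} (h : polySES G A B C) :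
    polyChar B = polyChar A + polyChar C := by
  obtain ⟨f, g, hfg⟩ := h
  funext d x
  exact trace_exact (hfg _).1 (hfg _).2.1 (hfg _).2.2
    (LinearMap.ext fun y => plin_natural f (diagEnd x) y)
    (LinearMap.ext fun y => plin_natural g (diagEnd x) y)

lemma polyChar_tensor (F H : PolyFun G) : polyChar (F ⊗ H) = polyChar F * polyChar H := by
  funext d x
  exact LinearMap.trace_tensorProduct' (fm F.obj (diagEnd x)) (fm H.obj (diagEnd x))

lemma polyChar_unit : polyChar (𝟙_ (PolyFun G)) = 1 := by
  funext d x
  have : fm (𝟙_ (PolyFun G)).obj (diagEnd x) = (LinearMap.id : ℂ →ₗ[ℂ] ℂ) := rfl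
  rw [polyChar_eq]
  refine (congrArg (LinearMap.trace ℂ ℂ) this).trans ?_
  rw [LinearMap.trace_id, Module.finrank_self, Nat.cast_one]
  rfl

lemma trace_fm_comm (F : FDRep ℂ G ⥤ FGModuleCat ℂ) {V W : FDRep ℂ G} (f : V ⟶ W) (g : W ⟶ V) :
    LinearMap.trace ℂ (F.obj V) (fm F (f ≫ g)) = LinearMap.trace ℂ (F.obj W) (fm F (g ≫ f)) := by
  rw [fm_comp, fm_comp, LinearMap.trace_comp_comm']

lemma trace_fm_conj (F : FDRep ℂ G ⥤ FGModuleCat ℂ) {V W : FDRep ℂ G} (u : V ⟶ W) (u' : W ⟶ V)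
    (hu : u ≫ u' = 𝟙 V) {f : V ⟶ V} {f' : W ⟶ W} (h : f ≫ u = u ≫ f') (hu' : u' ≫ u = 𝟙 W) :
    LinearMap.trace ℂ (F.obj V) (fm F f) = LinearMap.trace ℂ (F.obj W) (fm F f') := by
  have h1 : f = (u ≫ f') ≫ u' := by rw [← h, Category.assoc, hu, Category.comp_id]
  rw [h1, trace_fm_comm, ← Category.assoc, hu', Category.id_comp]

lemma diagEnd_comp {d : ℕ} (x y : Fin d → ℂ[G]) : diagEnd x ≫ diagEnd y = diagEnd (x * y) :=
  flin_ext fun (v : Fin d → ℂ[G]) => mul_assoc v x y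

/-- The inclusion `ℂ[G]^d → ℂ[G]^{d+1}` with last coordinate zero. -/
def snocLin (G : Type) [Group G] (d : ℕ) : (Fin d → ℂ[G]) →ₗ[ℂ] (Fin (d + 1) → ℂ[G]) where
  toFun v := Fin.snoc (α := fun _ => ℂ[G]) v 0
  map_add' v w := by
    refine funext fun j => Fin.lastCases ?_ (fun k => ?_) j <;> simp
  map_smul' c v := by
    refine funext fun j => Fin.lastCases ?_ (fun k => ?_) j <;> simp

/-- Since `diag(x, 0)` factors through `ℂ[G]^d`, cyclicity of the trace shows that it contributes
the same trace as `diag(x)`. -/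
lemma polyChar_snoc (F : PolyFun G) (d : ℕ) (x : Fin d → ℂ[G]) :
    polyChar F (d + 1) (Fin.snoc (α := fun _ => ℂ[G]) x 0) = polyChar F d x := by
  let i : freeRep G d ⟶ freeRep G (d + 1) := fmk (V := freeRep G d) (W := freeRep G (d + 1))
    (snocLin G d)
    (fun g (v : Fin d → ℂ[G]) => by
      refine funext fun j : Fin (d + 1) => ?_
      change (Fin.snoc (α := fun _ => ℂ[G]) (fun k => MonoidAlgebra.single g 1 * v k) 0 :
        Fin (d + 1) → ℂ[G]) j = MonoidAlgebra.single g 1 *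
          (Fin.snoc (α := fun _ => ℂ[G]) v 0 : Fin (d + 1) → ℂ[G]) j
      refine Fin.lastCases ?_ (fun k => ?_) j <;> simp)
  let p : freeRep G (d + 1) ⟶ freeRep G d := fmk (V := freeRep G (d + 1)) (W := freeRep G d)
    { toFun := fun v : Fin (d + 1) → ℂ[G] => fun j : Fin d => v j.castSucc
      map_add' := fun v w => rfl
      map_smul' := fun c v => rfl }
    (fun g (v : Fin (d + 1) → ℂ[G]) => rfl)
  have h1 : diagEnd (Fin.snoc (α := fun _ => ℂ[G]) x 0) = p ≫ diagEnd x ≫ i := by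
    refine flin_ext fun v : Fin (d + 1) → ℂ[G] => funext fun j : Fin (d + 1) => ?_
    change v j * (Fin.snoc (α := fun _ => ℂ[G]) x 0 : Fin (d + 1) → ℂ[G]) j =
      (Fin.snoc (α := fun _ => ℂ[G]) (fun k => v k.castSucc * x k) 0 : Fin (d + 1) → ℂ[G]) j
    refine Fin.lastCases ?_ (fun k => ?_) j <;> simp
  have h2 : i ≫ p = 𝟙 _ := flin_ext fun v : Fin d → ℂ[G] => funext fun j : Fin d => by
    change (Fin.snoc (α := fun _ => ℂ[G]) v 0 : Fin (d + 1) → ℂ[G]) j.castSucc = v j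
    simp
  rw [polyChar_eq, polyChar_eq, h1, trace_fm_comm, Category.assoc, h2, Category.comp_id]

end

section

variable {G : Type} [CommGroup G] [Finite G]

lemma coord_mul {d : ℕ} (x y : Fin d → ℂ[G]) : coord (x * y) = coord x * coord y :=
  funext fun p => map_mul (charExt p.1) _ _

lemma ofCoord_mul {d : ℕ} (y t : (G →* ℂˣ) × Fin d → ℂ) :
    ofCoord (y * t) = ofCoord y * ofCoord t :=
  coord_injective (by rw [coord_mul, coord_ofCoord, coord_ofCoord, coord_ofCoord])

/-- The element of `ℂ[G]^d` with a single nonzero coordinate. -/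
def coordVec {d : ℕ} (p : (G →* ℂˣ) × Fin d) : Fin d → ℂ[G] := Pi.single p.2 (cidem p.1)

lemma diagEnd_ofCoord {d : ℕ} (y : (G →* ℂˣ) × Fin d → ℂ) :
    diagEnd (ofCoord y) = ∑ p, y p • diagEnd (coordVec (G := G) p) := by
  have h1 : ofCoord y = ∑ p, y p • coordVec (G := G) p := by
    funext i
    rw [Finset.sum_apply, Fintype.sum_prod_type, ofCoord]
    refine Finset.sum_congr rfl fun χ _ => ?_
    rw [Finset.sum_eq_single i]
    · simp [coordVec]
    · intro j _ hj
      simp [coordVec, Pi.single_eq_of_ne (Ne.symm hj)]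
    · intro h
      exact absurd (Finset.mem_univ i) h
  let L : (Fin d → ℂ[G]) →ₗ[ℂ] (freeRep G d ⟶ freeRep G d) :=
    { toFun := diagEnd
      map_add' := fun x y => flin_ext fun (v : Fin d → ℂ[G]) => mul_add v x y
      map_smul' := fun c x => flin_ext fun (v : Fin d → ℂ[G]) => mul_smul_comm c v x }
  change L (ofCoord y) = ∑ p, y p • L (coordVec (G := G) p)
  rw [h1, map_sum]
  exact Finset.sum_congr rfl fun p _ => map_smul L _ _

/-- The coordinates `χ(x_i)`, as a linear equivalence. -/
def coordEquiv (G : Type) [CommGroup G] [Finite G] (d : ℕ) :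
    (Fin d → ℂ[G]) ≃ₗ[ℂ] ((G →* ℂˣ) × Fin d → ℂ) where
  toFun := coord
  map_add' _ _ := funext fun p => map_add (charExt p.1) _ _
  map_smul' _ _ := funext fun p => map_smul (charExt p.1) _ _
  invFun := ofCoord
  left_inv := ofCoord_coord
  right_inv := coord_ofCoord

/-- The linear map underlying `permEnd`. -/
def permLin {d : ℕ} (τ : (G →* ℂˣ) → Equiv.Perm (Fin d)) :
    (Fin d → ℂ[G]) →ₗ[ℂ] (Fin d → ℂ[G]) :=
  (coordEquiv G d).symm.toLinearMap ∘ₗ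
    LinearMap.funLeft ℂ ℂ (fun p => (p.1, τ p.1 p.2)) ∘ₗ (coordEquiv G d).toLinearMap

lemma coord_permLin {d : ℕ} (τ : (G →* ℂˣ) → Equiv.Perm (Fin d)) (v : Fin d → ℂ[G])
    (p : (G →* ℂˣ) × Fin d) : coord (permLin τ v) p = coord v (p.1, τ p.1 p.2) :=
  charExt_ofCoord _ _ _

lemma permLin_mul {d : ℕ} (τ : (G →* ℂˣ) → Equiv.Perm (Fin d)) (a : ℂ[G]) (v : Fin d → ℂ[G]) :
    permLin τ ((fun _ => a) * v) = (fun _ => a) * permLin τ v := by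
  have h : ∀ p : (G →* ℂˣ) × Fin d, coord (fun _ : Fin d => a) p = charExt p.1 a := fun _ => rfl
  refine coord_injective (funext fun p => ?_)
  rw [coord_permLin, coord_mul, coord_mul, Pi.mul_apply, Pi.mul_apply, coord_permLin, h, h]

/-- The automorphism of `ℂ[G]^d` that permutes the coordinates, separately for each character. -/
def permEnd {d : ℕ} (τ : (G →* ℂˣ) → Equiv.Perm (Fin d)) : freeRep G d ⟶ freeRep G d :=
  fmk (V := freeRep G d) (W := freeRep G d) (permLin τ) fun g (v : Fin d → ℂ[G]) =>
    permLin_mul τ (MonoidAlgebra.single g 1) v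

lemma coord_permEnd {d : ℕ} (τ : (G →* ℂˣ) → Equiv.Perm (Fin d)) (v : Fin d → ℂ[G])
    (p : (G →* ℂˣ) × Fin d) :
    coord (flin (permEnd τ) v : Fin d → ℂ[G]) p = coord v (p.1, τ p.1 p.2) :=
  coord_permLin τ v p

lemma permEnd_comp_inv {d : ℕ} (τ σ : (G →* ℂˣ) → Equiv.Perm (Fin d))
    (h : ∀ χ j, τ χ (σ χ j) = j) : permEnd τ ≫ permEnd σ = 𝟙 (freeRep G d) := by
  refine flin_ext fun (v : Fin d → ℂ[G]) => coord_injective (funext fun p => ?_)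
  refine (coord_permEnd σ _ p).trans ((coord_permEnd τ v _).trans ?_)
  rw [h]
  rfl

/-- Permuting the coordinates separately for each character conjugates the diagonal endomorphism by
an automorphism of the representation `ℂ[G]^d`. -/
lemma polyChar_perm (F : PolyFun G) {d : ℕ} (τ : (G →* ℂˣ) → Equiv.Perm (Fin d))
    (y : (G →* ℂˣ) × Fin d → ℂ) :
    polyChar F d (ofCoord fun p => y (p.1, τ p.1 p.2)) = polyChar F d (ofCoord y) := by
  rw [polyChar_eq, polyChar_eq]
  symm
  refine trace_fm_conj F.obj (permEnd τ) (permEnd fun χ => (τ χ).symm)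
    (permEnd_comp_inv _ _ fun χ j => (τ χ).apply_symm_apply j) ?_
    (permEnd_comp_inv _ _ fun χ j => (τ χ).symm_apply_apply j)
  refine flin_ext fun (v : Fin d → ℂ[G]) => coord_injective (funext fun p => ?_)
  refine (coord_permEnd τ (v * ofCoord y) p).trans ?_
  refine Eq.trans ?_ (congrFun (coord_mul (flin (permEnd τ) v : Fin d → ℂ[G]) _) p).symm
  rw [coord_mul, Pi.mul_apply, Pi.mul_apply, coord_ofCoord, coord_ofCoord]
  exact congrArg (· * _) (coord_permEnd τ v p).symm

lemma classPoly_eq {R : Type} [CommRing R] [Algebra R ℂ] {d : ℕ}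
    (P : MvPolynomial ((G →* ℂˣ) × Fin d) R) (x : Fin d → ℂ[G]) :
    classPoly P x = MvPolynomial.eval (coord x) (MvPolynomial.map (algebraMap R ℂ) P) := by
  rw [MvPolynomial.eval_map]
  rfl

lemma exists_trace_polynomial {F : PolyFun G} {D : ℕ}
    (hD : ∀ (X Y : FDRep ℂ G) (s : ℕ) (f : Fin s → (X ⟶ Y)),
      (fun c : Fin s → ℂ => F.obj.map (∑ i, c i • f i)) ∈ polyMaps s D (F.obj.obj X ⟶ F.obj.obj Y))
    (d : ℕ) (ℓ : (F.obj.obj (freeRep G d) →ₗ[ℂ] F.obj.obj (freeRep G d)) →ₗ[ℂ] ℂ) :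
    ∃ P : MvPolynomial ((G →* ℂˣ) × Fin d) ℂ, P.totalDegree ≤ D ∧
      ∀ y, ℓ (fm F.obj (diagEnd (ofCoord y))) = MvPolynomial.eval y P := by
  let e := Fintype.equivFin ((G →* ℂˣ) × Fin d)
  let L : (F.obj.obj (freeRep G d) ⟶ F.obj.obj (freeRep G d)) →ₗ[ℂ]
      (F.obj.obj (freeRep G d) →ₗ[ℂ] F.obj.obj (freeRep G d)) :=
    { toFun := fun t => t.hom.hom
      map_add' := fun _ _ => rfl
      map_smul' := fun _ _ => rfl }
  obtain ⟨P, hP, h⟩ := polyMaps_functional (ℓ ∘ₗ L)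
    (hD _ _ _ fun i => diagEnd (coordVec (G := G) (e.symm i)))
  refine ⟨MvPolynomial.rename e.symm P, (MvPolynomial.totalDegree_rename_le _ _).trans hP,
    fun y => ?_⟩
  rw [MvPolynomial.eval_rename, ← h, diagEnd_ofCoord]
  refine congrArg (fun f => ℓ (fm F.obj f)) ?_
  exact (Equiv.sum_comp e.symm fun p => y p • diagEnd (coordVec (G := G) p)).symm

/-- The character of a polynomial functor is a symmetric polynomial class function with integer
coefficients. -/
lemma polyChar_mem (F : PolyFun G) : polyChar F ∈ symClassFun G ℤ := by
  obtain ⟨D, hD⟩ := F.property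
  refine ⟨⟨D, fun d => ?_⟩, polyChar_snoc F⟩
  let b := Module.finBasis ℂ (F.obj.obj (freeRep G d))
  choose Q hQ hQ' using fun i j => exists_trace_polynomial hD d
    ((Matrix.entryLinearMap ℂ ℂ i j) ∘ₗ (LinearMap.toMatrix b b).toLinearMap)
  have hmap : ∀ y, (Matrix.of Q).map (MvPolynomial.eval y) =
      LinearMap.toMatrix b b (fm F.obj (diagEnd (ofCoord y))) := by
    intro y
    ext i j
    exact (hQ' i j y).symm
  have htr : ∀ y, polyChar F d (ofCoord y) = MvPolynomial.eval y (Matrix.of Q).trace := by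
    intro y
    rw [polyChar_eq, LinearMap.trace_eq_matrix_trace ℂ b, ← hmap, Matrix.trace, Matrix.trace,
      map_sum]
    rfl
  obtain ⟨P, hP⟩ := exists_int_polynomial (Matrix.of Q).trace (fun m => by
    obtain ⟨z, hz⟩ := coeff_trace_natCast (Matrix.of Q) (fun y t => by
      rw [hmap, hmap, hmap, ← LinearMap.toMatrix_comp, ← fm_comp, diagEnd_comp, ofCoord_mul,
        mul_comm]) m
    exact ⟨z, by rw [hz]; simp⟩)
  have hinj : Function.Injective (algebraMap ℤ ℂ) := (algebraMap ℤ ℂ).injective_int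
  refine ⟨P, ?_, fun τ => ?_, fun x => ?_⟩
  · rw [← totalDegree_of_map hinj, hP, Matrix.trace]
    exact MvPolynomial.totalDegree_finsetSum_le fun i _ => hQ i i
  · refine MvPolynomial.map_injective _ hinj (MvPolynomial.funext fun y => ?_)
    rw [MvPolynomial.map_rename, MvPolynomial.eval_rename, hP, ← htr, ← htr]
    exact polyChar_perm F τ y
  · rw [classPoly_eq, hP, ← htr, ofCoord_coord]

end

/-! ### The character of `Ξ(E)` is the Frobenius characteristic -/

section

/-- The trace on coinvariants is the average of the traces over the group. -/
lemma trace_coinvariants {W V : Type} [Group W] [Fintype W] [AddCommGroup V] [Module ℂ V]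
    [Module.Finite ℂ V] (ρ : Representation ℂ W V) (L : V →ₗ[ℂ] V)
    (L' : ρ.Coinvariants →ₗ[ℂ] ρ.Coinvariants)
    (h : L' ∘ₗ Representation.Coinvariants.mk ρ = Representation.Coinvariants.mk ρ ∘ₗ L) :
    LinearMap.trace ℂ _ L' =
      (Nat.card W : ℂ)⁻¹ * ∑ w : W, LinearMap.trace ℂ V (ρ w ∘ₗ L) := by
  have : Module.Finite ℂ ρ.Coinvariants := Module.Finite.of_surjective
    (Representation.Coinvariants.mk ρ) (Representation.Coinvariants.mk_surjective ρ)
  have hW : (Nat.card W : ℂ) ≠ 0 := by exact_mod_cast Nat.card_pos.ne'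
  let e : V →ₗ[ℂ] V := (Nat.card W : ℂ)⁻¹ • ∑ w : W, ρ w
  let s : ρ.Coinvariants →ₗ[ℂ] V := Representation.Coinvariants.lift ρ e (by
    intro u
    refine LinearMap.ext fun x => ?_
    simp only [e, LinearMap.comp_apply, LinearMap.smul_apply, LinearMap.sum_apply]
    refine congrArg _ (Fintype.sum_equiv (Equiv.mulRight u) _ _ fun w => ?_)
    rw [Equiv.coe_mulRight, map_mul]
    rfl)
  have hs : s ∘ₗ Representation.Coinvariants.mk ρ = e := LinearMap.ext fun x => rfl
  have hm : Representation.Coinvariants.mk ρ ∘ₗ e = Representation.Coinvariants.mk ρ := by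
    refine LinearMap.ext fun x => ?_
    simp only [e, LinearMap.comp_apply, LinearMap.smul_apply, LinearMap.sum_apply, map_smul,
      map_sum, Representation.Coinvariants.mk_self_apply]
    rw [Finset.sum_const, Finset.card_univ, ← Nat.card_eq_fintype_card,
      ← Nat.cast_smul_eq_nsmul ℂ, smul_smul, inv_mul_cancel₀ hW, one_smul]
  have hms : Representation.Coinvariants.mk ρ ∘ₗ s = LinearMap.id := by
    apply Representation.Coinvariants.hom_ext
    rw [LinearMap.comp_assoc, hs, hm]
    rfl
  rw [← LinearMap.comp_id L', ← hms, ← LinearMap.comp_assoc, h, LinearMap.comp_assoc,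
    LinearMap.trace_comp_comm', LinearMap.comp_assoc, hs, LinearMap.trace_comp_comm']
  have he : e ∘ₗ L = (Nat.card W : ℂ)⁻¹ • ∑ w : W, ρ w ∘ₗ L := by
    refine LinearMap.ext fun x => ?_
    simp [e]
  rw [he, map_smul, map_sum, smul_eq_mul]

lemma trace_lmap {A : ℕ → Type} [∀ n, AddCommGroup (A n)] [∀ n, Module ℂ (A n)]
    [∀ n, Module.Finite ℂ (A n)] [Module.Finite ℂ (⨁ n, A n)] (f : ∀ n, A n →ₗ[ℂ] A n) {N : ℕ}
    (hN : ∀ n, N ≤ n → Subsingleton (A n)) :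
    LinearMap.trace ℂ (⨁ n, A n) (DirectSum.lmap f) =
      ∑ n ∈ Finset.range N, LinearMap.trace ℂ (A n) (f n) := by
  have h1 : DirectSum.lmap f = ∑ n ∈ Finset.range N,
      DirectSum.lof ℂ ℕ A n ∘ₗ f n ∘ₗ DirectSum.component ℂ ℕ A n := by
    apply DirectSum.linearMap_ext
    intro m
    refine LinearMap.ext fun x => ?_
    rw [LinearMap.comp_apply, LinearMap.comp_apply, DirectSum.lmap_lof, LinearMap.sum_apply]
    simp only [LinearMap.comp_apply]
    by_cases hm : N ≤ m
    · have := hN m hm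
      obtain rfl : x = 0 := Subsingleton.elim _ _
      simp
    · rw [Finset.sum_eq_single m]
      · rw [DirectSum.component.lof_self]
      · intro n _ hn
        rw [DirectSum.component.of, dif_neg hn.symm, map_zero, map_zero]
      · intro h
        exact absurd (Finset.mem_range.2 (not_le.1 hm)) h
  rw [h1, map_sum]
  refine Finset.sum_congr rfl fun n _ => ?_
  rw [LinearMap.trace_comp_comm', LinearMap.comp_assoc]
  congr 1
  refine LinearMap.ext fun x => ?_
  rw [LinearMap.comp_apply, LinearMap.comp_apply, DirectSum.component.lof_self]

open Classical in
/-- The trace of an endomorphism that permutes the lines of a basis. -/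
lemma trace_monomial {V ι : Type*} [AddCommGroup V] [Module ℂ V] [Fintype ι]
    (b : Module.Basis ι ℂ V) (f : V →ₗ[ℂ] V) (σ : ι → ι) (c : ι → ℂ)
    (h : ∀ i, f (b i) = c i • b (σ i)) :
    LinearMap.trace ℂ V f = ∑ i, if σ i = i then c i else 0 := by
  rw [LinearMap.trace_eq_matrix_trace ℂ b, Matrix.trace]
  refine Finset.sum_congr rfl fun i _ => ?_
  rw [Matrix.diag_apply, LinearMap.toMatrix_apply, h, map_smul, Module.Basis.repr_self,
    Finsupp.smul_apply, Finsupp.single_apply]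
  simp

variable {G : Type} [CommGroup G] [Finite G]

/-- The basis of `ℂ[G]^d` of common eigenvectors of `G` and of the diagonal endomorphisms. -/
def eigenBasis (G : Type) [CommGroup G] [Finite G] (d : ℕ) :
    Module.Basis ((G →* ℂˣ) × Fin d) ℂ (Fin d → ℂ[G]) :=
  Module.Basis.ofEquivFun (coordEquiv G d)

lemma coordVec_mul {d : ℕ} (p : (G →* ℂˣ) × Fin d) (x : Fin d → ℂ[G]) :
    x * coordVec p = coord x p • coordVec p := by
  funext i
  by_cases hi : i = p.2
  · subst hi
    simp only [coordVec, Pi.mul_apply, Pi.smul_apply, Pi.single_eq_same]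
    exact mul_cidem _ _
  · simp [coordVec, Pi.single_eq_of_ne hi]

lemma eigenBasis_apply {d : ℕ} (p : (G →* ℂˣ) × Fin d) : eigenBasis G d p = coordVec p := by
  classical
  apply (coordEquiv G d).injective
  rw [eigenBasis, Module.Basis.coe_ofEquivFun, LinearEquiv.apply_symm_apply]
  funext q
  change _ = charExt q.1 ((Pi.single p.2 (cidem p.1) : Fin d → ℂ[G]) q.2)
  by_cases h2 : q.2 = p.2
  · rw [h2, Pi.single_eq_same, charExt_cidem]
    by_cases h1 : q.1 = p.1
    · rw [if_pos h1, Prod.ext h1 h2, Pi.single_eq_same]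
    · rw [if_neg h1, Pi.single_eq_of_ne fun h => h1 (congrArg Prod.fst h)]
  · rw [Pi.single_eq_of_ne h2, map_zero, Pi.single_eq_of_ne fun h => h2 (congrArg Prod.snd h)]

open Classical in
/-- The trace of `w ∈ G ≀ S_n` composed with `diag(x)^{⊗ n}`, in the basis of tensors of
eigenvectors. -/
lemma trace_tensorPow {n d : ℕ} (w : Wr G n) (x : Fin d → ℂ[G]) :
    LinearMap.trace ℂ (TPow n (freeRep G d)) (tensorPowRep n (freeRep G d).ρ w ∘ₗ
      PiTensorProduct.map fun _ => flin (diagEnd x)) =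
    ∑ h : Fin n → (G →* ℂˣ) × Fin d, if h ∘ w.right.symm = h then
      ∏ i, (((h i).1 (w.left i) : ℂˣ) : ℂ) * coord x (h i) else 0 := by
  let b : Module.Basis ((G →* ℂˣ) × Fin d) ℂ (freeRep G d) := eigenBasis G d
  have hb : ∀ p, b p = (coordVec p : Fin d → ℂ[G]) := eigenBasis_apply
  refine (trace_monomial (Basis.piTensorProduct fun _ : Fin n => b) _
    (fun h => h ∘ w.right.symm) (fun h => ∏ i, (((h (w.right.symm i)).1 (w.left i) : ℂˣ) : ℂ) *
      coord x (h (w.right.symm i))) fun h => ?_).trans ?_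
  · rw [Basis.piTensorProduct_apply, Basis.piTensorProduct_apply, LinearMap.comp_apply,
      PiTensorProduct.map_tprod, tensorPowRep_tprod]
    rw [← MultilinearMap.map_smul_univ]
    refine congrArg _ (funext fun i => ?_)
    rw [hb, Function.comp_apply, hb]
    have h1 : flin (diagEnd x) (coordVec (h (w.right.symm i)) : Fin d → ℂ[G]) =
        (coord x (h (w.right.symm i)) • coordVec (h (w.right.symm i)) : Fin d → ℂ[G]) :=
      (mul_comm _ x).trans (coordVec_mul _ x)
    refine (congrArg ((freeRep G d).ρ (w.left i)) h1).trans ?_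
    refine (map_smul ((freeRep G d).ρ (w.left i)) _ _).trans ?_
    refine Eq.trans (congrArg (coord x (h (w.right.symm i)) • ·) ?_)
      ((smul_smul _ _ _).trans (congrArg (· • _) (mul_comm _ _)))
    refine (coordVec_mul (h (w.right.symm i))
      (fun _ => MonoidAlgebra.single (w.left i) (1 : ℂ))).trans ?_
    rw [coord, charExt_single, one_mul]
    rfl
  · refine Finset.sum_congr rfl fun h _ => ?_
    split_ifs with hh
    · refine Finset.prod_congr rfl fun i _ => ?_
      rw [show h (w.right.symm i) = h i from congrFun hh i]
    · rfl

lemma powerSum_eq (r : ℕ) (c : G) (d : ℕ) (x : Fin d → ℂ[G]) :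
    powerSum r c d x = ∑ p : (G →* ℂˣ) × Fin d, ((p.1 c : ℂˣ) : ℂ) * coord x p ^ r := by
  rw [powerSum, Fintype.sum_prod_type_right]
  refine Finset.sum_congr rfl fun i _ => ?_
  rw [finsum_eq_sum_of_fintype]
  rfl

open Classical in
/-- Expanding the product over the cycles gives a sum over the maps that are constant on the cycles
of the permutation. -/
lemma cyclePowerSum_eq {n d : ℕ} (w : Wr G n) (x : Fin d → ℂ[G]) :
    cyclePowerSum w d x = ∑ h : Fin n → (G →* ℂˣ) × Fin d, if h ∘ w.right.symm = h then
      ∏ i, (((h i).1 (w.left i) : ℂˣ) : ℂ) * coord x (h i) else 0 := by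
  have h1 : ∀ q : Quotient (Equiv.Perm.SameCycle.setoid w.right),
      powerSum (Nat.card {i // cycleOf w.right i = q})
        (∏ᶠ i : {i // cycleOf w.right i = q}, w.left i) d x =
      ∑ p : (G →* ℂˣ) × Fin d, ∏ i : {i // cycleOf w.right i = q},
        ((p.1 (w.left i) : ℂˣ) : ℂ) * coord x p := by
    intro q
    rw [powerSum_eq]
    refine Finset.sum_congr rfl fun p _ => ?_
    rw [finprod_eq_prod_of_fintype, Finset.prod_mul_distrib, Finset.prod_const, Finset.card_univ,
      Nat.card_eq_fintype_card, map_prod, Units.coe_prod]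
  rw [cyclePowerSum, finprod_eq_prod_of_fintype]
  simp only [h1]
  rw [Finset.prod_univ_sum, Fintype.piFinset_univ, ← Finset.sum_filter]
  refine Finset.sum_bij (fun k _ => fun i => k (cycleOf w.right i)) ?_ ?_ ?_ ?_
  · intro k _
    refine Finset.mem_filter.2 ⟨Finset.mem_univ _, funext fun i => congrArg k ?_⟩
    exact Quotient.sound ⟨1, by simp⟩
  · intro k _ k' _ h
    funext q
    obtain ⟨i, rfl⟩ := Quotient.exists_rep q
    exact congrFun h i
  · intro h hh
    have hh' : ∀ i, h (w.right i) = h i := fun i => by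
      have := congrFun (Finset.mem_filter.1 hh).2 (w.right i)
      simpa using this.symm
    have hz : ∀ (z : ℤ) i, h ((w.right ^ z) i) = h i := by
      have hn : ∀ (k : ℕ) i, h ((w.right ^ k) i) = h i := by
        intro k
        induction k with
        | zero => exact fun i => rfl
        | succ k ih => exact fun i => by rw [pow_succ', Equiv.Perm.mul_apply, hh', ih]
      intro z i
      obtain ⟨k, rfl | rfl⟩ := z.eq_nat_or_neg
      · rw [zpow_natCast, hn]
      · have := hn k ((w.right ^ (-(k : ℤ))) i)
        rw [← this, ← Equiv.Perm.mul_apply, zpow_neg, zpow_natCast, mul_inv_cancel,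
          Equiv.Perm.one_apply]
    refine ⟨Quotient.lift h fun i j hij => ?_, Finset.mem_univ _, rfl⟩
    obtain ⟨z, hz'⟩ := hij
    rw [← hz', hz]
  · intro k _
    refine Eq.trans ?_ (Fintype.prod_fiberwise (cycleOf w.right) fun i =>
      (((k (cycleOf w.right i)).1 (w.left i) : ℂˣ) : ℂ) * coord x (k (cycleOf w.right i)))
    refine Finset.prod_congr rfl fun q _ => Finset.prod_congr rfl fun i _ => ?_
    rw [i.2]

lemma frob_eq_sum {E : WreathRep G} {N : ℕ} (hN : ∀ n, N ≤ n → Subsingleton (E.deg n)) (d : ℕ)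
    (x : Fin d → ℂ[G]) : frob E d x = ∑ n ∈ Finset.range N, (Nat.card (Wr G n) : ℂ)⁻¹ *
      ∑ᶠ w : Wr G n, (E.deg n).character w * cyclePowerSum w d x := by
  rw [frob]
  refine finsum_eq_sum_of_support_subset _ fun n hn => ?_
  by_contra h
  refine hn ?_
  have := hN n (by simpa using h)
  have h0 : ∀ w, (E.deg n).character w = 0 := by
    intro w
    have : (E.deg n).ρ w = 0 := Subsingleton.elim _ _
    rw [FDRep.character, this, map_zero]
  simp [h0]

/-- The character of `Ξ(E)` is a sum of traces on coinvariants, hence an average of traces on `E_n ⊗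
(ℂ[G]^d)^{⊗ n}`. -/
lemma polyChar_xi (E : WreathRep G) : polyChar ((Xi G).obj E) = frob E := by
  obtain ⟨N, hN⟩ := E.property
  have hN' : ∀ (V : FDRep ℂ G) n, N ≤ n → Subsingleton (XiDeg E V n) := by
    intro V n hn
    have := hN n hn
    have h : Subsingleton (E.deg n ⊗[ℂ] TPow n V) := by
      refine subsingleton_of_forall_eq 0 fun t => ?_
      induction t with
      | zero => rfl
      | tmul x y => rw [Subsingleton.elim x 0, TensorProduct.zero_tmul]
      | add a b ha hb => rw [ha, hb, add_zero]
    exact (Representation.Coinvariants.mk_surjective (xiRep E V n)).subsingleton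
  funext d x
  rw [frob_eq_sum hN]
  refine (trace_lmap (fun n => xiLin (𝟙 E) (diagEnd x) n) (hN' (freeRep G d))).trans ?_
  refine Finset.sum_congr rfl fun n _ => ?_
  let := Fintype.ofFinite (Wr G n)
  rw [trace_coinvariants (xiRep E (freeRep G d) n) (TensorProduct.map (lin (𝟙 E) n)
    (PiTensorProduct.map fun _ => flin (diagEnd x))) _ rfl, finsum_eq_sum_of_fintype]
  refine congrArg _ (Finset.sum_congr rfl fun w _ => ?_)
  rw [cyclePowerSum_eq, ← trace_tensorPow, FDRep.character]
  refine Eq.trans ?_ (LinearMap.trace_tensorProduct' _ _)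
  refine congrArg _ ?_
  rw [Representation.tprod_apply, ← TensorProduct.map_comp]
  rfl

end

/-! ### Representations of a finite group are determined by their characters -/

section

variable {W A B C : Type} [Group W] [Finite W] [AddCommGroup A] [Module ℂ A] [AddCommGroup B]
  [Module ℂ B] [AddCommGroup C] [Module ℂ C]

/-- A short exact sequence of representations of a finite group splits. -/
lemma exists_equiv_prod {ρA : Representation ℂ W A} {ρB : Representation ℂ W B}
    {ρC : Representation ℂ W C} {i : A →ₗ[ℂ] B} {p : B →ₗ[ℂ] C} (hi : Function.Injective i)
    (hip : Function.Exact i p) (hp : Function.Surjective p)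
    (hi' : ∀ g x, i (ρA g x) = ρB g (i x)) (hp' : ∀ g x, p (ρB g x) = ρC g (p x)) :
    ∃ e : B ≃ₗ[ℂ] A × C, ∀ g x, e (ρB g x) = (ρA g (e x).1, ρC g (e x).2) := by
  let := Fintype.ofFinite W
  have hW : (Nat.card W : ℂ) ≠ 0 := by exact_mod_cast Nat.card_pos.ne'
  obtain ⟨r₀, hr₀⟩ := LinearMap.exists_leftInverse_of_injective i (LinearMap.ker_eq_bot.2 hi)
  -- average the linear retraction over the group
  let r : B →ₗ[ℂ] A := (Nat.card W : ℂ)⁻¹ • ∑ g : W, ρA g ∘ₗ r₀ ∘ₗ ρB g⁻¹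
  have hr : ∀ x, r (i x) = x := by
    intro x
    have h : ∀ g : W, ρA g (r₀ (ρB g⁻¹ (i x))) = x := by
      intro g
      rw [← hi']
      have h1 : r₀ (i (ρA g⁻¹ x)) = ρA g⁻¹ x := LinearMap.congr_fun hr₀ _
      rw [h1, ← Module.End.mul_apply, ← map_mul, mul_inv_cancel, map_one, Module.End.one_apply]
    simp only [r, LinearMap.smul_apply, LinearMap.sum_apply, LinearMap.comp_apply, h]
    rw [Finset.sum_const, Finset.card_univ, ← Nat.card_eq_fintype_card,
      ← Nat.cast_smul_eq_nsmul ℂ, smul_smul, inv_mul_cancel₀ hW, one_smul]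
  have hr' : ∀ g x, r (ρB g x) = ρA g (r x) := by
    intro g x
    simp only [r, LinearMap.smul_apply, LinearMap.sum_apply, LinearMap.comp_apply, map_smul,
      map_sum]
    refine congrArg _ (Fintype.sum_equiv (Equiv.mulLeft g⁻¹) _ _ fun h => ?_)
    have h1 : ∀ z, ρA g (ρA (g⁻¹ * h) z) = ρA h z := fun z => by
      rw [← Module.End.mul_apply, ← map_mul, mul_inv_cancel_left]
    have h2 : ρB h⁻¹ (ρB g x) = ρB (g⁻¹ * h)⁻¹ x := by
      rw [← Module.End.mul_apply, ← map_mul, mul_inv_rev, inv_inv]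
    rw [Equiv.coe_mulLeft, h1, h2]
  refine ⟨LinearEquiv.ofBijective (r.prod p) ⟨?_, ?_⟩, fun g x => Prod.ext (hr' g x) (hp' g x)⟩
  · refine (injective_iff_map_eq_zero _).2 fun x hx => ?_
    obtain ⟨y, rfl⟩ := (hip x).1 (congrArg Prod.snd hx)
    have h1 : r (i y) = 0 := congrArg Prod.fst hx
    rw [hr] at h1
    rw [h1, map_zero]
  · rintro ⟨a, c⟩
    obtain ⟨y, rfl⟩ := hp c
    refine ⟨i a + (y - i (r y)), Prod.ext ?_ ?_⟩
    · change r _ = a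
      rw [map_add, map_sub, hr, hr, sub_self, add_zero]
    · change p _ = p y
      rw [map_add, map_sub, hip.apply_apply_eq_zero, hip.apply_apply_eq_zero, zero_add, sub_zero]

/-- The representation on an invariant subspace. -/
def subRep (ρ : Representation ℂ W B) (P : Submodule ℂ B) (h : ∀ g, ∀ x ∈ P, ρ g x ∈ P) :
    Representation ℂ W P where
  toFun g := (ρ g).restrict (h g)
  map_one' := LinearMap.ext fun x => Subtype.ext (by
    change ρ 1 x = x
    rw [map_one, Module.End.one_apply])
  map_mul' g k := LinearMap.ext fun x => Subtype.ext (by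
    change ρ (g * k) x = ρ g (ρ k x)
    rw [map_mul, Module.End.mul_apply])

/-- The representation on the quotient by an invariant subspace. -/
def quotRep (ρ : Representation ℂ W B) (P : Submodule ℂ B) (h : ∀ g, ∀ x ∈ P, ρ g x ∈ P) :
    Representation ℂ W (B ⧸ P) where
  toFun g := P.mapQ P (ρ g) (h g)
  map_one' := Submodule.linearMap_qext _ (LinearMap.ext fun x => by
    change Submodule.Quotient.mk (ρ 1 x) = Submodule.Quotient.mk x
    rw [map_one, Module.End.one_apply])
  map_mul' g k := Submodule.linearMap_qext _ (LinearMap.ext fun x => by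
    change Submodule.Quotient.mk (ρ (g * k) x) = Submodule.Quotient.mk (ρ g (ρ k x))
    rw [map_mul, Module.End.mul_apply])

/-- Two representations with the same character are isomorphic. If the first one is nonzero, then
there is a nonzero equivariant map between them, because the characters compute the dimensions of
spaces of equivariant maps; its kernel and its cokernel have the same character. -/
lemma exists_equiv_of_character : ∀ (k : ℕ) (A B : Type) [AddCommGroup A] [Module ℂ A]
    [AddCommGroup B] [Module ℂ B] [Module.Finite ℂ A] [Module.Finite ℂ B]
    (ρ : Representation ℂ W A) (σ : Representation ℂ W B), Module.finrank ℂ A = k →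
    ρ.character = σ.character → ∃ e : A ≃ₗ[ℂ] B, ∀ g x, e (ρ g x) = σ g (e x) := by
  let := Fintype.ofFinite W
  have hW : (Nat.card W : ℂ) ≠ 0 := by exact_mod_cast Nat.card_pos.ne'
  let : Invertible (Nat.card W : ℂ) := invertibleOfNonzero hW
  intro k
  induction k using Nat.strong_induction_on with
  | _ k ih =>
    intro A B _ _ _ _ _ _ ρ σ hk hχ
    have hd : Module.finrank ℂ A = Module.finrank ℂ B := by
      have := congrFun hχ 1
      rw [Representation.char_one, Representation.char_one] at this
      exact_mod_cast this
    by_cases hA : Module.finrank ℂ A = 0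
    · have hA' := Module.finrank_zero_iff.1 hA
      have hB' := Module.finrank_zero_iff.1 (hd.symm.trans hA)
      exact ⟨LinearEquiv.ofFinrankEq A B hd, fun g x => Subsingleton.elim _ _⟩
    have hid : Module.finrank ℂ (Representation.IntertwiningMap ρ ρ) =
        Module.finrank ℂ (Representation.IntertwiningMap ρ σ) := by
      have h1 := Representation.card_inv_mul_sum_char_mul_char_eq_finrank ρ ρ
      have h2 := Representation.card_inv_mul_sum_char_mul_char_eq_finrank ρ σ
      rw [← hχ] at h2
      exact_mod_cast h1.symm.trans h2
    have hne : ∃ f : Representation.IntertwiningMap ρ σ, f ≠ 0 := by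
      by_contra hc
      push Not at hc
      have : Subsingleton (Representation.IntertwiningMap ρ σ) := ⟨fun x y => by rw [hc x, hc y]⟩
      rw [Module.finrank_zero_of_subsingleton (M := Representation.IntertwiningMap ρ σ)] at hid
      have hfin : Module.Finite ℂ (Representation.IntertwiningMap ρ ρ) :=
        Module.Finite.of_injective
          ({ toFun := fun f => f.toLinearMap
             map_add' := fun _ _ => rfl
             map_smul' := fun _ _ => rfl } :
            Representation.IntertwiningMap ρ ρ →ₗ[ℂ] (A →ₗ[ℂ] A))
          fun f g h => Representation.IntertwiningMap.ext h
      have hs := Module.finrank_zero_iff.1 hid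
      refine hA (Module.finrank_zero_iff.2 ⟨fun x y => ?_⟩)
      have h0 := congrArg Representation.IntertwiningMap.toLinearMap
        (hs.elim (Representation.IntertwiningMap.id ρ) 0)
      exact (LinearMap.congr_fun h0 x).trans (LinearMap.congr_fun h0 y).symm
    obtain ⟨f, hf⟩ := hne
    have hfg : ∀ g x, f.toLinearMap (ρ g x) = σ g (f.toLinearMap x) := fun g x =>
      LinearMap.congr_fun (f.isIntertwining' g) x
    have hf0 : f.toLinearMap ≠ 0 := by
      intro h
      exact hf (Representation.IntertwiningMap.ext h)
    set φ := f.toLinearMap with hφ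
    have hK : ∀ g, ∀ x ∈ LinearMap.ker φ, ρ g x ∈ LinearMap.ker φ := by
      intro g x hx
      rw [LinearMap.mem_ker] at hx ⊢
      rw [hfg, hx, map_zero]
    have hI : ∀ g, ∀ x ∈ LinearMap.range φ, σ g x ∈ LinearMap.range φ := by
      rintro g _ ⟨x, rfl⟩
      exact ⟨ρ g x, hfg g x⟩
    let ρK := subRep ρ _ hK
    let σI := subRep σ _ hI
    let σQ := quotRep σ _ hI
    have e₁ := exists_equiv_prod (ρA := ρK) (ρB := ρ) (ρC := σI) (i := (LinearMap.ker φ).subtype)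
      (p := φ.rangeRestrict) (Submodule.injective_subtype _) (by
        intro x
        rw [← LinearMap.mem_ker, LinearMap.ker_rangeRestrict]
        exact ⟨fun h => ⟨⟨x, h⟩, rfl⟩, fun ⟨y, hy⟩ => hy ▸ y.2⟩) φ.surjective_rangeRestrict
        (fun g x => rfl) (fun g x => Subtype.ext (hfg g x))
    have e₂ := exists_equiv_prod (ρA := σI) (ρB := σ) (ρC := σQ) (i := (LinearMap.range φ).subtype)
      (p := (LinearMap.range φ).mkQ) (Submodule.injective_subtype _) (by
        intro x
        rw [Submodule.mkQ_apply, Submodule.Quotient.mk_eq_zero]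
        exact ⟨fun h => ⟨⟨x, h⟩, rfl⟩, fun ⟨y, hy⟩ => hy ▸ y.2⟩) (Submodule.mkQ_surjective _)
        (fun g x => rfl) (fun g x => rfl)
    have hch : ρK.character = σQ.character := by
      funext g
      have h1 := trace_exact (i := (LinearMap.ker φ).subtype) (p := φ.rangeRestrict)
        (a := ρK g) (b := ρ g) (c := σI g) (Submodule.injective_subtype _) (by
        intro x
        rw [← LinearMap.mem_ker, LinearMap.ker_rangeRestrict]
        exact ⟨fun h => ⟨⟨x, h⟩, rfl⟩, fun ⟨y, hy⟩ => hy ▸ y.2⟩) φ.surjective_rangeRestrict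
        (LinearMap.ext fun x => rfl) (LinearMap.ext fun x => Subtype.ext (hfg g x))
      have h2 := trace_exact (i := (LinearMap.range φ).subtype) (p := (LinearMap.range φ).mkQ)
        (a := σI g) (b := σ g) (c := σQ g) (Submodule.injective_subtype _) (by
        intro x
        rw [Submodule.mkQ_apply, Submodule.Quotient.mk_eq_zero]
        exact ⟨fun h => ⟨⟨x, h⟩, rfl⟩, fun ⟨y, hy⟩ => hy ▸ y.2⟩) (Submodule.mkQ_surjective _)
        (LinearMap.ext fun x => rfl) (LinearMap.ext fun x => rfl)
      have h3 := congrFun hχ g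
      rw [Representation.character, Representation.character, h1, h2, add_comm] at h3
      exact add_left_cancel h3
    have hlt : Module.finrank ℂ (LinearMap.ker φ) < k := by
      rw [← hk]
      exact Submodule.finrank_lt fun h => hf0 (LinearMap.ker_eq_top.1 h)
    obtain ⟨e₃, he₃⟩ := ih _ hlt (LinearMap.ker φ) (B ⧸ LinearMap.range φ) ρK σQ rfl hch
    obtain ⟨e₁, he₁⟩ := e₁
    obtain ⟨e₂, he₂⟩ := e₂
    refine ⟨(e₁.trans ((LinearEquiv.prodComm ℂ _ _).trans ((LinearEquiv.refl ℂ _).prodCongr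
      e₃))).trans e₂.symm, fun g x => ?_⟩
    apply e₂.injective
    rw [he₂]
    simp only [LinearEquiv.trans_apply, LinearEquiv.apply_symm_apply]
    rw [he₁]
    exact Prod.ext rfl (he₃ g _)

end

/-! ### Endomorphisms of finite order of `ℂ[G]^n` are diagonalizable -/

section

/-- An endomorphism of finite order is diagonalizable. -/
lemma exists_diagonalization {n M : ℕ} (hM : M ≠ 0) (A : Module.End ℂ (Fin n → ℂ))
    (hA : A ^ M = 1) : ∃ (e : (Fin n → ℂ) ≃ₗ[ℂ] (Fin n → ℂ)) (μ : Fin n → ℂ),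
      ∀ y i, e (A y) i = μ i * e y i := by
  have hss : A.IsSemisimple := by
    refine Module.End.isSemisimple_of_squarefree_aeval_eq_zero
      (p := (Polynomial.X ^ M - 1 : Polynomial ℂ))
      (Polynomial.X_pow_sub_one_separable_iff.2 (by exact_mod_cast hM)).squarefree ?_
    rw [map_sub, map_pow, Polynomial.aeval_X, hA, map_one, sub_self]
  have htop := hss.iSup_eigenspace_eq_top
  have hspan : ⊤ ≤ Submodule.span ℂ {v | ∃ μ : ℂ, A v = μ • v} := by
    rw [← htop]
    exact iSup_le fun μ v hv => Submodule.subset_span ⟨μ, Module.End.mem_eigenspace_iff.1 hv⟩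
  let b := Module.Basis.ofSpan hspan
  have hb : ∀ i, ∃ μ : ℂ, A (b i) = μ • b i := fun i =>
    Module.Basis.ofSpan_subset hspan ⟨i, rfl⟩
  have := Module.Finite.finite_basis b
  let := Fintype.ofFinite ((linearIndepOn_empty ℂ id).extend
    (Set.empty_subset {v | ∃ μ : ℂ, A v = μ • v}))
  have hcard := (Module.finrank_eq_card_basis b).symm.trans (Module.finrank_fin_fun ℂ)
  let b' := b.reindex (Fintype.equivFinOfCardEq hcard)
  have hb' : ∀ i, ∃ μ : ℂ, A (b' i) = μ • b' i := fun i => by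
    rw [Module.Basis.reindex_apply]
    exact hb _
  choose μ hμ using hb'
  refine ⟨b'.equivFun, μ, fun y i => ?_⟩
  let L₁ : (Fin n → ℂ) →ₗ[ℂ] ℂ := LinearMap.proj i ∘ₗ b'.equivFun.toLinearMap ∘ₗ A
  let L₂ : (Fin n → ℂ) →ₗ[ℂ] ℂ := μ i • (LinearMap.proj i ∘ₗ b'.equivFun.toLinearMap)
  have hL : L₁ = L₂ := b'.ext fun j => by
    change b'.equivFun (A (b' j)) i = μ i * b'.equivFun (b' j) i
    rw [hμ, map_smul, Pi.smul_apply, smul_eq_mul, Module.Basis.equivFun_self]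
    split_ifs with h
    · rw [h]
    · rw [mul_zero, mul_zero]
  exact LinearMap.congr_fun hL y

variable {G : Type} [CommGroup G] [Finite G]

/-- The linear map underlying an endomorphism of `ℂ[G]^n`. -/
def freeLin {n : ℕ} (f : freeRep G n ⟶ freeRep G n) : (Fin n → ℂ[G]) →ₗ[ℂ] (Fin n → ℂ[G]) :=
  flin f

lemma freeLin_ext {n : ℕ} {f g : freeRep G n ⟶ freeRep G n}
    (h : ∀ v, freeLin f v = freeLin g v) : f = g := flin_ext h

lemma freeLin_comp {n : ℕ} (f g : freeRep G n ⟶ freeRep G n) (v : Fin n → ℂ[G]) :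
    freeLin (f ≫ g) v = freeLin g (freeLin f v) := rfl

lemma freeLin_diagEnd {n : ℕ} (x v : Fin n → ℂ[G]) : freeLin (diagEnd x) v = v * x := rfl

/-- The `χ`-isotypic component of an element of `ℂ[G]^n`. -/
def coordAt {n : ℕ} (χ : G →* ℂˣ) : (Fin n → ℂ[G]) →ₗ[ℂ] (Fin n → ℂ) where
  toFun v i := coord v (χ, i)
  map_add' _ _ := funext fun _ => map_add (charExt χ) _ _
  map_smul' _ _ := funext fun _ => map_smul (charExt χ) _ _

/-- The inclusion of the `χ`-isotypic component of `ℂ[G]^n`. -/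
def coordIn {n : ℕ} (χ : G →* ℂˣ) : (Fin n → ℂ) →ₗ[ℂ] (Fin n → ℂ[G]) where
  toFun y i := y i • cidem χ
  map_add' y z := funext fun i => add_smul (y i) (z i) _
  map_smul' c y := funext fun i => mul_smul c (y i) _

lemma coordAt_coordIn [DecidableEq (G →* ℂˣ)] {n : ℕ} (χ ψ : G →* ℂˣ) (y : Fin n → ℂ) :
    coordAt χ (coordIn ψ y) = if χ = ψ then y else 0 := by
  funext i
  have h : coordAt χ (coordIn ψ y) i = y i * charExt χ (cidem ψ) := map_smul (charExt χ) (y i) _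
  rw [h, charExt_cidem]
  split_ifs
  · rw [mul_one]
  · rw [mul_zero, Pi.zero_apply]

lemma coordAt_coordIn_self {n : ℕ} (χ : G →* ℂˣ) (y : Fin n → ℂ) :
    coordAt χ (coordIn χ y) = y := by
  classical
  rw [coordAt_coordIn, if_pos rfl]

lemma coordIn_coordAt {n : ℕ} (χ : G →* ℂˣ) (v : Fin n → ℂ[G]) :
    coordIn χ (coordAt χ v) = (fun _ => cidem χ) * v := by
  funext i
  rw [Pi.mul_apply, mul_comm, mul_cidem]
  rfl

lemma coordAt_mul {n : ℕ} (χ : G →* ℂˣ) (a : ℂ[G]) (v : Fin n → ℂ[G]) :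
    coordAt χ ((fun _ => a) * v) = charExt χ a • coordAt χ v :=
  funext fun _ => map_mul (charExt χ) _ _

lemma coordAt_ext {n : ℕ} {v w : Fin n → ℂ[G]}
    (h : ∀ χ : G →* ℂˣ, coordAt χ v = coordAt χ w) : v = w :=
  coord_injective (funext fun p => congrFun (h p.1) p.2)

lemma coordIn_mul {n : ℕ} (χ : G →* ℂˣ) (a : ℂ[G]) (y : Fin n → ℂ) :
    (fun _ => a) * coordIn χ y = charExt χ a • coordIn χ y := by
  funext i
  have h : a * (y i • cidem χ) = charExt χ a • (y i • cidem χ) := by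
    rw [mul_smul_comm, mul_cidem, smul_comm]
  exact h

/-- The linear map underlying `blockEnd`. -/
def blockLin {n : ℕ} (A : (G →* ℂˣ) → Module.End ℂ (Fin n → ℂ)) :
    (Fin n → ℂ[G]) →ₗ[ℂ] (Fin n → ℂ[G]) :=
  ∑ χ, coordIn χ ∘ₗ A χ ∘ₗ coordAt χ

lemma blockLin_mul {n : ℕ} (A : (G →* ℂˣ) → Module.End ℂ (Fin n → ℂ)) (a : ℂ[G])
    (v : Fin n → ℂ[G]) : blockLin A ((fun _ => a) * v) = (fun _ => a) * blockLin A v := by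
  rw [blockLin, LinearMap.sum_apply, LinearMap.sum_apply, Finset.mul_sum]
  refine Finset.sum_congr rfl fun χ _ => ?_
  rw [LinearMap.comp_apply, LinearMap.comp_apply, coordAt_mul, map_smul, map_smul,
    LinearMap.comp_apply, LinearMap.comp_apply, coordIn_mul]

/-- The endomorphism of `ℂ[G]^n` with given matrices on the isotypic components. -/
def blockEnd {n : ℕ} (A : (G →* ℂˣ) → Module.End ℂ (Fin n → ℂ)) : freeRep G n ⟶ freeRep G n :=
  fmk (V := freeRep G n) (W := freeRep G n) (blockLin A)
    fun g (v : Fin n → ℂ[G]) => blockLin_mul A (MonoidAlgebra.single g 1) v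

lemma coordAt_blockEnd {n : ℕ} (A : (G →* ℂˣ) → Module.End ℂ (Fin n → ℂ)) (χ : G →* ℂˣ)
    (v : Fin n → ℂ[G]) : coordAt χ (freeLin (blockEnd A) v) = A χ (coordAt χ v) := by
  classical
  change coordAt χ (blockLin A v) = _
  rw [blockLin, LinearMap.sum_apply, map_sum]
  simp only [LinearMap.comp_apply, coordAt_coordIn]
  simp

/-- The matrix of an endomorphism of `ℂ[G]^n` on an isotypic component. -/
def blockOf {n : ℕ} (f : freeRep G n ⟶ freeRep G n) (χ : G →* ℂˣ) : Module.End ℂ (Fin n → ℂ) :=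
  coordAt χ ∘ₗ freeLin f ∘ₗ coordIn χ

/-- Endomorphisms of the representation `ℂ[G]^n` commute with the group algebra. -/
lemma freeLin_mul {n : ℕ} (f : freeRep G n ⟶ freeRep G n) (a : ℂ[G]) (v : Fin n → ℂ[G]) :
    freeLin f ((fun _ => a) * v) = (fun _ => a) * freeLin f v := by
  let m (a : ℂ[G]) (v : Fin n → ℂ[G]) : Fin n → ℂ[G] := (fun _ => a) * v
  change freeLin f (m a v) = m a (freeLin f v)
  induction a using MonoidAlgebra.induction_linear with
  | zero =>
    have h : ∀ v, m 0 v = 0 := fun v => funext fun i => zero_mul (v i)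
    rw [h, h, map_zero]
  | add a b ha hb =>
    have h : ∀ v, m (a + b) v = m a v + m b v := fun v => funext fun i => add_mul a b (v i)
    rw [h, h, map_add, ha, hb]
  | single g c =>
    have h : ∀ v, m (MonoidAlgebra.single g c) v = c • ((freeRep G n).ρ g v : Fin n → ℂ[G]) :=
      fun v => funext fun i => by
        change MonoidAlgebra.single g c * v i = c • (MonoidAlgebra.single g 1 * v i)
        rw [← smul_mul_assoc, MonoidAlgebra.smul_single, smul_eq_mul, mul_one]
    rw [h, h]
    refine ((freeLin f).map_smul c (show Fin n → ℂ[G] from (freeRep G n).ρ g v)).trans ?_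
    exact congrArg (c • ·) (flin_rho f g v)

lemma coordAt_freeLin {n : ℕ} (f : freeRep G n ⟶ freeRep G n) (χ : G →* ℂˣ) (v : Fin n → ℂ[G]) :
    coordAt χ (freeLin f v) = blockOf f χ (coordAt χ v) := by
  classical
  rw [blockOf, LinearMap.comp_apply, LinearMap.comp_apply, coordIn_coordAt, freeLin_mul,
    coordAt_mul, charExt_cidem, if_pos rfl, one_smul]

lemma blockOf_comp {n : ℕ} (f g : freeRep G n ⟶ freeRep G n) (χ : G →* ℂˣ) :
    blockOf (f ≫ g) χ = blockOf g χ * blockOf f χ :=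
  LinearMap.ext fun y => by
    rw [Module.End.mul_apply, blockOf.eq_def f, LinearMap.comp_apply, LinearMap.comp_apply,
      ← coordAt_freeLin]
    rfl

lemma blockOf_id {n : ℕ} (χ : G →* ℂˣ) : blockOf (𝟙 (freeRep G n)) χ = 1 :=
  LinearMap.ext fun y => coordAt_coordIn_self χ y

/-- The value of a functor on an endomorphism of finite order of `ℂ[G]^n` has the same trace as its
value on a diagonal endomorphism. -/
lemma exists_trace_eq {n M : ℕ} (hM : M ≠ 0) (f : End (freeRep G n)) (hf : f ^ M = 1) :
    ∃ x : Fin n → ℂ[G], ∀ F : FDRep ℂ G ⥤ FGModuleCat ℂ,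
      LinearMap.trace ℂ (F.obj (freeRep G n)) (fm F f) =
        LinearMap.trace ℂ (F.obj (freeRep G n)) (fm F (diagEnd x)) := by
  have hpow : ∀ (χ : G →* ℂˣ) (k : ℕ), blockOf (f ^ k : End (freeRep G n)) χ = blockOf f χ ^ k := by
    intro χ k
    induction k with
    | zero => exact blockOf_id χ
    | succ k ih =>
      rw [pow_succ, End.mul_def, blockOf_comp, ih, pow_succ]
  choose e μ he using fun χ : G →* ℂˣ => exists_diagonalization hM (blockOf f χ) (by
    rw [← hpow, hf]
    exact blockOf_id χ)
  refine ⟨ofCoord fun p => μ p.1 p.2, fun F => ?_⟩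
  refine trace_fm_conj F (blockEnd fun χ => (e χ).toLinearMap)
    (blockEnd fun χ => (e χ).symm.toLinearMap) ?_ ?_ ?_
  · refine freeLin_ext fun v => coordAt_ext fun χ => ?_
    rw [freeLin_comp, coordAt_blockEnd, coordAt_blockEnd]
    exact (e χ).symm_apply_apply _
  · refine freeLin_ext fun v => coordAt_ext fun χ => ?_
    rw [freeLin_comp, freeLin_comp, coordAt_blockEnd, coordAt_freeLin, freeLin_diagEnd]
    funext i
    refine (he χ _ i).trans ?_
    have h := congrFun (coord_mul (freeLin (blockEnd fun χ => (e χ).toLinearMap) v)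
      (ofCoord fun p => μ p.1 p.2)) (χ, i)
    refine Eq.trans ?_ h.symm
    rw [Pi.mul_apply, coord_ofCoord, mul_comm]
    exact congrArg (· * _) (congrFun (coordAt_blockEnd (fun χ => (e χ).toLinearMap) χ v) i).symm
  · refine freeLin_ext fun v => coordAt_ext fun χ => ?_
    rw [freeLin_comp, coordAt_blockEnd, coordAt_blockEnd]
    exact (e χ).apply_symm_apply _

end

/-! ### A polynomial functor is determined by its character -/

section

variable {G : Type} [Group G] [Finite G]

lemma tdiag_mul {n : ℕ} (s t : Fin n → ℂ) : tdiag G (s * t) = tdiag G s ≫ tdiag G t := by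
  rw [tdiag.eq_def (G := G) t, tdiag_comp_rowMap, tdiag]
  refine congrArg rowMap (funext fun j => ?_)
  rw [Pi.mul_apply, mul_smul]

lemma tdiag_one (n : ℕ) : tdiag G (1 : Fin n → ℂ) = 𝟙 (freeRep G n) := by
  rw [tdiag, ← rowMap_stdv_eq_id]
  exact congrArg rowMap (funext fun j => one_smul _ _)

lemma tdiag_pow {n : ℕ} (s : Fin n → ℂ) (k : ℕ) :
    (show End (freeRep G n) from tdiag G s) ^ k = tdiag G (s ^ k) := by
  induction k with
  | zero => exact (tdiag_one n).symm
  | succ k ih => rw [pow_succ, ih, End.mul_def, ← tdiag_mul, pow_succ']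

/-- Monomial matrices whose coefficients are roots of unity have finite order. -/
lemma exists_pow_eq_one {n N : ℕ} (hN : N ≠ 0) (w : Wr G n) (t : Fin n → ℂ) (ht : t ^ N = 1) :
    ∃ M : ℕ, M ≠ 0 ∧ (show End (freeRep G n) from tdiag G t ≫ wrMap w) ^ M = 1 := by
  have h : ∀ k : ℕ, ∃ s : Fin n → ℂ, s ^ N = 1 ∧
      (show End (freeRep G n) from tdiag G t ≫ wrMap w) ^ k = tdiag G s ≫ wrMap (w ^ k) := by
    intro k
    induction k with
    | zero =>
      refine ⟨1, one_pow N, ?_⟩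
      rw [tdiag_one, pow_zero, pow_zero, wrMap_one, Category.id_comp]
      rfl
    | succ k ih =>
      obtain ⟨s, hs, h⟩ := ih
      refine ⟨t * fun i => s (w.right i), ?_, ?_⟩
      · rw [mul_pow, ht, one_mul]
        exact funext fun i => congrFun hs (w.right i)
      · rw [pow_succ, h, End.mul_def, tdiag_mul, pow_succ, wrMap_mul, Category.assoc,
          Category.assoc, ← Category.assoc (wrMap w), wrMap_tdiag, Category.assoc]
  obtain ⟨s, hs, h⟩ := h (Nat.card (Wr G n))
  refine ⟨Nat.card (Wr G n) * N, mul_ne_zero Nat.card_pos.ne' hN, ?_⟩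
  rw [pow_mul, h, pow_card_eq_one', wrMap_one, Category.comp_id, tdiag_pow, hs, tdiag_one]
  rfl

/-- The trace of `w ∈ G ≀ S_n` on the multilinear part is a coefficient of the trace of a monomial
matrix. -/
lemma trace_wtRep {F : FDRep ℂ G ⥤ FGModuleCat ℂ} {d N n : ℕ} (hN : d + 2 ≤ N)
    (hF : ∀ V W : FDRep ℂ G, IsPolyLaw d (fun f : V ⟶ W => fm F f)) (w : Wr G n) :
    LinearMap.trace ℂ (wt F n) (wtRep F n w) = mlCoeff N n fun c =>
      LinearMap.trace ℂ (F.obj (freeRep G n)) (fm F (tdiag G c ≫ wrMap w)) := by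
  have h1 : ∀ x, (fm F (wrMap w) ∘ₗ wtProj F N n) x ∈ wt F n := fun x =>
    wrMap_mem w (wtProj_mem hN hF x)
  have h2 := LinearMap.trace_restrict_eq_of_forall_mem (wt F n) _ h1
  have h3 : wtRep F n w = (fm F (wrMap w) ∘ₗ wtProj F N n).restrict (fun x _ => h1 x) := by
    refine LinearMap.ext fun x => Subtype.ext ?_
    change fm F (wrMap w) x = fm F (wrMap w) (wtProj F N n x)
    rw [wtProj_of_mem (by omega) x.2]
  rw [h3, h2]
  let L : (F.obj (freeRep G n) →ₗ[ℂ] F.obj (freeRep G n)) →ₗ[ℂ] ℂ :=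
    LinearMap.trace ℂ _ ∘ₗ LinearMap.compRight ℂ (fm F (wrMap w))
  change L (wtProj F N n) = _
  rw [wtProj, pol]
  refine (mlCoeff_map N n L fun c => fm F (∑ j, c j • cproj G j)).symm.trans ?_
  refine congrArg (mlCoeff N n) (funext fun c => ?_)
  have h4 : ∑ j, c j • cproj G j = tdiag G c := by
    simp only [cproj_eq]
    rw [sum_smul_rowAt, rowMap_stdv_eq_id, Category.comp_id]
  rw [h4, fm_comp]
  rfl

end

section

variable {G : Type} [CommGroup G] [Finite G]

/-- Equal characters give equal traces on the multilinear parts, since monomial matrices whose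
entries are roots of unity times group elements are conjugate to diagonal endomorphisms. -/
lemma character_wtFam_eq {F H : PolyFun G} (h : polyChar F = polyChar H) (n : ℕ) :
    ((wtFam F).deg n).character = ((wtFam H).deg n).character := by
  funext w
  obtain ⟨d, hd⟩ := F.property.exists_degree
  obtain ⟨d', hd'⟩ := H.property.exists_degree
  change LinearMap.trace ℂ (wt F.obj n) (wtRep F.obj n w) =
    LinearMap.trace ℂ (wt H.obj n) (wtRep H.obj n w)
  rw [trace_wtRep (N := d + d' + 2) (by omega) hd, trace_wtRep (N := d + d' + 2) (by omega) hd']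
  rw [mlCoeff, mlCoeff]
  refine congrArg _ (Finset.sum_congr rfl fun k _ => congrArg _ ?_)
  have hp := Complex.isPrimitiveRoot_exp (d + d' + 2) (by omega)
  obtain ⟨M, hM, hM'⟩ := exists_pow_eq_one (N := d + d' + 2) (by omega) w
    (fun j => Complex.exp (2 * Real.pi * Complex.I / ((d + d' + 2 : ℕ) : ℂ)) ^ (k j : ℕ))
    (funext fun j => by
      rw [Pi.pow_apply, ← pow_mul, mul_comm (k j : ℕ), pow_mul, hp.pow_eq_one, one_pow,
        Pi.one_apply])
  obtain ⟨x, hx⟩ := exists_trace_eq hM _ hM'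
  exact (hx F.obj).trans ((congrFun (congrFun h n) x).trans (hx H.obj).symm)

/-- Two families with the same characters are isomorphic. -/
lemma nonempty_iso_of_character {E E' : WreathRep G}
    (h : ∀ n, (E.deg n).character = (E'.deg n).character) : Nonempty (E ≅ E') := by
  choose e he using fun n => exists_equiv_of_character _ (E.deg n) (E'.deg n) (E.deg n).ρ
    (E'.deg n).ρ rfl (h n)
  exact ⟨{ hom := mkHom (fun n => (e n).toLinearMap) fun n w x => he n w x
           inv := mkHom (fun n => (e n).symm.toLinearMap) fun n w x => by
             refine (e n).symm_apply_eq.2 ?_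
             refine Eq.trans ?_ (he n w _).symm
             exact congrArg _ ((e n).apply_symm_apply x).symm
           hom_inv_id := lin_ext fun n x => (e n).symm_apply_apply x
           inv_hom_id := lin_ext fun n x => (e n).apply_symm_apply x }⟩

lemma nonempty_iso_of_polyChar {F H : PolyFun G} (h : polyChar F = polyChar H) :
    Nonempty (F ≅ H) := by
  obtain ⟨e⟩ := nonempty_iso_of_character (character_wtFam_eq h)
  exact ⟨(thetaIso F).symm ≪≫ (Xi G).mapIso e ≪≫ thetaIso H⟩

lemma nonempty_iso_of_frob {E E' : WreathRep G} (h : frob E = frob E') : Nonempty (E ≅ E') := by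
  rw [← polyChar_xi, ← polyChar_xi] at h
  obtain ⟨e⟩ := nonempty_iso_of_polyChar h
  exact ⟨(Xi G).preimageIso e⟩

end

/-! ### The Grothendieck groups and the characteristic maps -/

section

variable {𝒞 : Type*} {ses : 𝒞 → 𝒞 → 𝒞 → Prop}

lemma K0.mk_eq_add {A B C : 𝒞} (h : ses A B C) :
    (K0.mk B : K0 𝒞 ses) = K0.mk A + K0.mk C := by
  refine eq_of_sub_eq_zero ((QuotientAddGroup.eq_zero_iff _).2 (AddSubgroup.subset_closure ?_))
  exact ⟨A, B, C, h, rfl⟩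

/-- The homomorphism from the Grothendieck group given by an additive invariant. -/
def K0.lift {M : Type*} [AddCommGroup M] (φ : 𝒞 → M)
    (h : ∀ A B C, ses A B C → φ B = φ A + φ C) : K0 𝒞 ses →+ M :=
  QuotientAddGroup.lift _ (FreeAbelianGroup.lift φ) (by
    rw [AddSubgroup.closure_le]
    rintro _ ⟨A, B, C, hABC, rfl⟩
    rw [SetLike.mem_coe, AddMonoidHom.mem_ker, map_sub, map_add, FreeAbelianGroup.lift_apply_of,
      FreeAbelianGroup.lift_apply_of, FreeAbelianGroup.lift_apply_of, h A B C hABC, sub_self])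

lemma K0.lift_mk {M : Type*} [AddCommGroup M] (φ : 𝒞 → M)
    (h : ∀ A B C, ses A B C → φ B = φ A + φ C) (A : 𝒞) : K0.lift φ h (K0.mk A) = φ A :=
  FreeAbelianGroup.lift_apply_of φ A

/-- If classes of objects are closed under addition, every element is a difference of two classes.
-/
lemma K0.exists_eq_sub [Nonempty 𝒞]
    (hsum : ∀ A B : 𝒞, ∃ C : 𝒞, (K0.mk C : K0 𝒞 ses) = K0.mk A + K0.mk B) (x : K0 𝒞 ses) :
    ∃ A B : 𝒞, x = K0.mk A - K0.mk B := by
  obtain ⟨y, rfl⟩ := QuotientAddGroup.mk_surjective x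
  obtain ⟨Z⟩ := ‹Nonempty 𝒞›
  induction y using FreeAbelianGroup.induction_on with
  | zero => exact ⟨Z, Z, (sub_self _).symm⟩
  | of A =>
    obtain ⟨C, hC⟩ := hsum A Z
    exact ⟨C, Z, by rw [hC, add_sub_cancel_right]; rfl⟩
  | neg A _ =>
    obtain ⟨C, hC⟩ := hsum A Z
    exact ⟨Z, C, by rw [hC, sub_add_cancel_right]; rfl⟩
  | add a b ha hb =>
    obtain ⟨A, B, h⟩ := ha
    obtain ⟨A', B', h'⟩ := hb
    obtain ⟨C, hC⟩ := hsum A A'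
    obtain ⟨C', hC'⟩ := hsum B B'
    refine ⟨C, C', ?_⟩
    rw [QuotientAddGroup.mk_add, h, h', hC, hC']
    exact sub_add_sub_comm _ _ _ _

lemma K0.lift_injective [Nonempty 𝒞] {M : Type*} [AddCommGroup M] {φ : 𝒞 → M}
    {h : ∀ A B C, ses A B C → φ B = φ A + φ C}
    (hsum : ∀ A B : 𝒞, ∃ C : 𝒞, (K0.mk C : K0 𝒞 ses) = K0.mk A + K0.mk B)
    (hφ : ∀ A B : 𝒞, φ A = φ B → (K0.mk A : K0 𝒞 ses) = K0.mk B) :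
    Function.Injective (K0.lift φ h) := by
  refine (injective_iff_map_eq_zero _).2 fun x hx => ?_
  obtain ⟨A, B, rfl⟩ := K0.exists_eq_sub hsum x
  rw [map_sub, K0.lift_mk, K0.lift_mk, sub_eq_zero] at hx
  rw [hφ A B hx, sub_self]

lemma exact_of_split {A B C : Type*} [AddCommGroup A] [Module ℂ A] [AddCommGroup B] [Module ℂ B]
    [AddCommGroup C] [Module ℂ C] {i : A →ₗ[ℂ] B} {r : B →ₗ[ℂ] A} {p : B →ₗ[ℂ] C} {s : C →ₗ[ℂ] B}
    (h₁ : ∀ x, r (i x) = x) (h₂ : ∀ x, p (s x) = x) (h₃ : ∀ x, i (r x) + s (p x) = x) :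
    Function.Injective i ∧ Function.Exact i p ∧ Function.Surjective p := by
  refine ⟨fun x y h => by rw [← h₁ x, h, h₁], fun x => ⟨fun h => ⟨r x, ?_⟩, ?_⟩,
    fun x => ⟨s x, h₂ x⟩⟩
  · have := h₃ x
    rwa [h, map_zero, add_zero] at this
  · rintro ⟨y, rfl⟩
    have h := h₃ (i y)
    rw [h₁, add_eq_left] at h
    rw [← h₂ (p (i y)), h, map_zero]

variable {G : Type} [Group G]

/-- The direct sum of two families of representations. -/
def wsum (E E' : WreathRep G) : WreathRep G where
  obj n := FDRep.of (Representation.prod (E.deg n).ρ (E'.deg n).ρ)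
  property := by
    obtain ⟨N, hN⟩ := E.property
    obtain ⟨M, hM⟩ := E'.property
    refine ⟨max N M, fun n hn => ?_⟩
    have h₁ := hN n ((le_max_left _ _).trans hn)
    have h₂ := hM n ((le_max_right _ _).trans hn)
    exact inferInstanceAs (Subsingleton (E.deg n × E'.deg n))

/-- The first inclusion. -/
def winl (E E' : WreathRep G) : E ⟶ wsum E E' :=
  mkHom (F := wsum E E') (fun n => LinearMap.inl ℂ (E.deg n) (E'.deg n)) fun n w _ =>
    Prod.ext rfl (map_zero ((E'.deg n).ρ w)).symm

/-- The second inclusion. -/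
def winr (E E' : WreathRep G) : E' ⟶ wsum E E' :=
  mkHom (F := wsum E E') (fun n => LinearMap.inr ℂ (E.deg n) (E'.deg n)) fun n w _ =>
    Prod.ext (map_zero ((E.deg n).ρ w)).symm rfl

/-- The first projection. -/
def wfst (E E' : WreathRep G) : wsum E E' ⟶ E :=
  mkHom (E := wsum E E') (fun n => LinearMap.fst ℂ (E.deg n) (E'.deg n)) fun _ _ _ => rfl

/-- The second projection. -/
def wsnd (E E' : WreathRep G) : wsum E E' ⟶ E' :=
  mkHom (E := wsum E E') (fun n => LinearMap.snd ℂ (E.deg n) (E'.deg n)) fun _ _ _ => rfl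

lemma wsum_decomp (E E' : WreathRep G) (n : ℕ) (x : (wsum E E').deg n) :
    lin (winl E E') n (lin (wfst E E') n x) + lin (winr E E') n (lin (wsnd E E') n x) = x :=
  Prod.ext (add_zero (lin (wfst E E') n x)) (zero_add (lin (wsnd E E') n x))

lemma wreathSES_wsum (E E' : WreathRep G) : wreathSES G E (wsum E E') E' :=
  ⟨winl E E', wsnd E E', fun n => exact_of_split (r := lin (wfst E E') n)
    (s := lin (winr E E') n) (fun _ => rfl) (fun _ => rfl) (wsum_decomp E E' n)⟩

lemma polySES_wsum [Finite G] (E E' : WreathRep G) :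
    polySES G ((Xi G).obj E) ((Xi G).obj (wsum E E')) ((Xi G).obj E') := by
  refine ⟨(Xi G).map (winl E E'), (Xi G).map (wsnd E E'), fun V => exact_of_split
    (r := plin ((Xi G).map (wfst E E')) V) (s := plin ((Xi G).map (winr E E')) V)
    (fun x => ?_) (fun x => ?_) fun x => ?_⟩
  · rw [← LinearMap.comp_apply, ← plin_comp, ← Functor.map_comp]
    have h : winl E E' ≫ wfst E E' = 𝟙 E := lin_ext fun n x => rfl
    rw [h, CategoryTheory.Functor.map_id]
    rfl
  · rw [← LinearMap.comp_apply, ← plin_comp, ← Functor.map_comp]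
    have h : winr E E' ≫ wsnd E E' = 𝟙 E' := lin_ext fun n x => rfl
    rw [h, CategoryTheory.Functor.map_id]
    rfl
  · refine LinearMap.congr_fun (f := xiHom (winl E E') (𝟙 V) ∘ₗ xiHom (wfst E E') (𝟙 V) +
      xiHom (winr E E') (𝟙 V) ∘ₗ xiHom (wsnd E E') (𝟙 V)) (g := LinearMap.id)
      (xi_hom_ext fun n x v => ?_) x
    rw [LinearMap.add_apply, LinearMap.comp_apply, LinearMap.comp_apply, xiHom_id_xg, xiHom_id_xg,
      xiHom_id_xg, xiHom_id_xg, ← xgMulti_apply, ← xgMulti_apply]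
    have h := congrArg (fun y => xg y v) (wsum_decomp E E' n x)
    refine Eq.trans ?_ h
    exact (LinearMap.map_add ((xiBil (wsum E E') V n).flip (PiTensorProduct.tprod ℂ v)) _ _).symm

lemma mk_wreath_eq_of_iso {E E' : WreathRep G} (e : E ≅ E') :
    (K0.mk E : K0Wreath G) = K0.mk E' := by
  have h : wreathSES G E' (wsum E E) E := by
    refine ⟨e.inv ≫ winl E E, wsnd E E, fun n => exact_of_split
      (r := lin (wfst E E ≫ e.hom) n) (s := lin (winr E E) n) (fun x => ?_) (fun _ => rfl)
      fun x => ?_⟩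
    · exact LinearMap.congr_fun (congrArg (fun f => lin f n) e.inv_hom_id) x
    · have h1 : lin e.inv n (lin e.hom n (lin (wfst E E) n x)) = lin (wfst E E) n x :=
        LinearMap.congr_fun (congrArg (fun f => lin f n) e.hom_inv_id) _
      refine Eq.trans ?_ (wsum_decomp E E n x)
      exact congrArg (fun y => lin (winl E E) n y + lin (winr E E) n (lin (wsnd E E) n x)) h1
  have h1 := K0.mk_eq_add (wreathSES_wsum E E)
  rw [K0.mk_eq_add h] at h1
  exact (add_right_cancel h1).symm

lemma mk_poly_eq_of_iso [Finite G] {F H : PolyFun G} (e : F ≅ H) :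
    (K0.mk F : K0Poly G) = K0.mk H := by
  -- both `F` and `H` are the kernel of the projection of `F ⊕ F` to `F`
  have key : ∀ H : PolyFun G, (F ≅ H) → (K0.mk ((Xi G).obj (wsum (wtFam F) (wtFam F))) : K0Poly G) =
      K0.mk H + K0.mk ((Xi G).obj (wtFam F)) := by
    intro H e
    refine K0.mk_eq_add ?_
    obtain ⟨f, g, h⟩ := polySES_wsum (wtFam F) (wtFam F)
    let u := (thetaIso F).trans e
    refine ⟨u.inv ≫ f, g, fun V => ?_⟩
    have hu : Function.Bijective (plin u.inv V) := by
      refine Function.bijective_iff_has_inverse.2 ⟨plin u.hom V, fun x => ?_, fun x => ?_⟩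
      · exact LinearMap.congr_fun (congrArg (fun f => plin f V) u.inv_hom_id) x
      · exact LinearMap.congr_fun (congrArg (fun f => plin f V) u.hom_inv_id) x
    refine ⟨(h V).1.comp hu.1, fun x => ?_, (h V).2.2⟩
    refine ((h V).2.1 x).trans ⟨?_, ?_⟩
    · rintro ⟨y, rfl⟩
      obtain ⟨z, rfl⟩ := hu.2 y
      exact ⟨z, rfl⟩
    · rintro ⟨y, rfl⟩
      exact ⟨plin u.inv V y, rfl⟩
  exact add_right_cancel ((key F (Iso.refl F)).symm.trans (key H e))

end

section

variable {G : Type} [CommGroup G] [Finite G]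

lemma character_wreathSES {A B C : WreathRep G} (h : wreathSES G A B C) (n : ℕ) :
    (B.deg n).character = (A.deg n).character + (C.deg n).character := by
  obtain ⟨f, g, hfg⟩ := h
  funext w
  exact trace_exact (hfg n).1 (hfg n).2.1 (hfg n).2.2 (LinearMap.ext fun x => lin_rho f n w x)
    (LinearMap.ext fun x => lin_rho g n w x)

/-- The characteristic is additive, because the sequence splits and `Ξ` preserves direct sums. -/
lemma frob_exact {A B C : WreathRep G} (h : wreathSES G A B C) : frob B = frob A + frob C := by
  obtain ⟨e⟩ := nonempty_iso_of_character (E := B) (E' := wsum A C) fun n =>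
    (character_wreathSES h n).trans (character_wreathSES (wreathSES_wsum A C) n).symm
  rw [← polyChar_xi, ← polyChar_xi, ← polyChar_xi, polyChar_iso ((Xi G).mapIso e)]
  exact polyChar_exact (polySES_wsum A C)

/-- The characteristic has integer coefficients because it is the character of `Ξ(E)`. -/
lemma frob_mem (E : WreathRep G) : frob E ∈ symClassFun G ℤ := polyChar_xi E ▸ polyChar_mem _

/-- The characteristic is multiplicative because `Ξ` is monoidal. -/
lemma frob_tensor (E F : WreathRep G) : frob (E ⊗ F) = frob E * frob F := by
  rw [← polyChar_xi, ← polyChar_xi, ← polyChar_xi, ← polyChar_tensor]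
  exact polyChar_iso (muIso E F).symm

lemma frob_unit : frob (𝟙_ (WreathRep G)) = 1 := by
  rw [← polyChar_xi, ← polyChar_unit]
  exact polyChar_iso (epsIso (G := G)).symm

variable (G)

/-- The characteristic map on the Grothendieck group of `⨁_n rep(G ≀ S_n)`. -/
def chHom : K0Wreath G →+ symClassFun G ℤ :=
  K0.lift (fun E => ⟨frob E, frob_mem E⟩) fun _ _ _ h => Subtype.ext (frob_exact h)

/-- The character, on the Grothendieck group of polynomial functors. -/
def chPoly : K0Poly G →+ symClassFun G ℤ :=
  K0.lift (fun F => ⟨polyChar F, polyChar_mem F⟩) fun _ _ _ h => Subtype.ext (polyChar_exact h)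

variable {G}

lemma chHom_mk (E : WreathRep G) : chHom G (K0.mk E) = ⟨frob E, frob_mem E⟩ := K0.lift_mk _ _ E

lemma chPoly_mk (F : PolyFun G) : chPoly G (K0.mk F) = ⟨polyChar F, polyChar_mem F⟩ :=
  K0.lift_mk _ _ F

lemma K0Wreath.exists_eq_sub (x : K0Wreath G) :
    ∃ E E' : WreathRep G, x = K0.mk E - K0.mk E' := by
  have : Nonempty (WreathRep G) := ⟨𝟙_ (WreathRep G)⟩
  exact K0.exists_eq_sub (fun A B => ⟨wsum A B, K0.mk_eq_add (wreathSES_wsum A B)⟩) x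

lemma chHom_injective : Function.Injective (chHom G) := by
  have : Nonempty (WreathRep G) := ⟨𝟙_ (WreathRep G)⟩
  refine K0.lift_injective (fun A B => ⟨wsum A B, K0.mk_eq_add (wreathSES_wsum A B)⟩)
    fun A B h => ?_
  obtain ⟨e⟩ := nonempty_iso_of_frob (congrArg Subtype.val h)
  exact mk_wreath_eq_of_iso e

lemma chPoly_injective : Function.Injective (chPoly G) := by
  have : Nonempty (PolyFun G) := ⟨𝟙_ (PolyFun G)⟩
  refine K0.lift_injective (fun A B => ⟨(Xi G).obj (wsum (wtFam A) (wtFam B)), ?_⟩) fun A B h => ?_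
  · rw [K0.mk_eq_add (polySES_wsum (wtFam A) (wtFam B)), mk_poly_eq_of_iso (thetaIso A),
      mk_poly_eq_of_iso (thetaIso B)]
  · obtain ⟨e⟩ := nonempty_iso_of_polyChar (congrArg Subtype.val h)
    exact mk_poly_eq_of_iso e

end

/-! ### Polynomials symmetric in several sets of variables -/

section

open MvPolynomial

/-- The elementary symmetric polynomial of degree `k` in the set of variables with index `i`. -/
def esymmAt (R : Type) [CommRing R] (d : ℕ) {ι : Type} (i : ι) (k : ℕ) :
    MvPolynomial (ι × Fin d) R :=
  rename (Prod.mk i) (esymm (Fin d) R k)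

/-- The permutation of each set of variables. -/
abbrev permVars (R : Type) [CommRing R] {d : ℕ} {ι : Type} (τ : ι → Equiv.Perm (Fin d)) :
    MvPolynomial (ι × Fin d) R →ₐ[R] MvPolynomial (ι × Fin d) R :=
  rename fun p => (p.1, τ p.1 p.2)

/-- The polynomials in one more set of variables as polynomials in this set with coefficients in
the other variables. -/
def splitOff (R : Type) [CommRing R] (d : ℕ) (ι : Type) :
    MvPolynomial (Option ι × Fin d) R →ₐ[R] MvPolynomial (Fin d) (MvPolynomial (ι × Fin d) R) :=
  aeval fun p => p.1.elim (X p.2) fun i => C (X (i, p.2))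

/-- The inverse of `splitOff`. -/
def splitOn (R : Type) [CommRing R] (d : ℕ) (ι : Type) :
    MvPolynomial (Fin d) (MvPolynomial (ι × Fin d) R) →+* MvPolynomial (Option ι × Fin d) R :=
  eval₂Hom (rename fun p : ι × Fin d => (some p.1, p.2)).toRingHom fun j => X (none, j)

lemma splitOn_splitOff (R : Type) [CommRing R] (d : ℕ) (ι : Type)
    (P : MvPolynomial (Option ι × Fin d) R) : splitOn R d ι (splitOff R d ι P) = P := by
  have h : (splitOn R d ι).comp (splitOff R d ι).toRingHom = RingHom.id _ := by
    refine ringHom_ext (fun r => ?_) fun p => ?_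
    · change splitOn R d ι (splitOff R d ι (C r)) = C r
      rw [splitOff, aeval_C, IsScalarTower.algebraMap_apply R (MvPolynomial (ι × Fin d) R)]
      change splitOn R d ι (C (C r)) = C r
      rw [splitOn, coe_eval₂Hom, eval₂_C]
      exact rename_C _ r
    · obtain ⟨i, j⟩ := p
      change splitOn R d ι (splitOff R d ι (X (i, j))) = X (i, j)
      rw [splitOff, aeval_X, splitOn, coe_eval₂Hom]
      cases i with
      | none => exact eval₂_X _ _ _
      | some i => exact (eval₂_C _ _ _).trans (rename_X _ _)
  exact RingHom.congr_fun h P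

lemma splitOff_permVars_none {R : Type} [CommRing R] {d : ℕ} {ι : Type} (σ : Equiv.Perm (Fin d))
    (P : MvPolynomial (Option ι × Fin d) R) :
    splitOff R d ι (permVars R (fun i => i.elim σ fun _ => 1) P) =
      rename σ (splitOff R d ι P) := by
  have h : (splitOff R d ι).comp (permVars R (fun i => i.elim σ fun _ => 1)) =
      AlgHom.comp (AlgHom.restrictScalars R
        (rename σ : MvPolynomial (Fin d) (MvPolynomial (ι × Fin d) R) →ₐ[_] _))
        (splitOff R d ι) := by
    refine algHom_ext fun p => ?_
    obtain ⟨i, j⟩ := p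
    change splitOff R d ι (rename _ (X (i, j))) = rename σ (splitOff R d ι (X (i, j)))
    rw [rename_X, splitOff, aeval_X, aeval_X]
    cases i with
    | none => exact (rename_X σ j).symm
    | some i => exact (rename_C σ (X (i, j) : MvPolynomial (ι × Fin d) R)).symm
  exact AlgHom.congr_fun h P

lemma splitOff_permVars_some {R : Type} [CommRing R] {d : ℕ} {ι : Type}
    (τ : ι → Equiv.Perm (Fin d)) (P : MvPolynomial (Option ι × Fin d) R) :
    splitOff R d ι (permVars R (fun i => i.elim 1 τ) P) =
      map (permVars R τ).toRingHom (splitOff R d ι P) := by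
  have h : (splitOff R d ι).toRingHom.comp (permVars R (fun i => i.elim 1 τ)).toRingHom =
      (map (permVars R τ).toRingHom).comp (splitOff R d ι).toRingHom := by
    refine ringHom_ext (fun r => ?_) fun p => ?_
    · change splitOff R d ι (rename _ (C r)) = map (permVars R τ).toRingHom (splitOff R d ι (C r))
      rw [rename_C, splitOff, aeval_C,
        IsScalarTower.algebraMap_apply R (MvPolynomial (ι × Fin d) R)]
      change C (C r) = map (permVars R τ).toRingHom (C (C r))
      rw [map_C]
      exact congrArg C (rename_C _ r).symm
    · obtain ⟨i, j⟩ := p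
      change splitOff R d ι (rename _ (X (i, j))) =
        map (permVars R τ).toRingHom (splitOff R d ι (X (i, j)))
      rw [rename_X, splitOff, aeval_X, aeval_X]
      cases i with
      | none => exact (map_X _ _).symm
      | some i =>
        refine Eq.trans ?_ (map_C _ _).symm
        exact congrArg C (rename_X (fun p : ι × Fin d => (p.1, τ p.1 p.2)) (i, j)).symm
  exact RingHom.congr_fun h P

/-- The fundamental theorem on symmetric polynomials for several sets of variables. One set of
variables is treated at a time; the coefficients of the expression in the elementary symmetric
polynomials are unique, hence symmetric in the other variables. -/
lemma mem_adjoin_esymmAt (ι : Type) [Finite ι] (R : Type) [CommRing R] (d : ℕ) :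
    ∀ P : MvPolynomial (ι × Fin d) R, (∀ τ, permVars R τ P = P) →
      P ∈ Algebra.adjoin R (Set.range fun p : ι × ℕ => esymmAt R d p.1 p.2) := by
  induction ι using Finite.induction_empty_option with
  | of_equiv e ih =>
    rename_i α β
    intro P hP
    have h1 := ih (rename (Prod.map e.symm id) P) fun τ => by
      rw [permVars, rename_rename]
      conv_rhs => rw [← hP fun b => τ (e.symm b), permVars, rename_rename]
      rfl
    have h2 : rename (Prod.map e id) (rename (Prod.map e.symm id) P) = P := by
      rw [rename_rename, Prod.map_comp_map, e.self_comp_symm, Function.id_comp, Prod.map_id]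
      exact rename_id_apply P
    rw [← h2]
    refine Algebra.adjoin_le (S := Subalgebra.comap (rename (Prod.map e id)) (Algebra.adjoin R
      (Set.range fun p : β × ℕ => esymmAt R d p.1 p.2))) ?_ h1
    rintro _ ⟨p, rfl⟩
    refine Algebra.subset_adjoin ⟨(e p.1, p.2), ?_⟩
    exact (rename_rename (Prod.mk p.1) (Prod.map e id) (esymm (Fin d) R p.2)).symm
  | h_empty =>
    intro P _
    rw [eq_C_of_isEmpty P]
    exact Subalgebra.algebraMap_mem _ _
  | h_option ih =>
    rename_i ι _
    intro P hP
    set P' := splitOff R d ι P with hP'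
    have hsym : P'.IsSymmetric := fun σ => by
      rw [hP', ← splitOff_permVars_none, hP]
    obtain ⟨Q, hQ⟩ := esymmAlgHom_surjective (R := MvPolynomial (ι × Fin d) R) (σ := Fin d)
      (n := d) (by simp) ⟨P', hsym⟩
    have hQ' : aeval (fun i : Fin d => esymm (Fin d) (MvPolynomial (ι × Fin d) R) (i + 1)) Q =
        P' := by
      rw [← esymmAlgHom_apply, hQ]
    have hcoeff : ∀ τ : ι → Equiv.Perm (Fin d), map (permVars R τ).toRingHom Q = Q := by
      intro τ
      refine esymmAlgHom_injective (σ := Fin d) (n := d) _ (by simp) (Subtype.ext ?_)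
      rw [esymmAlgHom_apply, esymmAlgHom_apply, hQ']
      have h1 : P' = map (permVars R τ).toRingHom P' := by
        rw [hP', ← splitOff_permVars_some, hP]
      rw [h1, ← hQ', map_aeval, coe_eval₂Hom, aeval_def, eval₂_map]
      congr 1
      · refine RingHom.ext fun r => ?_
        exact (MvPolynomial.map_C (permVars R τ).toRingHom r).symm
      · exact funext fun i => (MvPolynomial.map_esymm _ _ _ _).symm
    have hmem : ∀ m, coeff m Q ∈
        Algebra.adjoin R (Set.range fun p : ι × ℕ => esymmAt R d p.1 p.2) := fun m =>
      ih _ fun τ => by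
        conv_rhs => rw [← hcoeff τ, coeff_map]
        rfl
    rw [← splitOn_splitOff R d ι P, ← hP', ← hQ', aeval_def, eval₂_eq', map_sum]
    refine Subalgebra.sum_mem _ fun m _ => ?_
    rw [map_mul, map_prod]
    refine Subalgebra.mul_mem _ ?_ (Subalgebra.prod_mem _ fun i _ => ?_)
    · have h3 : splitOn R d ι (algebraMap _ _ (coeff m Q)) =
          rename (fun p : ι × Fin d => (some p.1, p.2)) (coeff m Q) := by
        rw [splitOn, coe_eval₂Hom]
        exact eval₂_C _ _ _
      rw [h3]
      refine Algebra.adjoin_le (S := Subalgebra.comap (rename fun p : ι × Fin d => (some p.1, p.2))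
        (Algebra.adjoin R (Set.range fun p : Option ι × ℕ => esymmAt R d p.1 p.2))) ?_ (hmem m)
      rintro _ ⟨p, rfl⟩
      refine Algebra.subset_adjoin ⟨(some p.1, p.2), ?_⟩
      exact (rename_rename (Prod.mk p.1) (fun p : ι × Fin d => (some p.1, p.2))
        (esymm (Fin d) R p.2)).symm
    · rw [map_pow]
      refine Subalgebra.pow_mem _ ?_ _
      refine Algebra.subset_adjoin (Set.mem_range.2 ⟨(none, (i : ℕ) + 1), ?_⟩)
      rw [esymmAt, esymm, esymm, map_sum, map_sum]
      refine Finset.sum_congr rfl fun t _ => ?_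
      rw [map_prod, map_prod]
      refine Finset.prod_congr rfl fun j _ => ?_
      rw [rename_X, splitOn, coe_eval₂Hom, eval₂_X]

end

/-! ### Elementary symmetric functions as characteristics -/

section

open MvPolynomial

/-- A sum over injective maps `Fin k → Fin d` counts every subset with `k` elements `k!` times. -/
lemma sum_injective_prod {d : ℕ} (k : ℕ) (y : Fin d → ℂ) :
    ∑ r : Fin k → Fin d, (if Function.Injective r then ∏ i, y (r i) else 0) =
      (k.factorial : ℂ) * ∑ s ∈ Finset.powersetCard k Finset.univ, ∏ j ∈ s, y j := by
  rw [← Finset.sum_filter, ← Finset.sum_fiberwise_of_maps_to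
    (g := fun r : Fin k → Fin d => Finset.univ.image r)
    (t := Finset.powersetCard k Finset.univ), Finset.mul_sum]
  · refine Finset.sum_congr rfl fun s hs => ?_
    have hsk := (Finset.mem_powersetCard.1 hs).2
    have h1 : ∀ r ∈ (Finset.univ.filter fun r : Fin k → Fin d => Function.Injective r).filter
        (fun r => Finset.univ.image r = s), ∏ i, y (r i) = ∏ j ∈ s, y j := by
      intro r hr
      rw [Finset.mem_filter, Finset.mem_filter] at hr
      rw [← hr.2, Finset.prod_image fun a _ b _ h => hr.1.2 h]
    rw [Finset.sum_congr rfl h1, Finset.sum_const, nsmul_eq_mul]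
    refine congrArg (fun m : ℕ => (m : ℂ) * _) ?_
    let e₀ : Fin k ≃ s := (s.equivFinOfCardEq hsk).symm
    have hc : k.factorial = (Finset.univ : Finset (Equiv.Perm (Fin k))).card := by
      rw [Finset.card_univ, Fintype.card_perm, Fintype.card_fin]
    rw [hc]
    symm
    refine Finset.card_bij (fun σ _ i => (e₀ (σ i) : Fin d)) (fun σ _ => ?_) (fun σ _ τ _ h => ?_)
      fun r hr => ?_
    · rw [Finset.mem_filter, Finset.mem_filter]
      refine ⟨⟨Finset.mem_univ _, fun a b h => σ.injective (e₀.injective (Subtype.ext h))⟩, ?_⟩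
      ext j
      rw [Finset.mem_image]
      refine ⟨fun ⟨i, _, h⟩ => h ▸ (e₀ (σ i)).2, fun hj => ⟨σ.symm (e₀.symm ⟨j, hj⟩),
        Finset.mem_univ _, ?_⟩⟩
      rw [Equiv.apply_symm_apply, Equiv.apply_symm_apply]
    · exact Equiv.ext fun i => e₀.injective (Subtype.ext (congrFun h i))
    · rw [Finset.mem_filter, Finset.mem_filter] at hr
      have hm : ∀ i, r i ∈ s := fun i => hr.2 ▸ Finset.mem_image_of_mem r (Finset.mem_univ i)
      have hinj : Function.Injective fun i => e₀.symm ⟨r i, hm i⟩ := fun a b h =>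
        hr.1.2 (congrArg Subtype.val (e₀.symm.injective h))
      refine ⟨Equiv.ofBijective _ (Finite.injective_iff_bijective.1 hinj), Finset.mem_univ _, ?_⟩
      funext i
      change (e₀ (e₀.symm ⟨r i, hm i⟩) : Fin d) = r i
      rw [Equiv.apply_symm_apply]
  · intro r hr
    rw [Finset.mem_powersetCard]
    refine ⟨Finset.subset_univ _, ?_⟩
    rw [Finset.card_image_of_injective _ (Finset.mem_filter.1 hr).2, Finset.card_univ,
      Fintype.card_fin]

/-- The sum of the signs over the stabilizer of a map vanishes unless the map is injective: a
transposition in the stabilizer pairs the terms. -/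
lemma sum_sign_stabilizer {k : ℕ} {T : Type*} [DecidableEq T] (h : Fin k → T) :
    ∑ π : Equiv.Perm (Fin k), (if h ∘ π.symm = h then ((Equiv.Perm.sign π : ℤ) : ℂ) else 0) =
      if Function.Injective h then 1 else 0 := by
  split_ifs with hh
  · rw [Finset.sum_eq_single 1]
    · have h1 : h ∘ (1 : Equiv.Perm (Fin k)).symm = h := rfl
      rw [if_pos h1]
      simp
    · intro π _ hπ
      refine if_neg fun hc => hπ (Equiv.ext fun i => ?_)
      have := congrFun hc (π i)
      rw [Function.comp_apply, π.symm_apply_apply] at this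
      exact (hh this).symm
    · intro h
      exact absurd (Finset.mem_univ _) h
  · obtain ⟨a, b, hab, hne⟩ : ∃ a b, h a = h b ∧ a ≠ b := by
      rw [Function.Injective] at hh
      push Not at hh
      exact hh
    have hswap : ∀ i, h (Equiv.swap a b i) = h i := by
      intro i
      rcases eq_or_ne i a with rfl | ha
      · rw [Equiv.swap_apply_left, hab]
      · rcases eq_or_ne i b with rfl | hb
        · rw [Equiv.swap_apply_right, hab]
        · rw [Equiv.swap_apply_of_ne_of_ne ha hb]
    have key : ∑ π : Equiv.Perm (Fin k),
        (if h ∘ π.symm = h then ((Equiv.Perm.sign π : ℤ) : ℂ) else 0) =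
          -∑ π : Equiv.Perm (Fin k),
            (if h ∘ π.symm = h then ((Equiv.Perm.sign π : ℤ) : ℂ) else 0) := by
      rw [← Finset.sum_neg_distrib]
      refine Fintype.sum_equiv (Equiv.mulRight (Equiv.swap a b)) _ _ fun π => ?_
      have h1 : h ∘ (π * Equiv.swap a b).symm = h ∘ π.symm := by
        funext i
        exact hswap (π.symm i)
      rw [Equiv.coe_mulRight, h1, Equiv.Perm.sign_mul, Equiv.Perm.sign_swap hne]
      split_ifs
      · simp
      · simp
    exact self_eq_neg.1 key

variable {G : Type} [CommGroup G] [Finite G]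

/-- The linear character `sgn ⊗ χ⁻¹` of `G ≀ S_k`. -/
def signChar (χ : G →* ℂˣ) (k : ℕ) : Wr G k →* ℂ where
  toFun w := ((Equiv.Perm.sign w.right : ℤ) : ℂ) * ∏ i, (((χ (w.left i))⁻¹ : ℂˣ) : ℂ)
  map_one' := by simp
  map_mul' u w := by
    have h : ∏ i, (((χ ((u * w).left i))⁻¹ : ℂˣ) : ℂ) =
        (∏ i, (((χ (u.left i))⁻¹ : ℂˣ) : ℂ)) * ∏ i, (((χ (w.left i))⁻¹ : ℂˣ) : ℂ) := by
      rw [← Equiv.prod_comp u.right.symm fun i => (((χ (w.left i))⁻¹ : ℂˣ) : ℂ),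
        ← Finset.prod_mul_distrib]
      refine Finset.prod_congr rfl fun i _ => ?_
      have h1 : (u * w).left i = u.left i * w.left (u.right.symm i) := rfl
      rw [h1, map_mul, mul_inv, Units.val_mul]
    rw [h, SemidirectProduct.mul_right, Equiv.Perm.sign_mul]
    push_cast
    ring

/-- The family of representations with the linear character `sgn ⊗ χ⁻¹` in degree `k`, and zero in
the other degrees. -/
def signFam (χ : G →* ℂˣ) (k : ℕ) : WreathRep G where
  obj n := FDRep.of (V := Fin (if n = k then 1 else 0) → ℂ)
    ((algebraMap ℂ (Module.End ℂ (Fin (if n = k then 1 else 0) → ℂ))).toMonoidHom.comp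
      (signChar χ n))
  property := ⟨k + 1, fun n hn => ⟨fun _ _ => funext fun i => by
    rw [if_neg (by omega)] at i
    exact i.elim0⟩⟩

lemma character_signFam (χ : G →* ℂˣ) (k n : ℕ) (w : Wr G n) :
    ((signFam χ k).deg n).character w = if n = k then signChar χ n w else 0 := by
  change LinearMap.trace ℂ (Fin (if n = k then 1 else 0) → ℂ) (algebraMap ℂ _ (signChar χ n w)) = _
  rw [Algebra.algebraMap_eq_smul_one, map_smul, LinearMap.trace_one, Module.finrank_fin_fun,
    smul_eq_mul]
  split_ifs <;> simp

lemma card_wr (k : ℕ) : (Nat.card (Wr G k) : ℂ) = (Nat.card G : ℂ) ^ k * k.factorial := by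
  rw [Nat.card_congr SemidirectProduct.equivProd, Nat.card_prod, Nat.card_fun, Nat.card_perm]
  simp

/-- Summing over the labels in `G` selects the coordinates with index `χ`; summing over the
permutations selects the injective maps. -/
lemma sum_signChar (χ : G →* ℂˣ) (k d : ℕ) (x : Fin d → ℂ[G]) :
    ∑ᶠ w : Wr G k, signChar χ k w * cyclePowerSum w d x =
      (Nat.card G : ℂ) ^ k * (k.factorial * ∑ s ∈ Finset.powersetCard k Finset.univ,
        ∏ j ∈ s, coord x (χ, j)) := by
  classical
  let := Fintype.ofFinite (Wr G k)
  let := Fintype.ofFinite G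
  rw [finsum_eq_sum_of_fintype, ← sum_injective_prod, Finset.mul_sum]
  -- sum over the elements of `G` first
  have h1 : ∀ h : Fin k → (G →* ℂˣ) × Fin d, ∑ a : Fin k → G, ∏ i, (((χ (a i))⁻¹ : ℂˣ) : ℂ) *
      (((h i).1 (a i) : ℂ) * coord x (h i)) =
        if ∀ i, (h i).1 = χ then (Nat.card G : ℂ) ^ k * ∏ i, coord x (h i) else 0 := by
    intro h
    have h2 := Finset.prod_univ_sum (fun _ : Fin k => (Finset.univ : Finset G))
      (fun i g => (((χ g)⁻¹ : ℂˣ) : ℂ) * (((h i).1 g : ℂ) * coord x (h i)))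
    rw [Fintype.piFinset_univ] at h2
    rw [← h2]
    have h3 : ∀ i, ∑ g : G, (((χ g)⁻¹ : ℂˣ) : ℂ) * (((h i).1 g : ℂ) * coord x (h i)) =
        if (h i).1 = χ then Nat.card G * coord x (h i) else 0 := by
      intro i
      split_ifs with hi
      · rw [hi, Finset.sum_congr rfl (g := fun _ => coord x (h i)) fun g _ => by
          rw [← mul_assoc, Units.inv_mul, one_mul]]
        rw [Finset.sum_const, Finset.card_univ, Nat.card_eq_fintype_card, nsmul_eq_mul]
      · have h4 := sum_apply_char (χ := χ⁻¹ * (h i).1) fun hc => hi (inv_mul_eq_one.1 hc).symm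
        simp only [MonoidHom.mul_apply, MonoidHom.inv_apply, Units.val_mul] at h4
        simp only [← mul_assoc]
        rw [← Finset.sum_mul, h4, zero_mul]
    rw [Finset.prod_congr rfl fun i _ => h3 i, Finset.prod_ite_zero]
    simp [Finset.prod_mul_distrib]
  have h5 : ∑ w : Wr G k, signChar χ k w * cyclePowerSum w d x =
      ∑ h : Fin k → (G →* ℂˣ) × Fin d,
        (∑ π : Equiv.Perm (Fin k), if h ∘ π.symm = h then ((Equiv.Perm.sign π : ℤ) : ℂ) else 0) *
          ∑ a : Fin k → G, ∏ i, (((χ (a i))⁻¹ : ℂˣ) : ℂ) *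
            (((h i).1 (a i) : ℂ) * coord x (h i)) := by
    refine (Fintype.sum_equiv SemidirectProduct.equivProd _
      (fun p : (Fin k → G) × Equiv.Perm (Fin k) =>
        signChar χ k ⟨p.1, p.2⟩ * cyclePowerSum (⟨p.1, p.2⟩ : Wr G k) d x) fun w => rfl).trans ?_
    simp only [cyclePowerSum_eq, Finset.mul_sum]
    rw [Finset.sum_comm]
    refine Finset.sum_congr rfl fun h _ => ?_
    rw [Fintype.sum_prod_type]
    refine Finset.sum_congr rfl fun a _ => ?_
    rw [Finset.sum_mul]
    refine Finset.sum_congr rfl fun π _ => ?_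
    change ((Equiv.Perm.sign π : ℤ) : ℂ) * (∏ i, (((χ (a i))⁻¹ : ℂˣ) : ℂ)) * _ = _
    rw [Finset.prod_mul_distrib (f := fun i => (((χ (a i))⁻¹ : ℂˣ) : ℂ))]
    split_ifs <;> ring
  rw [h5]
  simp only [sum_sign_stabilizer, h1]
  symm
  refine Fintype.sum_of_injective (fun (r : Fin k → Fin d) i => (χ, r i)) (fun r r' h =>
    funext fun i => (Prod.ext_iff.1 (congrFun h i)).2) _ _ (fun h hh => ?_) fun r => ?_
  · rw [if_neg (c := ∀ i, (h i).1 = χ), mul_zero]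
    exact fun hc => hh ⟨fun i => (h i).2, funext fun i => Prod.ext (hc i).symm rfl⟩
  · have h6 : Function.Injective (fun i => (χ, r i)) ↔ Function.Injective r :=
      ⟨fun h a b hab => h (Prod.ext rfl hab), fun h a b hab => h (Prod.ext_iff.1 hab).2⟩
    simp only [h6, implies_true, if_true]
    split_ifs <;> simp

/-- The characteristic of `sgn ⊗ χ⁻¹` is an elementary symmetric function of the coordinates with
index `χ`: orthogonality of characters leaves only these coordinates, and the signs cancel all
monomials with a repeated variable. -/
lemma frob_signFam (R : Type) [CommRing R] [Algebra R ℂ] (χ : G →* ℂˣ) (k d : ℕ)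
    (x : Fin d → ℂ[G]) : frob (signFam χ k) d x = classPoly (esymmAt R d χ k) x := by
  have hG : (Nat.card G : ℂ) ≠ 0 := by exact_mod_cast Nat.card_pos.ne'
  have hk : (k.factorial : ℂ) ≠ 0 := by exact_mod_cast k.factorial_ne_zero
  have hN : ∀ n, k + 1 ≤ n → Subsingleton ((signFam χ k).deg n) := fun n hn => ⟨fun _ _ =>
    funext fun i : Fin (if n = k then 1 else 0) => by
      rw [if_neg (by omega)] at i
      exact i.elim0⟩
  rw [frob_eq_sum hN, Finset.sum_eq_single k]
  · simp only [character_signFam, if_true]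
    rw [sum_signChar, card_wr, classPoly, esymmAt, aeval_rename, esymm, map_sum, ← mul_assoc,
      ← mul_assoc, mul_assoc _ _ (k.factorial : ℂ),
      inv_mul_cancel₀ (mul_ne_zero (pow_ne_zero k hG) hk), one_mul]
    refine Finset.sum_congr rfl fun s _ => ?_
    rw [map_prod]
    refine Finset.prod_congr rfl fun j _ => ?_
    rw [aeval_X]
    rfl
  · intro n _ hn
    simp only [character_signFam, if_neg hn, zero_mul, finsum_zero, mul_zero]
  · intro h
    exact absurd (Finset.mem_range.2 (Nat.lt_succ_self k)) h

end

/-! ### Symmetric class functions are combinations of characteristics -/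

section

open MvPolynomial

/-- Setting variables to zero does not change the coefficients of the monomials without them. -/
lemma coeff_aeval_ite {σ : Type*} {R : Type*} [CommRing R] (s : σ → Prop) [DecidablePred s]
    {m : σ →₀ ℕ} (hm : ∀ p, s p → m p = 0) (Q : MvPolynomial σ R) :
    coeff m (aeval (fun p => if s p then (0 : MvPolynomial σ R) else X p) Q) = coeff m Q := by
  classical
  induction Q using MvPolynomial.induction_on' with
  | add P Q hP hQ => rw [map_add, coeff_add, coeff_add, hP, hQ]
  | monomial u c =>
    rw [aeval_monomial]
    by_cases hu : ∀ p, s p → u p = 0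
    · have h : (u.prod fun p k => (if s p then (0 : MvPolynomial σ R) else X p) ^ k) =
          u.prod fun p k => X p ^ k := by
        refine Finset.prod_congr rfl fun p hp => ?_
        beta_reduce
        rw [if_neg fun h => Finsupp.mem_support_iff.1 hp (hu p h)]
      rw [h, algebraMap_eq, ← monomial_eq]
    · push Not at hu
      obtain ⟨p, hp, hup⟩ := hu
      have h : (u.prod fun p k => (if s p then (0 : MvPolynomial σ R) else X p) ^ k) = 0 := by
        refine Finset.prod_eq_zero (Finsupp.mem_support_iff.2 hup) ?_
        beta_reduce
        rw [if_pos hp, zero_pow hup]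
      rw [h, mul_zero, coeff_zero, coeff_monomial, if_neg]
      rintro rfl
      exact hup (hm p hp)

variable {G : Type} [CommGroup G] [Finite G]

lemma coord_snoc_zero {d : ℕ} (y : (G →* ℂˣ) × Fin (d + 1) → ℂ) :
    coord (Fin.snoc (α := fun _ => ℂ[G]) (ofCoord fun p => y (p.1, p.2.castSucc)) 0) =
      fun p => if p.2 = Fin.last d then 0 else y p := by
  funext p
  obtain ⟨χ, j⟩ := p
  refine Fin.lastCases ?_ (fun i => ?_) j
  · rw [coord, Fin.snoc_last, map_zero, if_pos rfl]
  · rw [coord, Fin.snoc_castSucc, charExt_ofCoord, if_neg (Fin.castSucc_lt_last i).ne]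

/-- A symmetric polynomial of degree at most `N ≤ d` in `d + 1` variables for each character is zero
if it vanishes where the last variables are zero: for each character, a monomial misses one of the
variables, and by symmetry this can be taken to be the last one. -/
lemma eq_zero_of_vanish {d N : ℕ} (hN : N ≤ d) {Q : MvPolynomial ((G →* ℂˣ) × Fin (d + 1)) ℂ}
    (hdeg : Q.totalDegree ≤ N) (hsym : IsSym Q)
    (h0 : ∀ y : (G →* ℂˣ) × Fin (d + 1) → ℂ,
      eval (fun p => if p.2 = Fin.last d then 0 else y p) Q = 0) : Q = 0 := by
  have hφ : aeval (fun p => if p.2 = Fin.last d then (0 : MvPolynomial _ ℂ) else X p) Q = 0 := by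
    refine MvPolynomial.funext fun y => ?_
    rw [map_zero, ← h0 y, ← coe_aeval_eq_eval, ← coe_aeval_eq_eval, RingHom.coe_coe,
      RingHom.coe_coe, ← AlgHom.comp_apply, comp_aeval]
    refine congrArg (fun f => aeval f Q) (funext fun p => ?_)
    split_ifs
    · exact map_zero _
    · exact aeval_X _ _
  have hlast : ∀ m : (G →* ℂˣ) × Fin (d + 1) →₀ ℕ, (∀ χ, m (χ, Fin.last d) = 0) →
      coeff m Q = 0 := by
    intro m hm
    rw [← coeff_aeval_ite (fun p => p.2 = Fin.last d) (m := m), hφ, coeff_zero]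
    rintro ⟨χ, j⟩ (rfl : j = _)
    exact hm χ
  ext m
  rw [coeff_zero]
  by_contra hm
  have hm' := (le_totalDegree (mem_support_iff.2 hm)).trans hdeg
  have hmiss : ∀ χ, ∃ i, m (χ, i) = 0 := by
    intro χ
    by_contra hc
    push Not at hc
    have h1 : ∑ p, m p ≤ N := by
      rwa [Finsupp.sum_fintype _ _ fun _ => rfl] at hm'
    have h2 : ∑ i, m (χ, i) ≤ ∑ p, m p := by
      rw [Fintype.sum_prod_type]
      exact Finset.single_le_sum (f := fun χ => ∑ i, m (χ, i)) (fun _ _ => Nat.zero_le _)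
        (Finset.mem_univ χ)
    have h3 : ∑ _i : Fin (d + 1), 1 ≤ ∑ i, m (χ, i) :=
      Finset.sum_le_sum fun i _ => Nat.one_le_iff_ne_zero.2 (hc i)
    rw [Finset.sum_const, Finset.card_univ, Fintype.card_fin] at h3
    simp only [smul_eq_mul, mul_one] at h3
    omega
  choose i hi using hmiss
  let τ : (G →* ℂˣ) → Equiv.Perm (Fin (d + 1)) := fun χ => Equiv.swap (i χ) (Fin.last d)
  have hinj : Function.Injective fun p : (G →* ℂˣ) × Fin (d + 1) => (p.1, τ p.1 p.2) := by
    rintro ⟨χ, a⟩ ⟨ψ, b⟩ h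
    obtain ⟨rfl, h'⟩ := Prod.ext_iff.1 h
    exact Prod.ext rfl ((τ χ).injective h')
  refine hm ?_
  rw [← coeff_rename_mapDomain _ hinj, hsym τ]
  refine hlast _ fun χ => ?_
  have h1 : (χ, Fin.last d) = (fun p : (G →* ℂˣ) × Fin (d + 1) => (p.1, τ p.1 p.2)) (χ, i χ) :=
    Prod.ext rfl (Equiv.swap_apply_left _ _).symm
  rw [h1, Finsupp.mapDomain_apply hinj, hi]

/-- A stable family of symmetric polynomials of degree at most `N` is determined by its member in
`N` variables: below by setting variables to zero, and above because no symmetric polynomial of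
degree at most `N` vanishes there. -/
lemma eq_zero_of_stable {R : Type} [CommRing R] [Algebra R ℂ] {h : ∀ d, (Fin d → ℂ[G]) → ℂ} {N : ℕ}
    (h₁ : ∀ d, ∃ P : MvPolynomial ((G →* ℂˣ) × Fin d) R,
      P.totalDegree ≤ N ∧ IsSym P ∧ ∀ x, h d x = classPoly P x)
    (h₂ : ∀ d (x : Fin d → ℂ[G]), h (d + 1) (Fin.snoc (α := fun _ => ℂ[G]) x 0) = h d x)
    (h₀ : ∀ x, h N x = 0) : h = 0 := by
  have hdown : ∀ k d, d + k = N → ∀ x, h d x = 0 := by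
    intro k
    induction k with
    | zero =>
      rintro d rfl x
      exact h₀ x
    | succ k ih =>
      intro d hd x
      rw [← h₂]
      exact ih (d + 1) (by omega) _
  have hup : ∀ d, N ≤ d → ∀ x, h d x = 0 := by
    intro d hd
    induction d, hd using Nat.le_induction with
    | base => exact h₀
    | succ d hd ih =>
      obtain ⟨P, hP, hsym, hPx⟩ := h₁ (d + 1)
      have hQ : map (algebraMap R ℂ) P = 0 := by
        refine eq_zero_of_vanish hd ((Finset.sup_mono (support_map_subset _ P)).trans hP)
          (fun τ => ?_) fun y => ?_
        · rw [← map_rename, hsym τ]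
        · rw [← coord_snoc_zero, ← classPoly_eq, ← hPx, h₂, ih]
      intro x
      rw [hPx, classPoly_eq, hQ, map_zero]
  funext d x
  rcases le_total N d with hd | hd
  · exact hup d hd x
  · exact hdown (N - d) d (by omega) x

/-- A product of elementary symmetric polynomials. -/
def esymmProd (R : Type) [CommRing R] (d : ℕ) {ι : Type} (L : List (ι × ℕ)) :
    MvPolynomial (ι × Fin d) R :=
  (L.map fun p => esymmAt R d p.1 p.2).prod

lemma esymmProd_cons (R : Type) [CommRing R] (d : ℕ) {ι : Type} (p : ι × ℕ) (L : List (ι × ℕ)) :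
    esymmProd R d (p :: L) = esymmAt R d p.1 p.2 * esymmProd R d L := by
  rw [esymmProd, List.map_cons, List.prod_cons, esymmProd]

lemma isHomogeneous_esymmAt (R : Type) [CommRing R] (d : ℕ) {ι : Type} (i : ι) (k : ℕ) :
    (esymmAt R d i k).IsHomogeneous k := by
  refine IsHomogeneous.rename_isHomogeneous ?_
  rw [esymm]
  refine IsHomogeneous.sum _ _ _ fun s hs => ?_
  have h := IsHomogeneous.prod s (fun j => (X j : MvPolynomial (Fin d) R)) (fun _ => 1)
    fun j _ => isHomogeneous_X R j
  rwa [Finset.sum_const, smul_eq_mul, mul_one, (Finset.mem_powersetCard.1 hs).2] at h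

lemma isHomogeneous_esymmProd (R : Type) [CommRing R] (d : ℕ) {ι : Type} (L : List (ι × ℕ)) :
    (esymmProd R d L).IsHomogeneous (L.map Prod.snd).sum := by
  induction L with
  | nil => exact isHomogeneous_one _ _
  | cons p L ih =>
    rw [esymmProd_cons, List.map_cons, List.sum_cons]
    exact (isHomogeneous_esymmAt R d p.1 p.2).mul ih

lemma permVars_esymmProd (R : Type) [CommRing R] (d : ℕ) {ι : Type} (τ : ι → Equiv.Perm (Fin d))
    (L : List (ι × ℕ)) : permVars R τ (esymmProd R d L) = esymmProd R d L := by
  induction L with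
  | nil => exact map_one _
  | cons p L ih =>
    rw [esymmProd_cons, map_mul, ih, esymmAt, permVars, rename_rename]
    have h : (fun q : ι × Fin d => (q.1, τ q.1 q.2)) ∘ Prod.mk p.1 = Prod.mk p.1 ∘ τ p.1 := rfl
    rw [h, ← rename_rename, rename_esymm]

/-- A symmetric polynomial of degree at most `N` is a combination of products of elementary
symmetric polynomials of degree at most `N`: the homogeneous components of larger degree of any
such expression cancel. -/
lemma mem_span_esymmProd (R : Type) [CommRing R] {d N : ℕ} {ι : Type} [Finite ι]
    {P : MvPolynomial (ι × Fin d) R} (hP : ∀ τ, permVars R τ P = P) (hN : P.totalDegree ≤ N) :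
    P ∈ Submodule.span R
      {Q | ∃ L : List (ι × ℕ), (L.map Prod.snd).sum ≤ N ∧ Q = esymmProd R d L} := by
  have h1 : P ∈ Submodule.span R (Set.range (esymmProd R d (ι := ι))) := by
    have h := mem_adjoin_esymmAt ι R d P hP
    rw [← Subalgebra.mem_toSubmodule, Algebra.adjoin_eq_span] at h
    refine Submodule.span_mono ?_ h
    intro Q hQ
    induction hQ using Submonoid.closure_induction with
    | mem _ h =>
      obtain ⟨p, rfl⟩ := h
      exact ⟨[p], by rw [esymmProd, List.map_singleton, List.prod_singleton]⟩
    | one => exact ⟨[], rfl⟩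
    | mul _ _ _ _ h h' =>
      obtain ⟨L, rfl⟩ := h
      obtain ⟨L', rfl⟩ := h'
      exact ⟨L ++ L', by rw [esymmProd, List.map_append, List.prod_append, esymmProd, esymmProd]⟩
  let trunc : MvPolynomial (ι × Fin d) R →ₗ[R] MvPolynomial (ι × Fin d) R :=
    ∑ m ∈ Finset.range (N + 1), homogeneousComponent m
  have h2 : trunc P = P := by
    rw [LinearMap.sum_apply]
    conv_rhs => rw [← sum_homogeneousComponent P]
    symm
    refine Finset.sum_subset (Finset.range_mono (by omega)) fun m _ hm => ?_
    exact homogeneousComponent_eq_zero _ _ (by rw [Finset.mem_range] at hm; omega)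
  rw [← h2]
  refine Submodule.span_induction (p := fun Q _ => trunc Q ∈ Submodule.span R
    {Q | ∃ L : List (ι × ℕ), (L.map Prod.snd).sum ≤ N ∧ Q = esymmProd R d L}) ?_ ?_ ?_ ?_ h1
  · rintro _ ⟨L, rfl⟩
    rw [LinearMap.sum_apply]
    simp only [homogeneousComponent_of_mem (isHomogeneous_esymmProd R d L)]
    rw [Finset.sum_ite_eq']
    split_ifs with h
    · exact Submodule.subset_span ⟨L, by rw [Finset.mem_range] at h; omega, rfl⟩
    · exact Submodule.zero_mem _
  · rw [map_zero]
    exact Submodule.zero_mem _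
  · intro a b _ _ ha hb
    rw [map_add]
    exact Submodule.add_mem _ ha hb
  · intro c a _ ha
    rw [map_smul]
    exact Submodule.smul_mem _ c ha

/-- The induction product of the families with characteristics the given elementary symmetric
functions. -/
def esymmFam : List ((G →* ℂˣ) × ℕ) → WreathRep G
  | [] => 𝟙_ (WreathRep G)
  | p :: L => signFam p.1 p.2 ⊗ esymmFam L

lemma frob_esymmFam (R : Type) [CommRing R] [Algebra R ℂ] (L : List ((G →* ℂˣ) × ℕ)) (d : ℕ)
    (x : Fin d → ℂ[G]) : frob (esymmFam L) d x = classPoly (esymmProd R d L) x := by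
  induction L with
  | nil =>
    rw [esymmFam, frob_unit]
    exact (map_one _).symm
  | cons p L ih =>
    rw [esymmFam, frob_tensor, esymmProd_cons, classPoly, map_mul]
    exact congrArg₂ (· * ·) (frob_signFam R p.1 p.2 d x) ih

/-- The ring of symmetric polynomial class functions is spanned by the characteristics. -/
lemma mem_span_frob {R : Type} [CommRing R] [Algebra R ℂ] {f : ∀ d, (Fin d → ℂ[G]) → ℂ}
    (hf : f ∈ symClassFun G R) : f ∈ Submodule.span R (Set.range (frob (G := G))) := by
  obtain ⟨⟨N, h⟩, hsnoc⟩ := hf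
  obtain ⟨P, hPdeg, hPsym, hPx⟩ := h N
  have hP := mem_span_esymmProd R hPsym hPdeg
  -- a combination of characteristics of degree at most `N` that agrees with `f` for `d = N`
  have key : ∃ g ∈ Submodule.span R (Set.range (frob (G := G))),
      (∀ d, ∃ Q : MvPolynomial ((G →* ℂˣ) × Fin d) R,
        Q.totalDegree ≤ N ∧ IsSym Q ∧ ∀ x, g d x = classPoly Q x) ∧
      (∀ d (x : Fin d → ℂ[G]), g (d + 1) (Fin.snoc (α := fun _ => ℂ[G]) x 0) = g d x) ∧
      ∀ x, g N x = classPoly P x := by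
    clear hPx hPsym hPdeg
    induction hP using Submodule.span_induction with
    | mem Q hQ =>
      obtain ⟨L, hL, rfl⟩ := hQ
      exact ⟨frob (esymmFam L), Submodule.subset_span ⟨_, rfl⟩, fun d => ⟨esymmProd R d L,
        (isHomogeneous_esymmProd R d L).totalDegree_le.trans hL,
        fun τ => permVars_esymmProd R d τ L,
        frob_esymmFam R L d⟩, (frob_mem _).2, frob_esymmFam R L N⟩
    | zero =>
      exact ⟨0, Submodule.zero_mem _, fun d => ⟨0, by simp, fun τ => map_zero _,
        fun x => (map_zero _).symm⟩, fun _ _ => rfl, fun x => (map_zero _).symm⟩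
    | add a b _ _ ha hb =>
      obtain ⟨g, hg, hg1, hg2, hg3⟩ := ha
      obtain ⟨g', hg', hg1', hg2', hg3'⟩ := hb
      refine ⟨g + g', Submodule.add_mem _ hg hg', fun d => ?_, fun d x => ?_, fun x => ?_⟩
      · obtain ⟨Q, hQ, hQ', h⟩ := hg1 d
        obtain ⟨Q₂, hQ₂, hQ₂', h₂⟩ := hg1' d
        refine ⟨Q + Q₂, (totalDegree_add _ _).trans (max_le hQ hQ₂), fun τ => ?_, fun x => ?_⟩
        · rw [map_add, hQ' τ, hQ₂' τ]
        · rw [classPoly, map_add]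
          exact congrArg₂ (· + ·) (h x) (h₂ x)
      · exact congrArg₂ (· + ·) (hg2 d x) (hg2' d x)
      · rw [classPoly, map_add]
        exact congrArg₂ (· + ·) (hg3 x) (hg3' x)
    | smul c a _ ha =>
      obtain ⟨g, hg, hg1, hg2, hg3⟩ := ha
      refine ⟨c • g, Submodule.smul_mem _ c hg, fun d => ?_, fun d x => ?_, fun x => ?_⟩
      · obtain ⟨Q, hQ, hQ', h⟩ := hg1 d
        refine ⟨c • Q, (totalDegree_smul_le _ _).trans hQ, fun τ => ?_, fun x => ?_⟩
        · rw [map_smul, hQ' τ]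
        · rw [classPoly, map_smul]
          exact congrArg (c • ·) (h x)
      · exact congrArg (c • ·) (hg2 d x)
      · rw [classPoly, map_smul]
        exact congrArg (c • ·) (hg3 x)
  obtain ⟨g, hg, hg1, hg2, hg3⟩ := key
  have hfg : f - g = 0 := by
    refine eq_zero_of_stable (R := R) (N := N) (fun d => ?_) (fun d x => ?_) fun x => ?_
    · obtain ⟨Q, hQ, hQ', h'⟩ := h d
      obtain ⟨Q₂, hQ₂, hQ₂', h₂⟩ := hg1 d
      refine ⟨Q - Q₂, (totalDegree_sub _ _).trans (max_le hQ hQ₂), fun τ => ?_, fun x => ?_⟩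
      · rw [map_sub, hQ' τ, hQ₂' τ]
      · rw [classPoly, map_sub]
        exact congrArg₂ (· - ·) (h' x) (h₂ x)
    · exact congrArg₂ (· - ·) (hsnoc d x) (hg2 d x)
    · exact sub_eq_zero.2 ((hPx x).trans (hg3 x).symm)
  rw [sub_eq_zero.1 hfg]
  exact hg

end

/-! ### The characteristic isomorphisms -/

section

open MvPolynomial

variable {G : Type} [CommGroup G] [Finite G]

lemma chHom_surjective : Function.Surjective (chHom G) := by
  intro f
  have h : ∃ z, (chHom G z).1 = f.1 := by
    refine Submodule.span_induction (p := fun g _ => ∃ z, (chHom G z).1 = g) ?_ ?_ ?_ ?_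
      (mem_span_frob f.2)
    · rintro _ ⟨E, rfl⟩
      exact ⟨K0.mk E, congrArg Subtype.val (chHom_mk E)⟩
    · exact ⟨0, congrArg Subtype.val (map_zero (chHom G))⟩
    · rintro g g' _ _ ⟨z, rfl⟩ ⟨z', rfl⟩
      exact ⟨z + z', congrArg Subtype.val (map_add (chHom G) z z')⟩
    · rintro n g _ ⟨z, rfl⟩
      exact ⟨n • z, congrArg Subtype.val (map_zsmul (chHom G) n z)⟩
  obtain ⟨z, hz⟩ := h
  exact ⟨z, Subtype.ext hz⟩

lemma chPoly_surjective : Function.Surjective (chPoly G) := by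
  intro f
  obtain ⟨z, rfl⟩ := chHom_surjective f
  obtain ⟨E, E', rfl⟩ := K0Wreath.exists_eq_sub z
  refine ⟨K0.mk ((Xi G).obj E) - K0.mk ((Xi G).obj E'), ?_⟩
  rw [map_sub, map_sub, chPoly_mk, chPoly_mk, chHom_mk, chHom_mk]
  exact congrArg₂ (· - ·) (Subtype.ext (polyChar_xi E)) (Subtype.ext (polyChar_xi E'))

lemma symClassFun_int_le {f : ∀ d, (Fin d → ℂ[G]) → ℂ} (hf : f ∈ symClassFun G ℤ) :
    f ∈ symClassFun G ℂ := by
  obtain ⟨⟨N, h⟩, hf'⟩ := hf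
  refine ⟨⟨N, fun d => ?_⟩, hf'⟩
  obtain ⟨P, hP, hP', hP''⟩ := h d
  refine ⟨map (algebraMap ℤ ℂ) P, (Finset.sup_mono (support_map_subset _ P)).trans hP,
    fun τ => ?_, fun x => ?_⟩
  · rw [← map_rename, hP' τ]
  · rw [hP'', classPoly, classPoly, aeval_map_algebraMap]

/-- Class functions with integer coefficients that satisfy no linear relation over `ℤ` satisfy none
over `ℂ`: a relation with coefficients independent over `ℤ` is trivial. -/
lemma eq_zero_of_sum_smul_eq_zero {ι : Type*} {b : ι → ℂ} (hb : LinearIndependent ℤ b)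
    (s : Finset ι) (f : ι → symClassFun G ℤ) (h : ∑ i ∈ s, b i • (f i).1 = 0) {i : ι} (hi : i ∈ s) :
    f i = 0 := by
  refine Subtype.ext (funext fun d => ?_)
  choose P _ _ hP using fun j => (f j).2.1.choose_spec d
  have hQ : ∑ j ∈ s, b j • map (algebraMap ℤ ℂ) (P j) = 0 := by
    refine MvPolynomial.funext fun y => ?_
    have h1 := congrFun (congrFun h d) (ofCoord y)
    rw [Finset.sum_apply, Finset.sum_apply] at h1
    rw [map_sum, map_zero]
    refine Eq.trans (Finset.sum_congr rfl fun j _ => ?_) h1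
    rw [smul_eval, ← coord_ofCoord y, ← classPoly_eq, ← hP, coord_ofCoord]
    rfl
  have hPi : P i = 0 := by
    ext m
    have h2 := congrArg (coeff m) hQ
    rw [coeff_sum, coeff_zero] at h2
    refine linearIndependent_iff'.1 hb s (fun j => coeff m (P j)) ?_ i hi
    refine Eq.trans (Finset.sum_congr rfl fun j _ => ?_) h2
    rw [coeff_smul, coeff_map, zsmul_eq_mul, smul_eq_mul, mul_comm]
    rfl
  funext x
  rw [hP, hPi]
  exact map_zero _

variable (G)

/-- The characteristic map with complex coefficients. -/
def chComplex : ℂ ⊗[ℤ] K0Wreath G →ₗ[ℂ] symClassFun G ℂ :=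
  LinearMap.liftBaseChange ℂ
    (({ toFun := fun f => ⟨f.1, symClassFun_int_le f.2⟩
        map_zero' := rfl
        map_add' := fun _ _ => rfl } : symClassFun G ℤ →+ symClassFun G ℂ).comp
      (chHom G)).toIntLinearMap

variable {G}

lemma chComplex_tmul (c : ℂ) (z : K0Wreath G) :
    (chComplex G (c ⊗ₜ z)).1 = c • (chHom G z).1 := by
  rw [chComplex, LinearMap.liftBaseChange_tmul]
  rfl

lemma chComplex_injective : Function.Injective (chComplex G) := by
  refine (injective_iff_map_eq_zero _).2 fun z hz => ?_
  -- write `z` with coefficients in a finitely generated, hence free, subgroup of `ℂ`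
  obtain ⟨A, hA, hzA⟩ := TensorProduct.exists_finite_submodule_left_of_setFinite {z}
    (Set.finite_singleton z)
  obtain ⟨z', rfl⟩ := hzA rfl
  have : Module.Free ℤ A := Module.free_of_finite_type_torsion_free'
  let b := Module.Free.chooseBasis ℤ A
  obtain ⟨k, rfl⟩ := TensorProduct.eq_repr_basis_left b z'
  have hsum : ∑ i ∈ k.support, (b i : ℂ) • (chHom G (k i)).1 = 0 := by
    rw [Finsupp.sum, map_sum, map_sum] at hz
    refine Eq.trans ?_ (congrArg Subtype.val hz)
    rw [AddSubmonoidClass.coe_finsetSum]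
    refine Finset.sum_congr rfl fun i _ => ?_
    rw [LinearMap.rTensor_tmul, chComplex_tmul]
    rfl
  have hb : LinearIndependent ℤ fun i => (b i : ℂ) :=
    b.linearIndependent.map' A.subtype A.ker_subtype
  have hk : k = 0 := by
    rw [← Finsupp.support_eq_empty, Finset.eq_empty_iff_forall_notMem]
    intro i hi
    have h1 := eq_zero_of_sum_smul_eq_zero hb k.support (fun i => chHom G (k i)) hsum hi
    rw [← map_zero (chHom G)] at h1
    exact Finsupp.mem_support_iff.1 hi (chHom_injective h1)
  rw [hk, Finsupp.sum_zero_index, map_zero]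

lemma chComplex_surjective : Function.Surjective (chComplex G) := by
  intro f
  have h : ∃ z, (chComplex G z).1 = f.1 := by
    refine Submodule.span_induction (p := fun g _ => ∃ z, (chComplex G z).1 = g) ?_ ?_ ?_ ?_
      (mem_span_frob f.2)
    · rintro _ ⟨E, rfl⟩
      refine ⟨1 ⊗ₜ K0.mk E, ?_⟩
      rw [chComplex_tmul, one_smul, chHom_mk]
    · exact ⟨0, congrArg Subtype.val (map_zero (chComplex G))⟩
    · rintro g g' _ _ ⟨z, rfl⟩ ⟨z', rfl⟩
      exact ⟨z + z', congrArg Subtype.val (map_add (chComplex G) z z')⟩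
    · rintro c g _ ⟨z, rfl⟩
      exact ⟨c • z, congrArg Subtype.val (map_smul (chComplex G) c z)⟩
  obtain ⟨z, hz⟩ := h
  exact ⟨z, Subtype.ext hz⟩

variable (G)

/-- The characteristic isomorphism. -/
def chEquiv : K0Wreath G ≃+ symClassFun G ℤ :=
  AddEquiv.ofBijective (chHom G) (And.intro chHom_injective chHom_surjective)

/-- The character isomorphism on the Grothendieck group of polynomial functors. -/
def chPolyEquiv : K0Poly G ≃+ symClassFun G ℤ :=
  AddEquiv.ofBijective (chPoly G) (And.intro chPoly_injective chPoly_surjective)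

variable {G}

lemma chEquiv_mk (E : WreathRep G) : chEquiv G (K0.mk E) = ⟨frob E, frob_mem E⟩ := chHom_mk E

lemma chPolyEquiv_mk (F : PolyFun G) :
    chPolyEquiv G (K0.mk F) = ⟨polyChar F, polyChar_mem F⟩ := chPoly_mk F

end

end WreathPoly

end

theorem mainTheorem4 :
    (∀ (G : Type) [Group G] [Finite G],
      (Xi G).IsEquivalence ∧ Nonempty (Xi G).Monoidal) ∧
    (∀ (G : Type) [CommGroup G] [Finite G],
      ∃ (ch : K0Wreath G ≃+ symClassFun G ℤ)
        (chC : ℂ ⊗[ℤ] K0Wreath G ≃ₗ[ℂ] symClassFun G ℂ)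
        (ch' : K0Poly G ≃+ symClassFun G ℤ),
        (∀ E : WreathRep G, (ch (K0.mk E)).1 = frob E) ∧
        ch (K0.mk (𝟙_ (WreathRep G))) = 1 ∧
        (∀ E F : WreathRep G, ch (K0.mk (E ⊗ F)) = ch (K0.mk E) * ch (K0.mk F)) ∧
        (∀ E : WreathRep G, (chC (1 ⊗ₜ K0.mk E)).1 = frob E) ∧
        (∀ F : PolyFun G, (ch' (K0.mk F)).1 = polyChar F) ∧
        ch' (K0.mk (𝟙_ (PolyFun G))) = 1 ∧
        (∀ F H : PolyFun G, ch' (K0.mk (F ⊗ H)) = ch' (K0.mk F) * ch' (K0.mk H)) ∧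
        (∀ E : WreathRep G, ch' (K0.mk ((Xi G).obj E)) = ch (K0.mk E))) := by
  refine ⟨fun G _ _ => ⟨xi_isEquivalence, xi_monoidal⟩, fun G _ _ => ?_⟩
  refine ⟨chEquiv G,
    LinearEquiv.ofBijective (chComplex G) ⟨chComplex_injective, chComplex_surjective⟩,
    chPolyEquiv G, fun E => congrArg Subtype.val (chEquiv_mk E),
    (chEquiv_mk _).trans (Subtype.ext frob_unit), fun E F => ?_, fun E => ?_,
    fun F => congrArg Subtype.val (chPolyEquiv_mk F),
    (chPolyEquiv_mk _).trans (Subtype.ext polyChar_unit), fun F H => ?_, fun E => ?_⟩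
  · rw [chEquiv_mk, chEquiv_mk, chEquiv_mk]
    exact Subtype.ext (frob_tensor E F)
  · refine (chComplex_tmul 1 (K0.mk E)).trans ?_
    rw [one_smul, chHom_mk]
  · rw [chPolyEquiv_mk, chPolyEquiv_mk, chPolyEquiv_mk]
    exact Subtype.ext (polyChar_tensor F H)
  · rw [chPolyEquiv_mk, chEquiv_mk]
    exact Subtype.ext (polyChar_xi E)
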